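/- Let $\mathbb T=\mathbb R/2\pi\mathbb Z$, so $|\mathbb T|=2\pi$, let $\xi,\sigma>0$ and $\tfrac12<b<\tfrac58$. Consider the complex Gross-Pitaevskii equation $$i\partial_t u=-\partial_x^2u+|u|^2u+i(\xi-\sigma|u|^2)u,\qquad u(0)=u_0\in L^2(\mathbb T).$$ Let $X^{0,b}$ be the space of functions on $\mathbb T\times\mathbb R$ with finite norm $\|u\|_{X^{0,b}}=\|\langle\tau+k^2\rangle^b\,\hat u(k,\tau)\|_{\ell^2_kL^2_\tau}$, where $\langle y\rangle=(1+y^2)^{1/2}$ and $\hat u(k,\tau)=\int_{\mathbb R}\int_{\mathbb T}e^{-ikx-it\tau}u(x,t)\,dx\,dt$. For an interval $J$, let $\|u\|_{X^{0,b}_J}$ be the infimum of $\|\tilde u\|_{X^{0,b}}$ over all $\tilde u$ with $\tilde u=u$ for $t\in J$. A solution on an interval $I\ni 0$ is a function $u\in C(I;L^2(\mathbb T))$ such that, for every compact interval $J\subset I$, $u$ has finite $X^{0,b}_J$ norm and $|u|^2u\in L^1(J\times\mathbb T)$, and such that, for all $t\in I$ (in the sense of spatial Fourier coefficients), $$u(t)=e^{it\partial_x^2}u_0+\int_0^te^{i(t-\tau)\partial_x^2}\big(\xi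 u-(\sigma+i)|u|^2u\big)(\tau)\,d\tau .$$ Then the equation is globally well-posed in $L^2(\mathbb T)$ for $t\ge 0$, that is: 1. (Existence) For every $u_0\in L^2(\mathbb T)$ there is a solution on $[0,\infty)$ with initial value $u_0$. 2. (Uniqueness) Two solutions on the same interval $I\ni0$ with the same initial value coincide on $I$. 3. (Extension) Every local solution on $[-\delta,\delta]$, $\delta>0$, extends to a solution on $[-\delta,\infty)$. 4. (Continuous dependence) For every $T>0$, the map taking $u_0\in L^2(\mathbb T)$ to the solution is continuous into $C([0,T];L^2(\mathbb T))\cap X^{0,b}_{[0,T]}$. Moreover, every solution on $[0,\infty)$ satisfies $$\|u(t)\|_{L^2}^2\le\|u_0\|_{L^2}^2e^{-2\xi t}+\frac{2\xi}{\sigma}|\mathbb T|\big(1-e^{-2\xi t}\big),\qquad t\ge0,$$ and for every $\rho>\frac{2\xi}{\sigma}|\mathbb T|$ the ball $\{v\in L^2(\mathbb T):\|v\|_{L^2}^2\le\rho\}$ is absorbing: for every $M$ there is $t_0\ge0$ such that $\|u(t)\|_{L^2}^2\le\rho$ for all $t\ge t_0$ and every solution $u$ on $[0,\infty)$ with $\|u_0\|_{L^2}\le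 M$. -/

import Mathlib

open MeasureTheory Set
open scoped Real ENNReal FourierTransform

noncomputable section

/-- The one-dimensional torus `ℝ / 2πℤ`. -/
abbrev Torus : Type := AddCircle (2 * π)

instance instFactTwoPiPos : Fact (0 < 2 * π) := ⟨Real.two_pi_pos⟩

/-- `L²(𝕋)`, with respect to Lebesgue measure of total mass `2π`. -/
abbrev L2T : Type := Lp ℂ 2 (volume : Measure Torus)

/-- `L²(ℝ; L²(𝕋))`, that is, `L²(𝕋 × ℝ)`. -/
abbrev L2SpaceTime : Type := Lp L2T 2 (volume : Measure ℝ)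

/-- The spatial Fourier transform `𝓕ₓ g (k) = ∫_𝕋 e^{-ikx} g(x) dx`. -/
def spaceFourier (g : Torus → ℂ) (k : ℤ) : ℂ :=
  ∫ x : Torus, fourier (-k) x * g x

/-- The space-time Fourier transform
`û(k, τ) = ∫_ℝ ∫_𝕋 e^{-ikx - itτ} u(x, t) dx dt` of `u ∈ L²(𝕋 × ℝ)`, defined for almost every `τ`.
The transform in time is Mathlib's Plancherel transform `𝓕` on `L²(ℝ; L²(𝕋))`; its kernel is
`e^{-2πi t r}`, so it is evaluated at `r = τ / 2π`. -/
def spaceTimeFourier (f : L2SpaceTime) (k : ℤ) (τ : ℝ) : ℂ :=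
  spaceFourier ((𝓕 f : L2SpaceTime) (τ / (2 * π))) k

/-- The norm `‖f‖_{X^{0,b}} = ‖⟨τ + k²⟩^b f̂(k, τ)‖_{ℓ²_k L²_τ}`, with values in `[0, ∞]`, where
`⟨y⟩ = (1 + y²)^{1/2}`. For `b ≥ 0` the space `X^{0,b}` consists of those `f ∈ L²(𝕋 × ℝ)` for
which it is finite. -/
def bourgainNorm (b : ℝ) (f : L2SpaceTime) : ℝ≥0∞ :=
  (∑' k : ℤ, ∫⁻ τ : ℝ,
    (ENNReal.ofReal ((1 + (τ + (k : ℝ) ^ 2) ^ 2) ^ (b / 2)) * ‖spaceTimeFourier f k τ‖ₑ) ^ 2)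
      ^ (1 / 2 : ℝ)

/-- The norm of the restriction space `X^{0,b}_J` on the time set `J`: the infimum of the
`X^{0,b}` norms of all functions that agree with `u` on `J`. It is `∞` if there are none in
`X^{0,b}`. -/
def restrictedNorm (b : ℝ) (J : Set ℝ) (u : ℝ → L2T) : ℝ≥0∞ :=
  ⨅ (f : L2SpaceTime) (_ : ∀ᵐ t ∂(volume.restrict J), f t = u t), bourgainNorm b f

/-- `u` is a solution on the time interval `I` (an interval containing `0`), with initial value
`u₀ ∈ L²(𝕋)`, of the complex Gross-Pitaevskii equation
`i ∂ₜu = -∂ₓ²u + |u|² u + i (ξ - σ |u|²) u`, in the class `C(I; L²(𝕋)) ∩ X^{0,b}_loc(I)`.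
The equation is Duhamel's formula
`u(t) = S(t) u₀ + ∫₀ᵗ S(t - τ) (ξ u - (σ + i) |u|² u)(τ) dτ`, `S(t) = e^{it∂ₓ²}`, written for each
Fourier coefficient, since `|u|² u` need not take values in `L²(𝕋)`. -/
structure IsSolutionOn (ξ σ b : ℝ) (I : Set ℝ) (u₀ : L2T) (u : ℝ → L2T) : Prop where
  continuousOn : ContinuousOn u I
  mem_restricted : ∀ a c : ℝ, Icc a c ⊆ I → restrictedNorm b (Icc a c) u < ∞
  /-- The nonlinearity is integrable in space-time, so that the integrals in Duhamel's formula
  converge absolutely. -/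
  integrable_cubic : ∀ a c : ℝ, Icc a c ⊆ I →
    ∫⁻ t in Icc a c, ∫⁻ x : Torus, ‖u t x‖ₑ ^ 3 < ∞
  duhamel : ∀ t ∈ I, ∀ k : ℤ,
    spaceFourier (u t) k =
      Complex.exp (-(Complex.I * (k : ℂ) ^ 2 * (t : ℂ))) * spaceFourier u₀ k +
      ∫ τ in (0 : ℝ)..t, Complex.exp (-(Complex.I * (k : ℂ) ^ 2 * ((t - τ : ℝ) : ℂ))) *
        ((ξ : ℂ) * spaceFourier (u τ) k -
          ((σ : ℂ) + Complex.I) *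
            spaceFourier (fun x => ((‖u τ x‖ ^ 2 : ℝ) : ℂ) * u τ x) k)

end

/-! The problem is solved in space-time `L⁴`. By Hölder the cubic term maps `L⁴` to `L^{4/3}`, and
the loop is closed by Bourgain's periodic Strichartz estimate: `X^{0,β} ⊆ L⁴` for `β > 3/8`
(`exists_strichartz`) and its dual `L^{4/3} ⊆ X^{0,-β}` (`exists_dual_strichartz`). In the
interaction picture the forcing is the time derivative of the Fourier coefficients, so passing from
forcing to solution gains one power of the weight: `L^{4/3} → X^{0,-(1-b)} → X^{0,b} → L⁴`. The
first arrow needs `1 - b > 3/8`. The condition `b > 1/2` makes the weighted coefficients have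
integrable transforms, so that they are continuous in time. The result is `exists_linear_estimate`.

The Strichartz estimate follows by squaring. The fourth power of the `L⁴` norm of a trigonometric
polynomial is controlled by the `ℓ²` norm of the autocorrelation of its coefficients. After
Plancherel in time and a weighted Cauchy-Schwarz inequality it remains to bound, uniformly in the
output frequencies `(n, τ)`, a kernel whose resonance function is a quadratic polynomial in `k`.
Away from at most two points this polynomial is large, so the sum over `k` converges.

A contraction needs a small factor. On an interval of length `δ` the free evolution has `L⁴` norm at
most `κ(δ)‖u₀‖` with `κ(δ) → 0`: a Gaussian cutoff at scale `δ` has small weighted norm when the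
exponent is below `1/2`. Data of norm at most `M` are therefore solved on an interval whose length
depends on `M` alone, with as small an `L⁴` norm as desired (`exists_local_solution`). Conversely,
every solution in the sense of the statement has an `L⁴` representative (`exists_isL4Solution`). On
short intervals the difference of two such solutions absorbs its own nonlinear term, which gives
uniqueness and Lipschitz dependence.

Global existence rests on the mass identity `d/dt ‖u‖² = 2ξ‖u‖² - 2σ‖u‖₄⁴`
(`IsL4Solution.sq_norm_sub_eq`). It holds for each Fourier mode and passes to the sum by the duality
of `L^{4/3}` and `L⁴`. Since `‖u‖₂⁴ ≤ 2π‖u‖₄⁴`, Gronwall's inequality gives the stated bound. Large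
balls of `L²` are thus invariant, the local step length never shrinks, and local solutions can be
glued indefinitely. The same invariance makes the Lipschitz estimate iterable, and absorption is
read off from the bound. -/

noncomputable section

/-! ### Frequency weights and the resonance kernel. -/

/-- The weight `1 + (2πr)²`, the square of the Japanese bracket of the angular frequency `2πr`. -/
def freqWeight (r : ℝ) : ℝ := 1 + (2 * π * r) ^ 2

lemma one_le_freqWeight (r : ℝ) : 1 ≤ freqWeight r := by
  unfold freqWeight; nlinarith [sq_nonneg (2 * π * r)]

lemma freqWeight_pos (r : ℝ) : 0 < freqWeight r := one_pos.trans_le (one_le_freqWeight r)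

@[fun_prop]
lemma continuous_freqWeight : Continuous freqWeight := by
  unfold freqWeight; fun_prop

@[fun_prop]
lemma continuous_freqWeight_rpow (s : ℝ) : Continuous fun r => freqWeight r ^ s :=
  continuous_freqWeight.rpow_const fun r => Or.inl (freqWeight_pos r).ne'

lemma integrable_freqWeight_rpow {γ : ℝ} (hγ : 1 / 2 < γ) :
    Integrable fun r : ℝ => freqWeight r ^ (-γ) := by
  have h := integrable_rpow_neg_one_add_norm_sq (E := ℝ) (μ := volume) (r := 2 * γ)
    (by simp; linarith)
  have h2 := h.comp_mul_left' (R := 2 * π) (by positivity)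
  refine h2.congr (Filter.Eventually.of_forall fun r => ?_)
  simp only [freqWeight, Real.norm_eq_abs, sq_abs]
  congr 1; ring

lemma freqWeight_add_le (x y : ℝ) : freqWeight (x + y) ≤ 4 * max (freqWeight x) (freqWeight y) := by
  have hπ := Real.pi_pos
  unfold freqWeight
  rcases le_total (x ^ 2) (y ^ 2) with h | h
  · refine le_trans ?_ (mul_le_mul_of_nonneg_left (le_max_right _ _) (by norm_num))
    nlinarith [sq_nonneg (x - y), mul_nonneg (sq_nonneg π) (sq_nonneg (x - y)),
      mul_nonneg (sq_nonneg π) (sub_nonneg.2 h)]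
  · refine le_trans ?_ (mul_le_mul_of_nonneg_left (le_max_left _ _) (by norm_num))
    nlinarith [sq_nonneg (x - y), mul_nonneg (sq_nonneg π) (sq_nonneg (x - y)),
      mul_nonneg (sq_nonneg π) (sub_nonneg.2 h)]

/-- The larger weight is at least a quarter of the weight at `x + y`. Spend the power `β - 1/8` of
it there and pass the remaining `1/8` to the smaller weight. The threshold `3/8` makes both
exponents work: `β + 1/8 > 1/2` is integrable in `x`, and `β - 1/8 > 1/4` is summable against
quartic growth in `k`. -/
lemma freqWeight_mul_le {β : ℝ} (hβ : 3 / 8 < β) (x y : ℝ) :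
    freqWeight x ^ (-β) * freqWeight y ^ (-β) ≤
      4 ^ (β - 1 / 8) * freqWeight (x + y) ^ (-(β - 1 / 8)) *
        (freqWeight x ^ (-(β + 1 / 8)) + freqWeight y ^ (-(β + 1 / 8))) := by
  have key : ∀ x y : ℝ, freqWeight y ≤ freqWeight x →
      freqWeight x ^ (-β) * freqWeight y ^ (-β) ≤
      4 ^ (β - 1 / 8) * freqWeight (x + y) ^ (-(β - 1 / 8)) * freqWeight y ^ (-(β + 1 / 8)) := by
    intro x y hxy
    have hx := freqWeight_pos x
    have hy := freqWeight_pos y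
    have hz := freqWeight_pos (x + y)
    have h1 : freqWeight x ^ (-(β - 1 / 8)) ≤
        4 ^ (β - 1 / 8) * freqWeight (x + y) ^ (-(β - 1 / 8)) := by
      rw [Real.rpow_neg hx.le, Real.rpow_neg hz.le, ← div_eq_mul_inv, inv_eq_one_div,
        div_le_div_iff₀ (by positivity) (by positivity), one_mul,
        ← Real.mul_rpow (by norm_num) hx.le]
      refine Real.rpow_le_rpow hz.le ?_ (by linarith)
      have := freqWeight_add_le x y
      rwa [max_eq_left hxy] at this
    have h2 : freqWeight x ^ (-(1 / 8 : ℝ)) ≤ freqWeight y ^ (-(1 / 8 : ℝ)) :=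
      Real.rpow_le_rpow_of_nonpos hy hxy (by norm_num)
    calc freqWeight x ^ (-β) * freqWeight y ^ (-β)
        = freqWeight x ^ (-(β - 1 / 8)) * (freqWeight x ^ (-(1 / 8 : ℝ)) * freqWeight y ^ (-β)) := by
          rw [← mul_assoc, ← Real.rpow_add hx]; congr 2; ring
      _ ≤ (4 ^ (β - 1 / 8) * freqWeight (x + y) ^ (-(β - 1 / 8))) *
          (freqWeight y ^ (-(1 / 8 : ℝ)) * freqWeight y ^ (-β)) := by gcongr
      _ = _ := by rw [← Real.rpow_add hy]; congr 2; ring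
  have hx := freqWeight_pos x
  have hy := freqWeight_pos y
  have hz := freqWeight_pos (x + y)
  rcases le_total (freqWeight y) (freqWeight x) with h | h
  · refine (key x y h).trans ?_
    exact mul_le_mul_of_nonneg_left (le_add_of_nonneg_left (by positivity)) (by positivity)
  · have := key y x h
    rw [mul_comm (freqWeight y ^ _), add_comm y x] at this
    refine this.trans ?_
    have h3 : 0 ≤ freqWeight y ^ (-(β + 1 / 8)) := by positivity
    exact mul_le_mul_of_nonneg_left (le_add_of_nonneg_right h3) (by positivity)

/-- The phase equals `2(k - n/2)² + B`. For `B ≥ 0` it dominates `(k - n/2)²`. For `B = -2α²` it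
factors as `2(m - α)(m + α)` with `m = k - n/2`, and the larger factor is at least the smaller one
in absolute value, so the distance to the nearer root enters squared. -/
lemma freqWeight_ge_quartic_dist (n : ℤ) (τ : ℝ) : ∃ x₁ x₂ : ℝ, ∀ k : ℤ,
    (1 + ((k : ℝ) - x₁) ^ 4 ≤ freqWeight (τ + ((k : ℝ) ^ 2 + ((n : ℝ) - k) ^ 2) / (2 * π))) ∨
    (1 + ((k : ℝ) - x₂) ^ 4 ≤ freqWeight (τ + ((k : ℝ) ^ 2 + ((n : ℝ) - k) ^ 2) / (2 * π))) := by
  have hW : ∀ k : ℤ, freqWeight (τ + ((k : ℝ) ^ 2 + ((n : ℝ) - k) ^ 2) / (2 * π)) =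
      1 + (2 * ((k : ℝ) - n / 2) ^ 2 + (2 * π * τ + (n : ℝ) ^ 2 / 2)) ^ 2 := by
    intro k
    unfold freqWeight
    congr 2
    field_simp
    ring
  simp_rw [hW]
  set B := 2 * π * τ + (n : ℝ) ^ 2 / 2
  rcases le_total 0 B with hB | hB
  · refine ⟨n / 2, n / 2, fun k => Or.inl ?_⟩
    have h0 := sq_nonneg ((k : ℝ) - n / 2)
    nlinarith [mul_nonneg h0 hB, mul_nonneg h0 h0, sq_nonneg B]
  · set α := √(-B / 2)
    have hα : B = -2 * α ^ 2 := by
      rw [Real.sq_sqrt (by linarith)]; ring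
    refine ⟨n / 2 - α, n / 2 + α, fun k => ?_⟩
    rw [hα]
    set m := (k : ℝ) - n / 2
    have e1 : (k : ℝ) - (n / 2 - α) = m + α := by ring
    have e2 : (k : ℝ) - (n / 2 + α) = m - α := by ring
    rw [e1, e2]
    have e : (2 * m ^ 2 + -2 * α ^ 2) ^ 2 = 4 * ((m - α) ^ 2 * (m + α) ^ 2) := by ring
    rw [e]
    have h1 := sq_nonneg (m - α)
    have h2 := sq_nonneg (m + α)
    rcases le_total ((m - α) ^ 2) ((m + α) ^ 2) with h | h
    · right
      nlinarith [mul_le_mul_of_nonneg_left h h1, mul_nonneg h1 h2]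
    · left
      nlinarith [mul_le_mul_of_nonneg_left h h2, mul_nonneg h1 h2]

/-- Uniformity in `x` comes from shifting the summation by `⌊x⌋`, after which only the fractional
part is left. The majorant is centred at `-1/2`, so that none of its terms is singular. -/
lemma exists_tsum_quartic_le {s : ℝ} (hs : 1 / 4 < s) : ∃ C : ℝ≥0∞, C ≠ ∞ ∧ ∀ x : ℝ,
    ∑' k : ℤ, ENNReal.ofReal ((1 + ((k : ℝ) - x) ^ 4) ^ (-s)) ≤ C := by
  refine ⟨∑' j : ℤ, ENNReal.ofReal (128 ^ s * (1 / |(j : ℝ) + 1 / 2| ^ (4 * s))), ?_, fun x => ?_⟩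
  · refine Summable.tsum_ofReal_ne_top ?_
    exact ((Real.summable_one_div_int_add_rpow (1 / 2) (4 * s)).2 (by linarith)).mul_left _
  · rw [← (Equiv.addRight ⌊x⌋).tsum_eq]
    refine ENNReal.tsum_le_tsum fun j => ENNReal.ofReal_le_ofReal ?_
    have h0 := Int.fract_nonneg x
    have h1 := Int.fract_lt_one x
    have hx : (((Equiv.addRight ⌊x⌋) j : ℤ) : ℝ) - x = j - Int.fract x := by
      simp only [Equiv.coe_addRight, Int.cast_add]
      rw [← Int.self_sub_floor]; ring
    rw [hx]
    set θ := Int.fract x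
    have hj : 0 < |(j : ℝ) + 1 / 2| := by
      rw [abs_pos]
      intro h
      have : (2 * j + 1 : ℤ) = 0 := by
        have : ((2 * j + 1 : ℤ) : ℝ) = 0 := by push_cast; linarith
        exact_mod_cast this
      omega
    have hy : |(j : ℝ) + 1 / 2| ≤ 2 + |(j : ℝ) - θ| := by
      have : (j : ℝ) + 1 / 2 = (j - θ) + (θ + 1 / 2) := by ring
      rw [this]
      refine (abs_add_le _ _).trans ?_
      rw [abs_of_nonneg (by linarith : 0 ≤ θ + 1 / 2)]
      linarith
    -- The constant comes from `(2 + z)⁴ ≤ 8(2⁴ + z⁴) ≤ 128(1 + z⁴)`.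
    have hpow : |(j : ℝ) + 1 / 2| ^ (4 : ℕ) ≤ 128 * (1 + ((j : ℝ) - θ) ^ 4) := by
      have e : ((j : ℝ) - θ) ^ 4 = |(j : ℝ) - θ| ^ 4 := by
        rw [← abs_pow, abs_of_nonneg (by positivity)]
      rw [e]
      have hz := abs_nonneg ((j : ℝ) - θ)
      generalize |(j : ℝ) - θ| = z at *
      calc |(j : ℝ) + 1 / 2| ^ (4 : ℕ) ≤ (2 + z) ^ 4 := by gcongr
        _ ≤ _ := by nlinarith [sq_nonneg (z - 2), sq_nonneg (z ^ 2 - 4), sq_nonneg (z ^ 2 - 2 * z)]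
    have hp : 0 < 1 + ((j : ℝ) - θ) ^ 4 := by positivity
    rw [Real.rpow_neg hp.le, inv_eq_one_div, mul_one_div,
      div_le_div_iff₀ (by positivity) (by positivity), one_mul,
      ← Real.mul_rpow (by norm_num) hp.le, Real.rpow_mul hj.le]
    refine Real.rpow_le_rpow (by positivity) ?_ (by linarith)
    rw [show (4 : ℝ) = ((4 : ℕ) : ℝ) by norm_num, Real.rpow_natCast]
    exact_mod_cast hpow

/-- The resonance kernel bound behind the `L⁴` Strichartz estimate on the torus. -/
theorem exists_sum_lintegral_freqWeight_le {β : ℝ} (hβ : 3 / 8 < β) :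
    ∃ C : ℝ≥0∞, C ≠ ∞ ∧ ∀ (s : Finset ℤ) (n : ℤ) (τ : ℝ),
      ∑ k ∈ s, ∫⁻ x : ℝ, ENNReal.ofReal
        (freqWeight (x + (k : ℝ) ^ 2 / (2 * π)) ^ (-β) *
          freqWeight (τ - x + ((n : ℝ) - k) ^ 2 / (2 * π)) ^ (-β)) ≤ C := by
  obtain ⟨C, hC, hsum⟩ := exists_tsum_quartic_le (s := β - 1 / 8) (by linarith)
  set I : ℝ≥0∞ := ∫⁻ x : ℝ, ENNReal.ofReal (freqWeight x ^ (-(β + 1 / 8)))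
  have hI : I ≠ ∞ := by
    have := (integrable_freqWeight_rpow (γ := β + 1 / 8) (by linarith))
    exact (this.lintegral_lt_top).ne
  refine ⟨ENNReal.ofReal (4 ^ (β - 1 / 8)) * (I + I) * (C + C), by finiteness, fun s n τ => ?_⟩
  obtain ⟨x₁, x₂, hx⟩ := freqWeight_ge_quartic_dist n τ
  have hk : ∀ k : ℤ, ∫⁻ x : ℝ, ENNReal.ofReal
        (freqWeight (x + (k : ℝ) ^ 2 / (2 * π)) ^ (-β) *
          freqWeight (τ - x + ((n : ℝ) - k) ^ 2 / (2 * π)) ^ (-β)) ≤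
      ENNReal.ofReal (4 ^ (β - 1 / 8)) * (I + I) *
        (ENNReal.ofReal ((1 + ((k : ℝ) - x₁) ^ 4) ^ (-(β - 1 / 8))) +
          ENNReal.ofReal ((1 + ((k : ℝ) - x₂) ^ 4) ^ (-(β - 1 / 8)))) := by
    intro k
    -- The arguments of the two weights add up to `z`, which does not depend on `x`. The factor with
    -- `z` therefore leaves the integral and carries all the decay in `k`.
    set z := τ + ((k : ℝ) ^ 2 + ((n : ℝ) - k) ^ 2) / (2 * π)
    have hz := freqWeight_pos z
    have hzle : ENNReal.ofReal (freqWeight z ^ (-(β - 1 / 8))) ≤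
        ENNReal.ofReal ((1 + ((k : ℝ) - x₁) ^ 4) ^ (-(β - 1 / 8))) +
          ENNReal.ofReal ((1 + ((k : ℝ) - x₂) ^ 4) ^ (-(β - 1 / 8))) := by
      rcases hx k with h | h
      · exact (ENNReal.ofReal_le_ofReal (Real.rpow_le_rpow_of_nonpos (by positivity) h
          (by linarith))).trans (self_le_add_right _ _)
      · exact (ENNReal.ofReal_le_ofReal (Real.rpow_le_rpow_of_nonpos (by positivity) h
          (by linarith))).trans (self_le_add_left _ _)
    calc _ ≤ ∫⁻ x : ℝ, ENNReal.ofReal (4 ^ (β - 1 / 8)) *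
          ENNReal.ofReal (freqWeight z ^ (-(β - 1 / 8))) *
          (ENNReal.ofReal (freqWeight (x + (k : ℝ) ^ 2 / (2 * π)) ^ (-(β + 1 / 8))) +
            ENNReal.ofReal (freqWeight (τ - x + ((n : ℝ) - k) ^ 2 / (2 * π)) ^ (-(β + 1 / 8)))) := by
          refine lintegral_mono fun x => ?_
          have h1 := freqWeight_pos (x + (k : ℝ) ^ 2 / (2 * π))
          have h2 := freqWeight_pos (τ - x + ((n : ℝ) - k) ^ 2 / (2 * π))
          rw [← ENNReal.ofReal_mul (by positivity), ← ENNReal.ofReal_add (by positivity)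
            (by positivity), ← ENNReal.ofReal_mul (by positivity)]
          refine ENNReal.ofReal_le_ofReal ?_
          have := freqWeight_mul_le hβ (x + (k : ℝ) ^ 2 / (2 * π))
            (τ - x + ((n : ℝ) - k) ^ 2 / (2 * π))
          rwa [show x + (k : ℝ) ^ 2 / (2 * π) + (τ - x + ((n : ℝ) - k) ^ 2 / (2 * π)) = z by
            simp only [z]; ring] at this
      _ = ENNReal.ofReal (4 ^ (β - 1 / 8)) * ENNReal.ofReal (freqWeight z ^ (-(β - 1 / 8))) *
          (I + I) := by
          have hm : Measurable fun x : ℝ => ENNReal.ofReal (freqWeight x ^ (-(β + 1 / 8))) :=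
            (continuous_freqWeight_rpow _).measurable.ennreal_ofReal
          rw [lintegral_const_mul _ (by fun_prop), lintegral_add_left (by fun_prop)]
          congr 2
          · exact lintegral_add_right_eq_self
              (fun x => ENNReal.ofReal (freqWeight x ^ (-(β + 1 / 8)))) _
          · have := lintegral_sub_left_eq_self
              (fun x => ENNReal.ofReal (freqWeight x ^ (-(β + 1 / 8))))
                (τ + ((n : ℝ) - k) ^ 2 / (2 * π)) (μ := volume)
            refine Eq.trans ?_ this
            refine lintegral_congr fun x => ?_
            congr 3; ring
      _ ≤ _ := by
          rw [mul_right_comm]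
          gcongr
  calc _ ≤ ∑ k ∈ s, ENNReal.ofReal (4 ^ (β - 1 / 8)) * (I + I) *
        (ENNReal.ofReal ((1 + ((k : ℝ) - x₁) ^ 4) ^ (-(β - 1 / 8))) +
          ENNReal.ofReal ((1 + ((k : ℝ) - x₂) ^ 4) ^ (-(β - 1 / 8)))) :=
        Finset.sum_le_sum fun k _ => hk k
    _ ≤ _ := by
        rw [← Finset.mul_sum, Finset.sum_add_distrib]
        gcongr
        · exact (ENNReal.sum_le_tsum s).trans (hsum x₁)
        · exact (ENNReal.sum_le_tsum s).trans (hsum x₂)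

/-! ### The Plancherel transform of Hilbert space valued functions, tested by functionals. -/

section PlancherelTransform

open SchwartzMap

lemma ae_eq_of_forall_integral_schwartz_mul_eq {f g : ℝ → ℂ} (hf : LocallyIntegrable f)
    (hg : LocallyIntegrable g) (h : ∀ φ : 𝓢(ℝ, ℂ), ∫ x, φ x * f x = ∫ x, φ x * g x) :
    f =ᵐ[volume] g := by
  refine ae_eq_of_integral_contDiff_smul_eq hf hg fun ψ hψ hc => ?_
  have hg₁ : HasCompactSupport (Complex.ofRealCLM ∘ ψ) := hc.comp_left rfl
  have hg₂ : ContDiff ℝ (⊤ : ℕ∞) (Complex.ofRealCLM ∘ ψ) :=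
    Complex.ofRealCLM.contDiff.comp hψ
  simpa using h (hg₁.toSchwartzMap hg₂)

variable {F : Type*} [NormedAddCommGroup F] [InnerProductSpace ℂ F] [CompleteSpace F]

/-- The Plancherel transform on `L²` agrees with the transform of tempered distributions, which is
defined by transposition; `L` commutes with the Bochner integral. -/
lemma integral_schwartz_mul_clm_fourier_L2 (f : Lp F 2 (volume : Measure ℝ)) (L : F →L[ℂ] ℂ) (φ : 𝓢(ℝ, ℂ)) :
    ∫ r, φ r * L ((𝓕 f : Lp F 2 (volume : Measure ℝ)) r) = ∫ t, 𝓕 (φ : ℝ → ℂ) t * L (f t) := by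
  have hint : ∀ (φ : 𝓢(ℝ, ℂ)) (f : Lp F 2 (volume : Measure ℝ)), Integrable fun r => φ r • f r := by
    intro φ f
    have h1 : MemLp (fun r => φ r • f r) 1 :=
      MemLp.smul (p := 2) (q := 2) (r := 1) (Lp.memLp f) (φ.memLp 2)
    exact memLp_one_iff_integrable.1 h1
  have key := congrArg (fun T => T φ) (Lp.fourier_toTemperedDistribution_eq f)
  simp only [TemperedDistribution.fourier_apply, Lp.toTemperedDistribution_apply] at key
  have h1 := L.integral_comp_comm (hint φ (𝓕 f))
  have h2 := L.integral_comp_comm (hint (𝓕 φ) f)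
  simp only [map_smul, smul_eq_mul] at h1 h2
  rw [h1, ← key, ← h2, SchwartzMap.fourier_coe]

omit [CompleteSpace F] in
lemma locallyIntegrable_clm_L2 (f : Lp F 2 (volume : Measure ℝ)) (L : F →L[ℂ] ℂ) :
    LocallyIntegrable fun r => L (f r) :=
  (L.comp_memLp' (Lp.memLp f)).locallyIntegrable (by norm_num)

lemma integral_fourier_mul_comm {f g : ℝ → ℂ} (hf : Integrable f) (hg : Integrable g) :
    ∫ t, 𝓕 f t * g t = ∫ r, f r * 𝓕 g r := by
  have := VectorFourier.integral_bilin_fourierIntegral_eq_flip (ContinuousLinearMap.mul ℂ ℂ)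
    (L := innerₗ ℝ) (μ := volume) (ν := volume) Real.continuous_fourierChar continuous_inner hf hg
  simpa [Real.fourier_eq, VectorFourier.fourierIntegral, flip_innerₗ] using this

/-- If `L ∘ f` is integrable, then the Plancherel transform of `f` is given, after `L`, by the
Fourier integral. -/
lemma clm_fourier_L2_ae_eq (f : Lp F 2 (volume : Measure ℝ)) (L : F →L[ℂ] ℂ)
    (hf : Integrable fun t => L (f t)) :
    (fun r => L ((𝓕 f : Lp F 2 (volume : Measure ℝ)) r)) =ᵐ[volume] 𝓕 (fun t => L (f t)) := by
  refine ae_eq_of_forall_integral_schwartz_mul_eq (locallyIntegrable_clm_L2 _ L) ?_ fun φ => ?_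
  · exact (VectorFourier.fourierIntegral_continuous Real.continuous_fourierChar
      continuous_inner hf).locallyIntegrable
  · rw [integral_schwartz_mul_clm_fourier_L2, integral_fourier_mul_comm φ.integrable hf]

/-- If `L ∘ 𝓕 f` is integrable, then `L ∘ f` is its inverse Fourier integral. -/
lemma clm_L2_ae_eq_fourierInv (f : Lp F 2 (volume : Measure ℝ)) (L : F →L[ℂ] ℂ)
    (hf : Integrable fun r => L ((𝓕 f : Lp F 2 (volume : Measure ℝ)) r)) :
    (fun t => L (f t)) =ᵐ[volume] 𝓕⁻ (fun r => L ((𝓕 f : Lp F 2 (volume : Measure ℝ)) r)) := by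
  have hcont : Continuous (𝓕⁻ fun r => L ((𝓕 f : Lp F 2 (volume : Measure ℝ)) r)) := by
    have h : Continuous (𝓕 fun r => L ((𝓕 f : Lp F 2 (volume : Measure ℝ)) r)) :=
      VectorFourier.fourierIntegral_continuous Real.continuous_fourierChar continuous_inner hf
    exact (h.comp continuous_neg).congr fun x => (Real.fourierInv_eq_fourier_neg _ x).symm
  refine ae_eq_of_forall_integral_schwartz_mul_eq (locallyIntegrable_clm_L2 _ L)
    hcont.locallyIntegrable fun φ => ?_
  have h1 := integral_schwartz_mul_clm_fourier_L2 f L (𝓕⁻ φ)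
  have e : 𝓕 ((𝓕⁻ φ : 𝓢(ℝ, ℂ)) : ℝ → ℂ) = φ := by
    rw [← SchwartzMap.fourier_coe, FourierTransform.fourier_fourierInv_eq]
  rw [e] at h1
  rw [← h1]
  have h2 := integral_fourier_mul_comm (𝓕⁻ φ : 𝓢(ℝ, ℂ)).integrable
    (hf.comp_neg)
  rw [e] at h2
  have h3 : 𝓕⁻ (fun r => L ((𝓕 f : Lp F 2 (volume : Measure ℝ)) r)) =
      𝓕 (fun r => L ((𝓕 f : Lp F 2 (volume : Measure ℝ)) (-r))) := by
    ext x
    rw [Real.fourierInv_eq_fourier_comp_neg]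
  rw [h3]
  have h4 := integral_fourier_mul_comm (φ.integrable (μ := volume)) hf.comp_neg
  rw [← h4]
  rw [← integral_neg_eq_self]
  refine integral_congr_ae (Filter.Eventually.of_forall fun x => ?_)
  beta_reduce
  rw [SchwartzMap.fourierInv_coe, Real.fourierInv_eq_fourier_neg, neg_neg]

/-- Plancherel's inequality for integrable functions. -/
lemma lintegral_enorm_fourier_sq {f : ℝ → ℂ} (hf : Integrable f) (hf2 : MemLp f 2) :
    ∫⁻ r, ‖𝓕 f r‖ₑ ^ 2 = ∫⁻ t, ‖f t‖ₑ ^ 2 := by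
  set g : Lp ℂ 2 (volume : Measure ℝ) := hf2.toLp f
  have hg : (g : ℝ → ℂ) =ᵐ[volume] f := hf2.coeFn_toLp
  have h := clm_fourier_L2_ae_eq g (ContinuousLinearMap.id ℂ ℂ)
    (hf.congr (by filter_upwards [hg] with x hx; simp [hx]))
  have hF : 𝓕 (fun t => (ContinuousLinearMap.id ℂ ℂ) (g t)) = 𝓕 f := by
    ext x
    exact Real.fourier_congr_ae (by filter_upwards [hg] with x hx; simp [hx]) x
  rw [hF] at h
  have hn : ∀ u : Lp ℂ 2 (volume : Measure ℝ), ∫⁻ r, ‖u r‖ₑ ^ 2 = ‖u‖ₑ ^ 2 := by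
    intro u
    rw [Lp.enorm_def, eLpNorm_eq_lintegral_rpow_enorm_toReal (by norm_num) (by norm_num)]
    simp only [ENNReal.toReal_ofNat, ENNReal.rpow_ofNat]
    rw [← ENNReal.rpow_natCast, ← ENNReal.rpow_mul]
    norm_num
  have e1 : ∫⁻ r, ‖𝓕 f r‖ₑ ^ 2 = ‖(𝓕 g : Lp ℂ 2 (volume : Measure ℝ))‖ₑ ^ 2 := by
    rw [← hn]
    refine lintegral_congr_ae ?_
    filter_upwards [h] with x hx
    rw [← hx]; rfl
  have e2 : ∫⁻ r, ‖f r‖ₑ ^ 2 = ‖g‖ₑ ^ 2 := by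
    rw [← hn]
    refine lintegral_congr_ae ?_
    filter_upwards [hg] with x hx
    rw [hx]
  rw [e1, e2, ← ofReal_norm, Lp.norm_fourier_eq, ofReal_norm]

end PlancherelTransform

/-! ### Trigonometric polynomials in `L⁴(𝕋)`. -/

instance instFactOneLeFour : Fact ((1 : ℝ≥0∞) ≤ 4) := ⟨by norm_num⟩

/-- `L⁴(𝕋)`. -/
abbrev L4T : Type := Lp ℂ 4 (volume : Measure Torus)

/-- The character `e^{ikx}` as an element of `L⁴(𝕋)`. -/
def mode (k : ℤ) : L4T := ContinuousMap.toLp 4 volume ℂ (fourier k)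

/-- The trigonometric polynomial with spatial Fourier coefficients `c k`, `k ∈ s`. -/
def trigPoly (s : Finset ℤ) (c : ℤ → ℂ) : L4T := ∑ k ∈ s, ((2 * π : ℂ)⁻¹ * c k) • mode k

lemma coeFn_mode (k : ℤ) : (mode k : Torus → ℂ) =ᵐ[volume] fourier k :=
  ContinuousMap.coeFn_toLp volume (fourier k)

lemma coeFn_finset_sum_Lp {α ι : Type*} [MeasurableSpace α] {μ : Measure α} {p : ℝ≥0∞}
    (s : Finset ι) (f : ι → Lp ℂ p μ) :
    ((∑ i ∈ s, f i : Lp ℂ p μ) : α → ℂ) =ᵐ[μ] fun x => ∑ i ∈ s, f i x := by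
  classical
  induction s using Finset.induction_on with
  | empty =>
    simp only [Finset.sum_empty]
    exact Lp.coeFn_zero _ _ _
  | insert i s hi ih =>
    rw [Finset.sum_insert hi]
    filter_upwards [Lp.coeFn_add (f i) (∑ i ∈ s, f i), ih] with x hx h
    rw [hx, Pi.add_apply, h, Finset.sum_insert hi]

lemma coeFn_trigPoly (s : Finset ℤ) (c : ℤ → ℂ) :
    (trigPoly s c : Torus → ℂ) =ᵐ[volume] fun x => ∑ k ∈ s, (2 * π : ℂ)⁻¹ * c k * fourier k x := by
  have h : ∀ᵐ x : Torus, ∀ k : ℤ, (((2 * π : ℂ)⁻¹ * c k) • mode k : L4T) x =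
      (2 * π : ℂ)⁻¹ * c k * fourier k x := by
    rw [ae_all_iff]
    intro k
    filter_upwards [Lp.coeFn_smul ((2 * π : ℂ)⁻¹ * c k) (mode k), coeFn_mode k] with x h1 h2
    rw [h1, Pi.smul_apply, h2, smul_eq_mul]
  filter_upwards [coeFn_finset_sum_Lp s fun k => ((2 * π : ℂ)⁻¹ * c k) • mode k, h] with x h1 h2
  rw [trigPoly, h1]
  exact Finset.sum_congr rfl fun k _ => h2 k

lemma integral_fourier (n : ℤ) : ∫ x : Torus, fourier n x = if n = 0 then (2 * π : ℂ) else 0 := by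
  have h := (orthonormal_iff_ite.1 (orthonormal_fourier (T := 2 * π))) 0 n
  rw [ContinuousMap.inner_toLp (@AddCircle.haarAddCircle (2 * π) _) (fourier 0) (fourier n)] at h
  simp_rw [← fourier_neg, ← fourier_add] at h
  rw [AddCircle.integral_haarAddCircle] at h
  simp only [neg_zero, add_zero] at h
  have hπ : (2 * π : ℂ) ≠ 0 := by simp [Real.pi_ne_zero]
  have h2 : ∫ x : Torus, fourier n x = (2 * π : ℂ) * (if (0 : ℤ) = n then 1 else 0) := by
    rw [← h, Complex.real_smul]
    push_cast
    rw [mul_inv_cancel_left₀ hπ]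
  rw [h2]
  by_cases hn : n = 0
  · simp [hn]
  · simp [hn, Ne.symm hn]

/-- Parseval's identity for trigonometric polynomials. -/
lemma lintegral_enorm_sq_trigSum (s : Finset ℤ) (d : ℤ → ℂ) :
    ∫⁻ x : Torus, ‖∑ n ∈ s, d n * fourier n x‖ₑ ^ 2 =
      ENNReal.ofReal (2 * π) * ∑ n ∈ s, ‖d n‖ₑ ^ 2 := by
  have hcont : Continuous fun x : Torus => ∑ n ∈ s, d n * fourier n x := by fun_prop
  have hint : ∀ f : Torus → ℂ, Continuous f → Integrable f :=
    fun f hf => hf.integrable_of_hasCompactSupport (HasCompactSupport.of_compactSpace f)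
  have h1 : ∫ x : Torus, ((‖∑ n ∈ s, d n * fourier n x‖ ^ 2 : ℝ) : ℂ) =
      ((2 * π * ∑ n ∈ s, ‖d n‖ ^ 2 : ℝ) : ℂ) := by
    have e : ∀ x : Torus, ((‖∑ n ∈ s, d n * fourier n x‖ ^ 2 : ℝ) : ℂ) =
        ∑ m ∈ s, ∑ n ∈ s, (starRingEnd ℂ (d m) * d n) * fourier (n - m) x := by
      intro x
      rw [Complex.ofReal_pow, ← Complex.conj_mul', map_sum, Finset.sum_mul_sum]
      refine Finset.sum_congr rfl fun m _ => Finset.sum_congr rfl fun n _ => ?_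
      rw [map_mul, ← fourier_neg, sub_eq_add_neg, fourier_add]; ring
    simp_rw [e]
    rw [integral_finsetSum _ fun m _ => integrable_finsetSum _ fun n _ => hint _ (by fun_prop)]
    push_cast
    rw [Finset.mul_sum]
    refine Finset.sum_congr rfl fun m hm => ?_
    rw [integral_finsetSum _ fun n _ => hint _ (by fun_prop)]
    simp_rw [integral_const_mul, integral_fourier, sub_eq_zero, mul_ite, mul_zero]
    rw [Finset.sum_ite_eq' s m, if_pos hm, Complex.conj_mul']
    ring
  replace h1 : ∫ x : Torus, ‖∑ n ∈ s, d n * fourier n x‖ ^ 2 = 2 * π * ∑ n ∈ s, ‖d n‖ ^ 2 :=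
    Complex.ofReal_injective ((integral_ofReal (𝕜 := ℂ)).symm.trans h1)
  have h2 := ofReal_integral_eq_lintegral_ofReal
    (μ := volume) (f := fun x : Torus => ‖∑ n ∈ s, d n * fourier n x‖ ^ 2)
    (by
      refine Continuous.integrable_of_hasCompactSupport (by fun_prop) ?_
      exact HasCompactSupport.of_compactSpace _)
    (Filter.Eventually.of_forall fun x => by positivity)
  rw [h1, ENNReal.ofReal_mul (by positivity), ENNReal.ofReal_sum_of_nonneg (fun _ _ => by positivity)]
    at h2
  simp_rw [ENNReal.ofReal_pow (norm_nonneg _), ofReal_norm] at h2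
  exact h2.symm

lemma enorm_L4_pow_four (v : L4T) : ‖v‖ₑ ^ 4 = ∫⁻ x : Torus, ‖v x‖ₑ ^ 4 := by
  rw [Lp.enorm_def, eLpNorm_eq_lintegral_rpow_enorm_toReal (by norm_num) (by norm_num)]
  simp only [ENNReal.toReal_ofNat, ENNReal.rpow_ofNat]
  rw [← ENNReal.rpow_natCast, ← ENNReal.rpow_mul]
  norm_num

/-- The `L⁴` norm of a trigonometric polynomial in terms of the autocorrelation of its
coefficients. -/
lemma enorm_trigPoly_pow_four_le (s : Finset ℤ) (c : ℤ → ℂ) (hc : ∀ k ∉ s, c k = 0) :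
    ‖trigPoly s c‖ₑ ^ 4 ≤ ∑' n : ℤ, ‖∑ k ∈ s, c k * c (n - k)‖ₑ ^ 2 := by
  classical
  have hπ := Real.pi_pos
  set P : Finset ℤ := (s ×ˢ s).image fun p => p.1 + p.2
  -- `‖v‖₄⁴ = ‖v²‖₂²`, and `v²` has the autocorrelation of `c` as coefficients. Since `c` vanishes
  -- off `s`, the term `c (n - k)` needs no restriction on `n - k`.
  have hsq : ∀ x : Torus, (∑ k ∈ s, (2 * π : ℂ)⁻¹ * c k * fourier k x) ^ 2 =
      ∑ n ∈ P, ((2 * π : ℂ)⁻¹ ^ 2 * ∑ k ∈ s, c k * c (n - k)) * fourier n x := by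
    intro x
    have e1 : ∀ n ∈ P, ((2 * π : ℂ)⁻¹ ^ 2 * ∑ k ∈ s, c k * c (n - k)) * fourier n x =
        ∑ k ∈ s, ∑ l ∈ s, if k + l = n then ((2 * π : ℂ)⁻¹ * c k * fourier k x) *
          ((2 * π : ℂ)⁻¹ * c l * fourier l x) else 0 := by
      intro n _
      rw [Finset.mul_sum, Finset.sum_mul]
      refine Finset.sum_congr rfl fun k _ => ?_
      have : ∀ l ∈ s, (if k + l = n then ((2 * π : ℂ)⁻¹ * c k * fourier k x) *
          ((2 * π : ℂ)⁻¹ * c l * fourier l x) else 0) =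
          if n - k = l then ((2 * π : ℂ)⁻¹ * c k * fourier k x) *
          ((2 * π : ℂ)⁻¹ * c (n - k) * fourier (n - k) x) else 0 := by
        intro l _
        by_cases h : k + l = n
        · rw [if_pos h, if_pos (by omega), show n - k = l by omega]
        · rw [if_neg h, if_neg (by omega)]
      rw [Finset.sum_congr rfl this, Finset.sum_ite_eq]
      have hf : (fourier n x : ℂ) = fourier k x * fourier (n - k) x := by
        rw [← fourier_add]; congr 2; omega
      by_cases hl : n - k ∈ s
      · rw [if_pos hl, hf]; ring
      · rw [if_neg hl, hc _ hl]; ring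
    rw [Finset.sum_congr rfl e1, Finset.sum_comm, sq, Finset.sum_mul_sum]
    refine Finset.sum_congr rfl fun k hk => ?_
    rw [Finset.sum_comm]
    refine Finset.sum_congr rfl fun l hl => ?_
    rw [Finset.sum_ite_eq, if_pos]
    exact Finset.mem_image.2 ⟨(k, l), Finset.mem_product.2 ⟨hk, hl⟩, rfl⟩
  calc ‖trigPoly s c‖ₑ ^ 4 = ∫⁻ x : Torus, ‖∑ n ∈ P, ((2 * π : ℂ)⁻¹ ^ 2 *
        ∑ k ∈ s, c k * c (n - k)) * fourier n x‖ₑ ^ 2 := by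
        rw [enorm_L4_pow_four]
        refine lintegral_congr_ae ?_
        filter_upwards [coeFn_trigPoly s c] with x hx
        rw [hx, ← hsq, enorm_pow, ← pow_mul]
    _ = ENNReal.ofReal (2 * π) * ∑ n ∈ P, ‖(2 * π : ℂ)⁻¹ ^ 2 *
        ∑ k ∈ s, c k * c (n - k)‖ₑ ^ 2 := lintegral_enorm_sq_trigSum _ _
    _ = (ENNReal.ofReal (2 * π) * (‖(2 * π : ℂ)⁻¹ ^ 2‖ₑ ^ 2)) *
        ∑ n ∈ P, ‖∑ k ∈ s, c k * c (n - k)‖ₑ ^ 2 := by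
        simp_rw [enorm_mul, mul_pow]
        rw [← Finset.mul_sum, mul_assoc]
    -- The exact constant is `2π · (2π)⁻⁴`; only that it is at most `1` is kept.
    _ ≤ 1 * ∑ n ∈ P, ‖∑ k ∈ s, c k * c (n - k)‖ₑ ^ 2 := by
        gcongr
        rw [← ofReal_norm, ← ENNReal.ofReal_pow (by positivity), ← ENNReal.ofReal_mul (by positivity),
          ENNReal.ofReal_le_one]
        have : ‖(2 * π : ℂ)⁻¹ ^ 2‖ = (2 * π)⁻¹ ^ 2 := by
          rw [norm_pow, norm_inv]
          congr 2
          simp [abs_of_pos hπ]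
        rw [this]
        have h1 : 1 ≤ 2 * π := by linarith [Real.pi_gt_three]
        rw [← pow_mul, inv_pow, ← div_eq_mul_inv, div_le_one (by positivity)]
        exact le_self_pow₀ h1 (by norm_num)
    _ ≤ _ := by
        rw [one_mul]
        exact ENNReal.sum_le_tsum P

/-! ### The periodic `L⁴` Strichartz estimate. -/

/-- The square of the weighted `L²` norm with weight `freqWeight ^ s`. -/
def weightedSq (s : ℝ) (φ : ℝ → ℂ) : ℝ≥0∞ :=
  ∫⁻ r, ENNReal.ofReal (freqWeight r ^ s) * ‖φ r‖ₑ ^ 2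

lemma trigPoly_congr {s : Finset ℤ} {c d : ℤ → ℂ} (h : ∀ k ∈ s, c k = d k) :
    trigPoly s c = trigPoly s d :=
  Finset.sum_congr rfl fun k hk => by rw [h k hk]

/-- The phase `e^{-ik²t}` of the free Schrödinger evolution. -/
def schrodingerPhase (k : ℤ) (t : ℝ) : ℂ := Complex.exp (-(Complex.I * (k : ℂ) ^ 2 * (t : ℂ)))

lemma norm_schrodingerPhase (k : ℤ) (t : ℝ) : ‖schrodingerPhase k t‖ = 1 := by
  rw [schrodingerPhase, show -(Complex.I * (k : ℂ) ^ 2 * (t : ℂ)) =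
    ((-((k : ℝ) ^ 2 * t) : ℝ) : ℂ) * Complex.I by push_cast; ring, Complex.norm_exp_ofReal_mul_I]

/-- A modulation in time is a translation in frequency: the phase `e^{-ik²t}` moves the symbol onto
the paraboloid. -/
lemma schrodingerPhase_mul_fourierInv (k : ℤ) (φ : ℝ → ℂ) (t : ℝ) :
    schrodingerPhase k t * 𝓕⁻ φ t = 𝓕 (fun r => φ (r + (k : ℝ) ^ 2 / (2 * π))) (-t) := by
  rw [Real.fourierInv_eq_fourier_neg, Real.fourier_real_eq_integral_exp_smul,
    Real.fourier_real_eq_integral_exp_smul, ← integral_const_mul]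
  rw [← integral_add_right_eq_self _ ((k : ℝ) ^ 2 / (2 * π))]
  refine integral_congr_ae (Filter.Eventually.of_forall fun r => ?_)
  simp only [smul_eq_mul]
  rw [schrodingerPhase, ← mul_assoc, ← Complex.exp_add]
  congr 2
  push_cast
  field_simp
  ring

lemma lintegral_sqrt_mul_sqrt_le {α : Type*} [MeasurableSpace α] {μ : Measure α} {f g : α → ℝ≥0∞}
    (hf : AEMeasurable f μ) (hg : AEMeasurable g μ) :
    ∫⁻ x, f x ^ (1 / 2 : ℝ) * g x ^ (1 / 2 : ℝ) ∂μ ≤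
      (∫⁻ x, f x ∂μ) ^ (1 / 2 : ℝ) * (∫⁻ x, g x ∂μ) ^ (1 / 2 : ℝ) := by
  have h := ENNReal.lintegral_mul_le_Lp_mul_Lq μ Real.HolderConjugate.two_two
    (hf.pow_const (1 / 2 : ℝ)) (hg.pow_const (1 / 2 : ℝ))
  simp only [Pi.mul_apply, ← ENNReal.rpow_mul] at h
  norm_num at h ⊢
  exact h

lemma sum_sqrt_mul_sqrt_le {ι : Type*} (s : Finset ι) (f g : ι → ℝ≥0∞) :
    ∑ i ∈ s, f i ^ (1 / 2 : ℝ) * g i ^ (1 / 2 : ℝ) ≤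
      (∑ i ∈ s, f i) ^ (1 / 2 : ℝ) * (∑ i ∈ s, g i) ^ (1 / 2 : ℝ) := by
  have h := ENNReal.inner_le_Lp_mul_Lq s (fun i => f i ^ (1 / 2 : ℝ)) (fun i => g i ^ (1 / 2 : ℝ))
    Real.HolderConjugate.two_two
  simp only [← ENNReal.rpow_mul] at h
  norm_num at h ⊢
  exact h

lemma ENNReal_sqrt_sq (a : ℝ≥0∞) : (a ^ (1 / 2 : ℝ)) ^ 2 = a := by
  rw [← ENNReal.rpow_natCast, ← ENNReal.rpow_mul]; norm_num

lemma ENNReal_sq_sqrt (a : ℝ≥0∞) : (a ^ 2) ^ (1 / 2 : ℝ) = a := by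
  rw [← ENNReal.rpow_natCast, ← ENNReal.rpow_mul]; norm_num

/-- Insert the product of the weights to the powers `-β` and `β`, and apply Cauchy-Schwarz jointly
in `(k, x)`. One factor is the resonance kernel, bounded by `C`; the other keeps the weights on the
functions. -/
lemma enorm_sum_convolution_sq_le {β : ℝ} {C : ℝ≥0∞} (s : Finset ℤ) (n : ℤ) (τ : ℝ)
    (hC : ∑ k ∈ s, ∫⁻ x : ℝ, ENNReal.ofReal
        (freqWeight (x + (k : ℝ) ^ 2 / (2 * π)) ^ (-β) *
          freqWeight (τ - x + ((n : ℝ) - k) ^ 2 / (2 * π)) ^ (-β)) ≤ C)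
    (ψ : ℤ → ℝ → ℂ) (hψ : ∀ k, Measurable (ψ k)) :
    ‖∑ k ∈ s, ∫ x, ψ k x * ψ (n - k) (τ - x)‖ₑ ^ 2 ≤
      C * ∑ k ∈ s, ∫⁻ x, (ENNReal.ofReal (freqWeight (x + (k : ℝ) ^ 2 / (2 * π)) ^ β) *
        ‖ψ k x‖ₑ ^ 2) *
        (ENNReal.ofReal (freqWeight (τ - x + ((n - k : ℤ) : ℝ) ^ 2 / (2 * π)) ^ β) *
        ‖ψ (n - k) (τ - x)‖ₑ ^ 2) := by
  set K : ℤ → ℝ → ℝ≥0∞ := fun k x => ENNReal.ofReal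
        (freqWeight (x + (k : ℝ) ^ 2 / (2 * π)) ^ (-β) *
          freqWeight (τ - x + ((n : ℝ) - k) ^ 2 / (2 * π)) ^ (-β))
  set Y : ℤ → ℝ → ℝ≥0∞ := fun k x =>
    (ENNReal.ofReal (freqWeight (x + (k : ℝ) ^ 2 / (2 * π)) ^ β) * ‖ψ k x‖ₑ ^ 2) *
        (ENNReal.ofReal (freqWeight (τ - x + ((n - k : ℤ) : ℝ) ^ 2 / (2 * π)) ^ β) *
        ‖ψ (n - k) (τ - x)‖ₑ ^ 2)
  have hw : ∀ s : ℝ, Measurable fun r => freqWeight r ^ s := fun s =>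
    (continuous_freqWeight_rpow s).measurable
  have hK : ∀ k, Measurable (K k) := by
    intro k
    have h1 := hw (-β)
    simp only [K]
    fun_prop
  have hY : ∀ k, Measurable (Y k) := by
    intro k
    have h1 := hw β
    have h2 := hψ
    simp only [Y]
    fun_prop
  have hKY : ∀ k x, ‖ψ k x * ψ (n - k) (τ - x)‖ₑ = K k x ^ (1 / 2 : ℝ) * Y k x ^ (1 / 2 : ℝ) := by
    intro k x
    have h1 := freqWeight_pos (x + (k : ℝ) ^ 2 / (2 * π))
    have h2 := freqWeight_pos (τ - x + ((n : ℝ) - k) ^ 2 / (2 * π))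
    rw [← ENNReal.mul_rpow_of_nonneg _ _ (by norm_num)]
    have : K k x * Y k x = (‖ψ k x * ψ (n - k) (τ - x)‖ₑ) ^ 2 := by
      simp only [K, Y]
      push_cast
      set A := freqWeight (x + (k : ℝ) ^ 2 / (2 * π))
      set B := freqWeight (τ - x + ((n : ℝ) - k) ^ 2 / (2 * π))
      rw [enorm_mul, mul_pow, ENNReal.ofReal_mul (by positivity)]
      have hA : ENNReal.ofReal (A ^ (-β)) * ENNReal.ofReal (A ^ β) = 1 := by
        rw [← ENNReal.ofReal_mul (by positivity), ← Real.rpow_add h1]; simp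
      have hB : ENNReal.ofReal (B ^ (-β)) * ENNReal.ofReal (B ^ β) = 1 := by
        rw [← ENNReal.ofReal_mul (by positivity), ← Real.rpow_add h2]; simp
      calc _ = (ENNReal.ofReal (A ^ (-β)) * ENNReal.ofReal (A ^ β)) *
            (ENNReal.ofReal (B ^ (-β)) * ENNReal.ofReal (B ^ β)) *
            (‖ψ k x‖ₑ ^ 2 * ‖ψ (n - k) (τ - x)‖ₑ ^ 2) := by ring
        _ = _ := by rw [hA, hB]; ring
    rw [this, ENNReal_sq_sqrt]
  have h1 : ‖∑ k ∈ s, ∫ x, ψ k x * ψ (n - k) (τ - x)‖ₑ ≤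
      C ^ (1 / 2 : ℝ) * (∑ k ∈ s, ∫⁻ x, Y k x) ^ (1 / 2 : ℝ) := by
    calc _ ≤ ∑ k ∈ s, ‖∫ x, ψ k x * ψ (n - k) (τ - x)‖ₑ := enorm_sum_le _ _
      _ ≤ ∑ k ∈ s, (∫⁻ x, K k x) ^ (1 / 2 : ℝ) * (∫⁻ x, Y k x) ^ (1 / 2 : ℝ) := by
          refine Finset.sum_le_sum fun k _ => ?_
          refine (enorm_integral_le_lintegral_enorm _).trans ?_
          simp_rw [hKY]
          exact lintegral_sqrt_mul_sqrt_le (hK k).aemeasurable (hY k).aemeasurable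
      _ ≤ _ := by
          refine (sum_sqrt_mul_sqrt_le _ _ _).trans ?_
          gcongr
  calc _ ≤ (C ^ (1 / 2 : ℝ) * (∑ k ∈ s, ∫⁻ x, Y k x) ^ (1 / 2 : ℝ)) ^ 2 := by gcongr
    _ = _ := by rw [mul_pow, ENNReal_sqrt_sq, ENNReal_sqrt_sq]

open scoped Convolution in
/-- Bourgain's periodic `L⁴` Strichartz estimate: `X^{0,β} ⊆ L⁴(𝕋 × ℝ)` for `β > 3/8`. The function
with interaction-picture coefficients `𝓕⁻ (φ k)` has `L⁴` norm controlled by weighted `L²` norms of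
`φ k`. -/
theorem exists_strichartz {β : ℝ} (hβ : 3 / 8 < β) :
    ∃ C : ℝ≥0∞, C ≠ ∞ ∧ ∀ (s : Finset ℤ) (φ : ℤ → ℝ → ℂ),
      (∀ k, Measurable (φ k)) → (∀ k, Integrable (φ k)) →
      ∫⁻ t, ‖trigPoly s fun k => schrodingerPhase k t * 𝓕⁻ (φ k) t‖ₑ ^ 4 ≤
        C * (∑ k ∈ s, weightedSq β (φ k)) ^ 2 := by
  classical
  obtain ⟨C, hC, hker⟩ := exists_sum_lintegral_freqWeight_le hβ
  -- Adding `1` keeps the constant nonzero, so that the case of an infinite right side is trivial.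
  refine ⟨C + 1, by finiteness, fun s φ hm hi => ?_⟩
  by_cases htop : ∑ k ∈ s, weightedSq β (φ k) = ∞
  · rw [htop]; simp
  -- Symbols on the paraboloid, set to zero off `s`; the values at `-t` of their transforms are the
  -- coefficients of the trigonometric polynomial.
  set ψ : ℤ → ℝ → ℂ := fun k r => if k ∈ s then φ k (r + (k : ℝ) ^ 2 / (2 * π)) else 0
  have hψm : ∀ k, Measurable (ψ k) := by
    intro k
    by_cases hk : k ∈ s
    · simp only [ψ, if_pos hk]; exact (hm k).comp (measurable_id.add_const _)
    · simp only [ψ, if_neg hk]; exact measurable_const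
  have hψi : ∀ k, Integrable (ψ k) := by
    intro k
    by_cases hk : k ∈ s
    · simp only [ψ, if_pos hk]; exact (hi k).comp_add_right _
    · simp only [ψ, if_neg hk]; exact integrable_zero _ _ _
  set A : ℤ → ℝ → ℝ≥0∞ := fun k x =>
    ENNReal.ofReal (freqWeight (x + (k : ℝ) ^ 2 / (2 * π)) ^ β) * ‖ψ k x‖ₑ ^ 2
  have hAm : ∀ k, Measurable (A k) := by
    intro k
    have h1 : Measurable fun r => freqWeight r ^ β := (continuous_freqWeight_rpow β).measurable
    have h2 := hψm k
    simp only [A]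
    fun_prop
  have hA : ∀ k ∈ s, ∫⁻ x, A k x = weightedSq β (φ k) := by
    intro k hk
    simp only [A, ψ, if_pos hk, weightedSq]
    exact lintegral_add_right_eq_self
      (fun x => ENNReal.ofReal (freqWeight x ^ β) * ‖φ k x‖ₑ ^ 2) _
  have hA0 : ∀ k ∉ s, ∫⁻ x, A k x = 0 := by
    intro k hk
    simp [A, ψ, if_neg hk]
  -- The transform of `h n` is the `n`-th autocorrelation of the coefficients, so Plancherel in time
  -- reduces the estimate to the `L²` norms of the `h n`.
  set h : ℤ → ℝ → ℂ := fun n r => ∑ k ∈ s, ∫ x, ψ k x * ψ (n - k) (r - x)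
  have hconv : ∀ n, h n = fun r => ∑ k ∈ s, (ψ k ⋆[ContinuousLinearMap.mul ℂ ℂ] ψ (n - k)) r := by
    intro n; rfl
  have hconvi : ∀ n k, Integrable (ψ k ⋆[ContinuousLinearMap.mul ℂ ℂ] ψ (n - k)) :=
    fun n k => (hψi k).integrable_convolution _ (hψi _)
  have hhi : ∀ n, Integrable (h n) := by
    intro n
    rw [hconv]
    exact integrable_finsetSum _ fun k _ => hconvi n k
  have hF : ∀ n t, 𝓕 (h n) t = ∑ k ∈ s, 𝓕 (ψ k) t * 𝓕 (ψ (n - k)) t := by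
    intro n t
    have h1 : 𝓕 (h n) t = ∑ k ∈ s, 𝓕 (ψ k ⋆[ContinuousLinearMap.mul ℂ ℂ] ψ (n - k)) t := by
      simp_rw [Real.fourier_real_eq_integral_exp_smul]
      rw [← integral_finsetSum]
      · refine integral_congr_ae (Filter.Eventually.of_forall fun r => ?_)
        simp only [hconv, Finset.smul_sum]
      · intro k _
        have := (Real.fourierIntegral_convergent_iff (μ := volume) t).2 (hconvi n k)
        refine this.congr (Filter.Eventually.of_forall fun r => ?_)
        simp only [Circle.smul_def, Real.fourierChar_apply, RCLike.inner_apply, conj_trivial]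
        congr 3
        push_cast; ring
    rw [h1]
    exact Finset.sum_congr rfl fun k _ => Real.fourier_mul_convolution_eq (hψi k) (hψi _) t
  -- Once the kernel is removed, integrating in `r` and summing in `n` decouples the two factors by
  -- translation invariance and leaves the square of the total weighted norm.
  have hconvsum : ∑' n, ∫⁻ r, ‖h n r‖ₑ ^ 2 ≤ C * (∑ k ∈ s, weightedSq β (φ k)) ^ 2 := by
    have hpt : ∀ n r, ‖h n r‖ₑ ^ 2 ≤ C * ∑ k ∈ s, ∫⁻ x, A k x * A (n - k) (r - x) :=
      fun n r => enorm_sum_convolution_sq_le s n r (hker s n r) ψ hψm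
    calc _ ≤ ∑' n, ∫⁻ r, C * ∑ k ∈ s, ∫⁻ x, A k x * A (n - k) (r - x) :=
          ENNReal.tsum_le_tsum fun n => lintegral_mono (hpt n)
      _ = ∑' n, C * ∑ k ∈ s, (∫⁻ x, A k x) * ∫⁻ x, A (n - k) x := by
          refine tsum_congr fun n => ?_
          have hjm : ∀ k, Measurable fun p : ℝ × ℝ => A k p.2 * A (n - k) (p.1 - p.2) := by
            intro k
            exact ((hAm k).comp measurable_snd).mul
              ((hAm _).comp (measurable_fst.sub measurable_snd))
          rw [lintegral_const_mul' _ _ hC, lintegral_finsetSum]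
          · congr 1
            refine Finset.sum_congr rfl fun k _ => ?_
            rw [lintegral_lintegral_swap (hjm k).aemeasurable]
            have : ∀ x, ∫⁻ r, A k x * A (n - k) (r - x) = A k x * ∫⁻ r, A (n - k) r := by
              intro x
              have hms : Measurable fun r => A (n - k) (r - x) :=
                (hAm _).comp (measurable_id.sub_const x)
              rw [lintegral_const_mul _ hms]
              congr 1
              exact lintegral_sub_right_eq_self (A (n - k)) x
            simp_rw [this]
            rw [lintegral_mul_const _ (hAm k)]
          · intro k _
            exact (hjm k).lintegral_prod_right'
      _ = C * ∑ k ∈ s, (∫⁻ x, A k x) * ∑' n, ∫⁻ x, A n x := by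
          rw [ENNReal.tsum_mul_left, Summable.tsum_finsetSum fun _ _ => ENNReal.summable]
          congr 1
          refine Finset.sum_congr rfl fun k _ => ?_
          rw [ENNReal.tsum_mul_left]
          congr 1
          exact (Equiv.subRight k).tsum_eq fun n => ∫⁻ x, A n x
      _ = _ := by
          rw [tsum_eq_sum (s := s) hA0, ← Finset.sum_mul, Finset.sum_congr rfl hA, sq]
  -- Plancherel needs `h n ∈ L²`. This follows from the bound just proved, whose right side is
  -- finite in the present case.
  have hmem : ∀ n, MemLp (h n) 2 := by
    intro n
    refine ⟨(hhi n).aestronglyMeasurable, ?_⟩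
    rw [eLpNorm_lt_top_iff_lintegral_rpow_enorm_lt_top (by norm_num) (by norm_num)]
    simp only [ENNReal.toReal_ofNat, ENNReal.rpow_ofNat]
    refine lt_of_le_of_lt ((ENNReal.le_tsum n).trans hconvsum) ?_
    exact ENNReal.mul_lt_top hC.lt_top (ENNReal.pow_lt_top (Ne.lt_top htop))
  have hc : ∀ t k, k ∈ s → schrodingerPhase k t * 𝓕⁻ (φ k) t = 𝓕 (ψ k) (-t) := by
    intro t k hk
    rw [schrodingerPhase_mul_fourierInv]
    simp only [ψ, if_pos hk]
  have hz : ∀ t, ∀ k ∉ s, 𝓕 (ψ k) (-t) = 0 := by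
    intro t k hk
    simp only [ψ, if_neg hk]
    simp [Real.fourier_real_eq_integral_exp_smul]
  calc ∫⁻ t, ‖trigPoly s fun k => schrodingerPhase k t * 𝓕⁻ (φ k) t‖ₑ ^ 4
      = ∫⁻ t, ‖trigPoly s fun k => 𝓕 (ψ k) (-t)‖ₑ ^ 4 := by
        refine lintegral_congr fun t => ?_
        congr 2
        exact trigPoly_congr (hc t)
    _ ≤ ∫⁻ t, ∑' n, ‖𝓕 (h n) (-t)‖ₑ ^ 2 := by
        refine lintegral_mono fun t => ?_
        simp_rw [hF]
        exact enorm_trigPoly_pow_four_le s _ (hz t)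
    _ = ∑' n, ∫⁻ t, ‖𝓕 (h n) (-t)‖ₑ ^ 2 := by
        refine lintegral_tsum fun n => ?_
        have : Continuous (𝓕 (h n)) := VectorFourier.fourierIntegral_continuous
          Real.continuous_fourierChar continuous_inner (hhi n)
        have := this.comp continuous_neg
        exact (this.enorm.measurable.pow_const 2).aemeasurable
    _ = ∑' n, ∫⁻ r, ‖h n r‖ₑ ^ 2 := by
        refine tsum_congr fun n => ?_
        rw [lintegral_neg_eq_self (fun t => ‖𝓕 (h n) t‖ₑ ^ 2)]
        exact lintegral_enorm_fourier_sq (hhi n) (hmem n)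
    _ ≤ _ := hconvsum.trans (by gcongr; exact self_le_add_right _ _)

/-! ### Free solutions on short time intervals. -/

lemma trigPoly_smul (s : Finset ℤ) (z : ℂ) (c : ℤ → ℂ) :
    trigPoly s (fun k => z * c k) = z • trigPoly s c := by
  rw [trigPoly, trigPoly, Finset.smul_sum]
  refine Finset.sum_congr rfl fun k _ => ?_
  rw [smul_smul]; congr 1; ring

lemma schrodingerPhase_add (k : ℤ) (s t : ℝ) :
    schrodingerPhase k (s + t) = schrodingerPhase k s * schrodingerPhase k t := by
  rw [schrodingerPhase, schrodingerPhase, schrodingerPhase, ← Complex.exp_add]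
  congr 1; push_cast; ring

lemma fourierInv_gaussian {L : ℝ} (hL : 0 < L) (a : ℂ) (t : ℝ) :
    𝓕⁻ (fun r : ℝ => a * ((L * Real.exp (-π * L ^ 2 * r ^ 2) : ℝ) : ℂ)) t =
      ((Real.exp (-π * t ^ 2 / L ^ 2) : ℝ) : ℂ) * a := by
  have hb : 0 < ((L ^ 2 : ℝ) : ℂ).re := by
    rw [Complex.ofReal_re]; positivity
  have h := congrFun (fourier_gaussian_pi hb) (-t)
  rw [Real.fourierInv_eq_fourier_neg]
  have e : 𝓕 (fun r : ℝ => a * ((L * Real.exp (-π * L ^ 2 * r ^ 2) : ℝ) : ℂ)) (-t) =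
      (a * L) * 𝓕 (fun r : ℝ => Complex.exp (-π * ((L ^ 2 : ℝ) : ℂ) * r ^ 2)) (-t) := by
    rw [Real.fourier_real_eq_integral_exp_smul, Real.fourier_real_eq_integral_exp_smul,
      ← integral_const_mul]
    refine integral_congr_ae (Filter.Eventually.of_forall fun r => ?_)
    simp only [smul_eq_mul]
    push_cast
    ring
  rw [e, h]
  have h2 : (((L ^ 2 : ℝ) : ℂ) ^ (1 / 2 : ℂ)) = L := by
    have : ((1 / 2 : ℂ)) = ((1 / 2 : ℝ) : ℂ) := by push_cast; rfl
    rw [this, ← Complex.ofReal_cpow (by positivity), ← Real.sqrt_eq_rpow, Real.sqrt_sq hL.le]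
  rw [h2]
  have hL' : (L : ℂ) ≠ 0 := by exact_mod_cast hL.ne'
  push_cast
  have h3 : -(π : ℂ) / L ^ 2 * (-t : ℂ) ^ 2 = -π * t ^ 2 / L ^ 2 := by ring
  rw [h3]
  field_simp

lemma freqWeight_div_le {L : ℝ} (hL : 0 < L) (r : ℝ) :
    freqWeight (L⁻¹ * r) ≤ (1 + L⁻¹) ^ 2 * freqWeight r := by
  unfold freqWeight
  have h0 : 0 < L⁻¹ := inv_pos.2 hL
  nlinarith [mul_nonneg (sq_nonneg (2 * π * r)) h0.le, sq_nonneg (2 * π * r),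
    mul_pos h0 h0]

/-- The factor measuring the weighted norm of a Gaussian cutoff to a time interval of size `L`. -/
def cutoffScale (β L : ℝ) : ℝ := L * (1 + L⁻¹) ^ (2 * β)

/-- The factor equals `L^{1-2β}(L + 1)^{2β}`. This is the source of all smallness on short
intervals. -/
lemma tendsto_cutoffScale {β : ℝ} (hβ : β < 1 / 2) :
    Filter.Tendsto (cutoffScale β) (nhdsWithin 0 (Ioi 0)) (nhds 0) := by
  have h1 : Filter.Tendsto (fun L : ℝ => L ^ (1 - 2 * β) * (L + 1) ^ (2 * β))
      (nhdsWithin 0 (Ioi 0)) (nhds (0 ^ (1 - 2 * β) * (0 + 1) ^ (2 * β))) := by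
    refine Filter.Tendsto.mono_left ?_ nhdsWithin_le_nhds
    refine Filter.Tendsto.mul ?_ ?_
    · exact (Real.continuousAt_rpow_const _ _ (Or.inr (by linarith))).tendsto
    · exact ((continuous_id.add continuous_const).tendsto' _ _ rfl).rpow_const
        (Or.inl (by norm_num))
  rw [Real.zero_rpow (by linarith), zero_mul] at h1
  refine h1.congr' ?_
  filter_upwards [self_mem_nhdsWithin] with L hL
  have hL : 0 < L := hL
  have : 1 + L⁻¹ = (L + 1) * L⁻¹ := by field_simp
  rw [cutoffScale, this, Real.mul_rpow (by positivity) (by positivity), Real.inv_rpow hL.le,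
    Real.rpow_sub hL, Real.rpow_one]
  field_simp

/-- The weighted norm of a Gaussian at frequency scale `1 / L`. -/
lemma exists_weightedSq_gaussian_le {β : ℝ} (hβ : 0 < β) (hβ1 : β ≤ 1) : ∃ C : ℝ, 0 ≤ C ∧
    ∀ (L : ℝ), 0 < L → ∀ a : ℂ,
      weightedSq β (fun r : ℝ => a * ((L * Real.exp (-π * L ^ 2 * r ^ 2) : ℝ) : ℂ)) ≤
        ENNReal.ofReal (C * cutoffScale β L) * ‖a‖ₑ ^ 2 := by
  have hπ := Real.pi_pos
  have hexp : ∀ r : ℝ, Real.exp (-π * r ^ 2) ^ 2 = Real.exp (-(2 * π) * r ^ 2) := by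
    intro r
    rw [← Real.exp_nat_mul]; congr 1; push_cast; ring
  have hint : Integrable fun r : ℝ => freqWeight r ^ β * Real.exp (-π * r ^ 2) ^ 2 := by
    have h1 := integrable_exp_neg_mul_sq (b := 2 * π) (by positivity)
    have h2 := integrable_rpow_mul_exp_neg_mul_sq (b := 2 * π) (by positivity) (s := 2)
      (by norm_num)
    refine (h1.add (h2.const_mul (4 * π ^ 2))).mono' ?_ (Filter.Eventually.of_forall fun r => ?_)
    · have : Continuous fun r : ℝ => freqWeight r ^ β * Real.exp (-π * r ^ 2) ^ 2 := by fun_prop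
      exact this.aestronglyMeasurable
    · have hW := freqWeight_pos r
      rw [hexp, Real.norm_of_nonneg (by positivity)]
      have : freqWeight r ^ β ≤ 1 + 4 * π ^ 2 * r ^ 2 := by
        calc freqWeight r ^ β ≤ freqWeight r ^ (1 : ℝ) :=
              Real.rpow_le_rpow_of_exponent_le (one_le_freqWeight r) hβ1
          _ = _ := by rw [Real.rpow_one, freqWeight]; ring
      calc _ ≤ (1 + 4 * π ^ 2 * r ^ 2) * Real.exp (-(2 * π) * r ^ 2) := by gcongr
        _ = _ := by simp only [Pi.add_apply, Real.rpow_ofNat]; ring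
  refine ⟨∫ r : ℝ, freqWeight r ^ β * Real.exp (-π * r ^ 2) ^ 2,
    integral_nonneg fun r => by have := freqWeight_pos r; positivity, fun L hL a => ?_⟩
  -- The integrand in the variable `ρ = Lr`. The amplitude gives `L²`, the weight costs `(1 +
  -- L⁻¹)^{2β}`, and the Jacobian `L⁻¹` leaves `cutoffScale`.
  set g : ℝ → ℝ := fun ρ => freqWeight (L⁻¹ * ρ) ^ β * (L ^ 2 * Real.exp (-π * ρ ^ 2) ^ 2)
  have hg0 : ∀ ρ, 0 ≤ g ρ := fun ρ => by have := freqWeight_pos (L⁻¹ * ρ); positivity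
  have hgle : ∀ ρ, g ρ ≤ (L ^ 2 * (1 + L⁻¹) ^ (2 * β)) *
      (freqWeight ρ ^ β * Real.exp (-π * ρ ^ 2) ^ 2) := by
    intro ρ
    have h0 := freqWeight_pos (L⁻¹ * ρ)
    have h1 := freqWeight_pos ρ
    have : freqWeight (L⁻¹ * ρ) ^ β ≤ (1 + L⁻¹) ^ (2 * β) * freqWeight ρ ^ β := by
      calc _ ≤ ((1 + L⁻¹) ^ 2 * freqWeight ρ) ^ β :=
            Real.rpow_le_rpow h0.le (freqWeight_div_le hL ρ) hβ.le
        _ = _ := by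
            rw [Real.mul_rpow (by positivity) h1.le, Real.rpow_mul (by positivity)]
            norm_num
    calc g ρ ≤ ((1 + L⁻¹) ^ (2 * β) * freqWeight ρ ^ β) * (L ^ 2 * Real.exp (-π * ρ ^ 2) ^ 2) := by
          simp only [g]; gcongr
      _ = _ := by ring
  have hgi : Integrable g := by
    refine (hint.const_mul (L ^ 2 * (1 + L⁻¹) ^ (2 * β))).mono' ?_
      (Filter.Eventually.of_forall fun r => ?_)
    · have : Continuous g := by
        have := (continuous_freqWeight_rpow β).comp (continuous_const_mul L⁻¹)
        simp only [Function.comp_def] at this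
        fun_prop
      exact this.aestronglyMeasurable
    · rw [Real.norm_of_nonneg (hg0 r)]; exact hgle r
  have hw : weightedSq β (fun r : ℝ => a * ((L * Real.exp (-π * L ^ 2 * r ^ 2) : ℝ) : ℂ)) =
      ENNReal.ofReal (∫ r, g (L * r)) * ‖a‖ₑ ^ 2 := by
    rw [ofReal_integral_eq_lintegral_ofReal (hgi.comp_mul_left' hL.ne')
      (Filter.Eventually.of_forall fun r => hg0 _), weightedSq, ← lintegral_mul_const' _ _ (by finiteness)]
    refine lintegral_congr fun r => ?_
    have h0 := freqWeight_pos r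
    simp only [g]
    rw [inv_mul_cancel_left₀ hL.ne', enorm_mul, mul_pow, ENNReal.ofReal_mul (by positivity),
      mul_comm (‖a‖ₑ ^ 2), ← mul_assoc]
    congr 2
    rw [← ofReal_norm, ← ENNReal.ofReal_pow (by positivity)]
    congr 1
    rw [Complex.norm_real, Real.norm_of_nonneg (by positivity), mul_pow]
    rw [mul_pow L r, ← mul_assoc]
  rw [hw]
  gcongr
  rw [Measure.integral_comp_mul_left, abs_of_pos (inv_pos.2 hL), smul_eq_mul]
  calc L⁻¹ * ∫ r, g r ≤ L⁻¹ * ∫ ρ, (L ^ 2 * (1 + L⁻¹) ^ (2 * β)) *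
      (freqWeight ρ ^ β * Real.exp (-π * ρ ^ 2) ^ 2) := by
        exact mul_le_mul_of_nonneg_left (integral_mono hgi (hint.const_mul _) hgle) (by positivity)
    _ = _ := by
        rw [integral_const_mul, cutoffScale]
        field_simp

/-- The `L⁴` Strichartz estimate for free solutions on a time interval of length `2L`, with a
constant that vanishes as `L → 0`. -/
theorem exists_homogeneous_strichartz {β : ℝ} (hβ : 3 / 8 < β) (hβ1 : β ≤ 1) :
    ∃ C : ℝ≥0∞, C ≠ ∞ ∧ ∀ (L : ℝ), 0 < L → ∀ (t₀ : ℝ) (s : Finset ℤ) (a : ℤ → ℂ),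
      ∫⁻ t in Icc (t₀ - L) (t₀ + L), ‖trigPoly s fun k => schrodingerPhase k t * a k‖ₑ ^ 4 ≤
        C * (ENNReal.ofReal (cutoffScale β L) * ∑ k ∈ s, ‖a k‖ₑ ^ 2) ^ 2 := by
  obtain ⟨C, hC, hS⟩ := exists_strichartz hβ
  obtain ⟨D, hD, hG⟩ := exists_weightedSq_gaussian_le (β := β) (by linarith) hβ1
  refine ⟨ENNReal.ofReal (Real.exp π) ^ 4 * C * (ENNReal.ofReal D) ^ 2, by finiteness,
    fun L hL t₀ s a => ?_⟩
  -- A time translation multiplies the data by unimodular phases, which do not change the right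
  -- side.
  wlog ht₀ : t₀ = 0 generalizing t₀ a
  · have h := this 0 (fun k => schrodingerPhase k t₀ * a k) rfl
    simp only [enorm_mul, ← ofReal_norm (schrodingerPhase _ _), norm_schrodingerPhase,
      ENNReal.ofReal_one, one_mul, zero_sub, zero_add] at h
    refine le_trans (le_of_eq ?_) h
    have hpre : Icc (-L) L = (fun x => x + t₀) ⁻¹' Icc (t₀ - L) (t₀ + L) := by
      ext x; simp only [mem_preimage, mem_Icc]
      constructor <;> rintro ⟨h1, h2⟩ <;> constructor <;> linarith
    rw [hpre, ← (measurePreserving_add_right volume t₀).setLIntegral_comp_preimage_emb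
      (MeasurableEquiv.addRight t₀).measurableEmbedding]
    refine setLIntegral_congr_fun (hpre ▸ measurableSet_Icc) fun t _ => ?_
    simp only [schrodingerPhase_add, mul_assoc]
  subst ht₀
  simp only [zero_sub, zero_add]
  set φ : ℤ → ℝ → ℂ := fun k r => a k * ((L * Real.exp (-π * L ^ 2 * r ^ 2) : ℝ) : ℂ)
  have hφc : ∀ k, Continuous (φ k) := fun k => by simp only [φ]; fun_prop
  have hφi : ∀ k, Integrable (φ k) := by
    intro k
    have h := integrable_exp_neg_mul_sq (b := π * L ^ 2) (by positivity)
    refine Integrable.const_mul (Integrable.ofReal (Integrable.const_mul ?_ L)) (a k)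
    simpa using h
  have h := hS s φ (fun k => (hφc k).measurable) hφi
  -- The inverse transform of `φ k` is `a k` times `e^{-πt²/L²}`, which is at least `e^{-π}` on
  -- `[-L, L]`.
  have hpt : ∀ t ∈ Icc (-L) L, ‖trigPoly s fun k => schrodingerPhase k t * a k‖ₑ ^ 4 ≤
      ENNReal.ofReal (Real.exp π) ^ 4 *
        ‖trigPoly s fun k => schrodingerPhase k t * 𝓕⁻ (φ k) t‖ₑ ^ 4 := by
    intro t ht
    have e : (trigPoly s fun k => schrodingerPhase k t * 𝓕⁻ (φ k) t) =
        ((Real.exp (-π * t ^ 2 / L ^ 2) : ℝ) : ℂ) •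
          trigPoly s fun k => schrodingerPhase k t * a k := by
      rw [← trigPoly_smul]
      refine trigPoly_congr fun k _ => ?_
      rw [fourierInv_gaussian hL]; ring
    rw [e, enorm_smul, ← mul_pow, ← mul_assoc]
    gcongr
    refine le_mul_of_one_le_left zero_le ?_
    rw [← ofReal_norm, ← ENNReal.ofReal_mul (by positivity), Complex.norm_real,
      Real.norm_of_nonneg (Real.exp_pos _).le, ← Real.exp_add, ENNReal.one_le_ofReal,
      Real.one_le_exp_iff]
    have : t ^ 2 / L ^ 2 ≤ 1 := by
      rw [div_le_one (by positivity)]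
      exact sq_le_sq' ht.1 ht.2
    rw [neg_mul, neg_div, mul_div_assoc]
    nlinarith [Real.pi_pos]
  calc _ ≤ ∫⁻ t in Icc (-L) L, ENNReal.ofReal (Real.exp π) ^ 4 *
        ‖trigPoly s fun k => schrodingerPhase k t * 𝓕⁻ (φ k) t‖ₑ ^ 4 :=
        setLIntegral_mono' measurableSet_Icc hpt
    _ ≤ ENNReal.ofReal (Real.exp π) ^ 4 *
        ∫⁻ t, ‖trigPoly s fun k => schrodingerPhase k t * 𝓕⁻ (φ k) t‖ₑ ^ 4 := by
        rw [lintegral_const_mul' _ _ (by finiteness)]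
        gcongr
        exact Measure.restrict_le_self
    _ ≤ ENNReal.ofReal (Real.exp π) ^ 4 * (C * (∑ k ∈ s, ENNReal.ofReal (D * cutoffScale β L) *
          ‖a k‖ₑ ^ 2) ^ 2) := by
        refine mul_le_mul_right (h.trans ?_) _
        gcongr with k hk
        exact hG L hL (a k)
    _ = _ := by
        rw [← Finset.mul_sum, ENNReal.ofReal_mul hD]
        ring

/-! ### Forcing terms and the dual Strichartz estimates. -/

/-- The space of bounded conjugate-linear functionals on `L⁴(𝕋)`, a model of `L^{4/3}(𝕋)`. -/
abbrev DualL4T : Type := L4T →L⋆[ℂ] ℂ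

/-- The spatial Fourier coefficient of a forcing term, in the interaction picture. -/
def forcingCoeff (F : ℝ → DualL4T) (k : ℤ) (t : ℝ) : ℂ := schrodingerPhase k (-t) * F t (mode k)

lemma conj_schrodingerPhase (k : ℤ) (t : ℝ) :
    starRingEnd ℂ (schrodingerPhase k t) = schrodingerPhase k (-t) := by
  rw [schrodingerPhase, schrodingerPhase, ← Complex.exp_conj]
  congr 1
  simp

@[fun_prop]
lemma continuous_schrodingerPhase (k : ℤ) : Continuous (schrodingerPhase k) := by
  unfold schrodingerPhase; fun_prop

lemma aestronglyMeasurable_forcingCoeff {μ : Measure ℝ} {F : ℝ → DualL4T}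
    (hF : AEStronglyMeasurable F μ) (k : ℤ) : AEStronglyMeasurable (forcingCoeff F k) μ := by
  have h1 : Continuous fun T : DualL4T => T (mode k) := continuous_eval_const (mode k)
  have h2 : Continuous fun t => schrodingerPhase k (-t) := by fun_prop
  exact h2.aestronglyMeasurable.mul (h1.comp_aestronglyMeasurable hF)

lemma norm_forcingCoeff_le (F : ℝ → DualL4T) (k : ℤ) (t : ℝ) :
    ‖forcingCoeff F k t‖ ≤ ‖mode k‖ * ‖F t‖ := by
  rw [forcingCoeff, norm_mul, norm_schrodingerPhase, one_mul]
  exact ((F t).le_opNorm _).trans_eq (mul_comm _ _)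

lemma integrable_forcingCoeff {μ : Measure ℝ} [IsFiniteMeasure μ] {F : ℝ → DualL4T}
    (hF : MemLp F (4 / 3) μ) (k : ℤ) : Integrable (forcingCoeff F k) μ := by
  have h43 : (1 : ℝ≥0∞) ≤ 4 / 3 := by
    rw [ENNReal.le_div_iff_mul_le (by simp) (by simp)]; norm_num
  have h1 : Integrable F μ := memLp_one_iff_integrable.1 (hF.mono_exponent h43)
  exact (h1.norm.const_mul ‖mode k‖).mono' (aestronglyMeasurable_forcingCoeff hF.1 k)
    (Filter.Eventually.of_forall fun t => norm_forcingCoeff_le F k t)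

lemma eLpNorm_four_eq {α E : Type*} [MeasurableSpace α] [NormedAddCommGroup E] (μ : Measure α)
    (f : α → E) : eLpNorm f 4 μ = (∫⁻ t, ‖f t‖ₑ ^ 4 ∂μ) ^ (1 / 4 : ℝ) := by
  rw [eLpNorm_eq_lintegral_rpow_enorm_toReal (by norm_num) (by norm_num)]
  simp

lemma eLpNorm_four_pow {α E : Type*} [MeasurableSpace α] [NormedAddCommGroup E] (μ : Measure α)
    (f : α → E) : eLpNorm f 4 μ ^ 4 = ∫⁻ t, ‖f t‖ₑ ^ 4 ∂μ := by
  rw [eLpNorm_four_eq, ← ENNReal.rpow_natCast, ← ENNReal.rpow_mul]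
  norm_num

/-- Hölder's inequality in time for the duality pairing between `L^{4/3}` and `L⁴`. -/
lemma lintegral_pairing_le {μ : Measure ℝ} {F : ℝ → DualL4T} {y : ℝ → L4T}
    (hF : AEStronglyMeasurable F μ) (hy : AEStronglyMeasurable y μ) :
    ∫⁻ t, ‖F t (y t)‖ₑ ∂μ ≤ eLpNorm F (4 / 3) μ * eLpNorm y 4 μ := by
  have h43 : (4 / 3 : ℝ≥0∞).toReal = 4 / 3 := by simp
  have h430 : (4 / 3 : ℝ≥0∞) ≠ ∞ := by finiteness
  have h := ENNReal.lintegral_mul_le_Lp_mul_Lq μ (p := 4 / 3) (q := 4)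
    (by constructor <;> norm_num) hF.enorm hy.enorm
  rw [eLpNorm_eq_lintegral_rpow_enorm_toReal (by simp) h430,
    eLpNorm_eq_lintegral_rpow_enorm_toReal (by simp) (by simp), h43]
  refine le_trans (lintegral_mono fun t => ?_) h
  rw [Pi.mul_apply]
  exact (F t).le_opENorm (y t)

lemma apply_trigPoly_phase (T : DualL4T) (s : Finset ℤ) (t : ℝ) (c : ℤ → ℂ) :
    T (trigPoly s fun k => schrodingerPhase k t * c k) =
      (2 * π : ℂ)⁻¹ * ∑ k ∈ s, starRingEnd ℂ (c k) * (schrodingerPhase k (-t) * T (mode k)) := by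
  rw [trigPoly, map_sum, Finset.mul_sum]
  refine Finset.sum_congr rfl fun k _ => ?_
  rw [map_smulₛₗ, map_mul, map_mul, conj_schrodingerPhase, map_inv₀, map_mul, Complex.conj_ofReal,
    smul_eq_mul]
  simp only [map_ofNat]
  ring

/-- Duality between forcing terms and trigonometric polynomials with time dependent
coefficients. -/
lemma enorm_sum_integral_conj_mul_forcingCoeff_le {μ : Measure ℝ} [IsFiniteMeasure μ]
    {F : ℝ → DualL4T} (hF : MemLp F (4 / 3) μ) (s : Finset ℤ) (c : ℤ → ℝ → ℂ)
    (hc : ∀ k, Continuous (c k)) (hb : ∀ k, ∃ B, ∀ t, ‖c k t‖ ≤ B) :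
    ‖∑ k ∈ s, ∫ t, starRingEnd ℂ (c k t) * forcingCoeff F k t ∂μ‖ₑ ≤
      ENNReal.ofReal (2 * π) * eLpNorm F (4 / 3) μ *
        (∫⁻ t, ‖trigPoly s fun k => schrodingerPhase k t * c k t‖ₑ ^ 4 ∂μ) ^ (1 / 4 : ℝ) := by
  have hπ := Real.pi_pos
  have hi : ∀ k, Integrable (fun t => starRingEnd ℂ (c k t) * forcingCoeff F k t) μ := by
    intro k
    obtain ⟨B, hB⟩ := hb k
    refine (integrable_forcingCoeff hF k).bdd_mul (c := B) ?_ (Filter.Eventually.of_forall fun t => ?_)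
    · exact (Complex.continuous_conj.comp (hc k)).aestronglyMeasurable
    · simpa using hB t
  have hy : Continuous fun t => trigPoly s fun k => schrodingerPhase k t * c k t := by
    unfold trigPoly
    fun_prop
  have e : ∑ k ∈ s, ∫ t, starRingEnd ℂ (c k t) * forcingCoeff F k t ∂μ =
      (2 * π : ℂ) * ∫ t, F t (trigPoly s fun k => schrodingerPhase k t * c k t) ∂μ := by
    rw [← integral_finsetSum _ fun k _ => hi k, ← integral_const_mul]
    refine integral_congr_ae (Filter.Eventually.of_forall fun t => ?_)
    simp only
    rw [apply_trigPoly_phase, mul_inv_cancel_left₀ (by simp [hπ.ne'])]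
    rfl
  rw [e, enorm_mul, mul_assoc, ← eLpNorm_four_eq]
  have h2 : ‖(2 * π : ℂ)‖ₑ = ENNReal.ofReal (2 * π) := by
    rw [← ofReal_norm]
    congr 1
    simp [abs_of_pos hπ]
  rw [h2]
  gcongr
  exact (enorm_integral_le_lintegral_enorm _).trans
    (lintegral_pairing_le hF.1 hy.aestronglyMeasurable)

/-- The last step of each duality argument: cancel `√X`. Finiteness of `X` is essential, which is
why finite sums, or bounded frequency windows, are estimated first. -/
lemma ENNReal_le_sq_of_le_mul_sqrt {X B : ℝ≥0∞} (hX : X ≠ ∞) (h : X ≤ B * X ^ (1 / 2 : ℝ)) :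
    X ≤ B ^ 2 := by
  by_cases h0 : X = 0
  · simp [h0]
  have h1 : X ^ (1 / 2 : ℝ) * X ^ (1 / 2 : ℝ) ≤ B * X ^ (1 / 2 : ℝ) := by
    rw [← sq, ENNReal_sqrt_sq]; exact h
  have h2 : X ^ (1 / 2 : ℝ) ≠ 0 := by simp [h0, hX]
  have h3 : X ^ (1 / 2 : ℝ) ≠ ∞ := ENNReal.rpow_ne_top_of_nonneg (by norm_num) hX
  have h4 := (ENNReal.mul_le_mul_iff_left h2 h3).1 h1
  rw [← ENNReal_sqrt_sq X]
  gcongr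

/-- The dual of the homogeneous Strichartz estimate. -/
theorem exists_dual_homogeneous_strichartz {β : ℝ} (hβ : 3 / 8 < β) (hβ1 : β ≤ 1) :
    ∃ C : ℝ≥0∞, C ≠ ∞ ∧ ∀ (L : ℝ), 0 < L → ∀ (t₀ : ℝ) (J : Set ℝ),
      J ⊆ Icc (t₀ - L) (t₀ + L) → ∀ (F : ℝ → DualL4T),
      MemLp F (4 / 3) (volume.restrict J) → ∀ s : Finset ℤ,
      ∑ k ∈ s, ‖∫ t in J, forcingCoeff F k t‖ₑ ^ 2 ≤
        C * ENNReal.ofReal (cutoffScale β L) * eLpNorm F (4 / 3) (volume.restrict J) ^ 2 := by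
  obtain ⟨C, hC, hS⟩ := exists_homogeneous_strichartz hβ hβ1
  refine ⟨ENNReal.ofReal (2 * π) ^ 2 * C ^ (1 / 2 : ℝ), by finiteness,
    fun L hL t₀ J hJ F hF s => ?_⟩
  have : IsFiniteMeasure (volume.restrict J) :=
    isFiniteMeasure_restrict.2 ((measure_mono hJ).trans_lt (by simp)).ne
  set α : ℤ → ℂ := fun k => ∫ t in J, forcingCoeff F k t
  set X := ∑ k ∈ s, ‖α k‖ₑ ^ 2
  have hX : X ≠ ∞ := (ENNReal.sum_lt_top.2 fun k _ => by finiteness).ne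
  -- The forcing is tested against the free solution with its own coefficients `α`: the pairing is
  -- `X`, and the homogeneous estimate bounds the test function by `√X`.
  have h1 := enorm_sum_integral_conj_mul_forcingCoeff_le hF s (fun k _ => α k)
    (fun k => continuous_const) (fun k => ⟨‖α k‖, fun _ => le_rfl⟩)
  have h2 : ‖∑ k ∈ s, ∫ t in J, starRingEnd ℂ (α k) * forcingCoeff F k t‖ₑ = X := by
    have : ∀ k, ∫ t in J, starRingEnd ℂ (α k) * forcingCoeff F k t = ((‖α k‖ ^ 2 : ℝ) : ℂ) := by
      intro k
      rw [integral_const_mul, Complex.ofReal_pow, ← Complex.conj_mul']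
    simp_rw [this]
    rw [← Complex.ofReal_sum, ← ofReal_norm, Complex.norm_real,
      Real.norm_of_nonneg (Finset.sum_nonneg fun k _ => by positivity),
      ENNReal.ofReal_sum_of_nonneg fun k _ => by positivity]
    simp_rw [ENNReal.ofReal_pow (norm_nonneg _), ofReal_norm]
    rfl
  rw [h2] at h1
  have h3 : (∫⁻ t in J, ‖trigPoly s fun k => schrodingerPhase k t * α k‖ₑ ^ 4) ^ (1 / 4 : ℝ) ≤
      C ^ (1 / 4 : ℝ) * ENNReal.ofReal (cutoffScale β L) ^ (1 / 2 : ℝ) * X ^ (1 / 2 : ℝ) := by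
    calc _ ≤ (C * (ENNReal.ofReal (cutoffScale β L) * X) ^ 2) ^ (1 / 4 : ℝ) := by
          gcongr
          exact (lintegral_mono_set hJ).trans (hS L hL t₀ s α)
      _ = _ := by
          rw [ENNReal.mul_rpow_of_nonneg _ _ (by norm_num), ← ENNReal.rpow_natCast,
            ← ENNReal.rpow_mul, ENNReal.mul_rpow_of_nonneg _ _ (by norm_num), mul_assoc]
          norm_num
  have h4 : X ≤ (ENNReal.ofReal (2 * π) * eLpNorm F (4 / 3) (volume.restrict J) *
      (C ^ (1 / 4 : ℝ) * ENNReal.ofReal (cutoffScale β L) ^ (1 / 2 : ℝ))) * X ^ (1 / 2 : ℝ) := by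
    refine h1.trans ?_
    rw [mul_assoc _ _ (X ^ (1 / 2 : ℝ))]
    gcongr
  refine (ENNReal_le_sq_of_le_mul_sqrt hX h4).trans (le_of_eq ?_)
  have h5 : (C ^ (1 / 4 : ℝ)) ^ 2 = C ^ (1 / 2 : ℝ) := by
    rw [← ENNReal.rpow_natCast, ← ENNReal.rpow_mul]; norm_num
  rw [mul_pow, mul_pow, mul_pow, h5, ENNReal_sqrt_sq]
  ring

lemma conj_fourierInv (φ : ℝ → ℂ) (t : ℝ) :
    starRingEnd ℂ (𝓕⁻ φ t) = 𝓕 (fun r => starRingEnd ℂ (φ r)) t := by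
  rw [Real.fourierInv_eq_fourier_neg, Real.fourier_real_eq_integral_exp_smul,
    Real.fourier_real_eq_integral_exp_smul, ← integral_conj]
  refine integral_congr_ae (Filter.Eventually.of_forall fun r => ?_)
  simp only [smul_eq_mul, map_mul, ← Complex.exp_conj]
  congr 2
  simp [map_ofNat]

lemma continuous_fourier_of_integrable {f : ℝ → ℂ} (hf : Integrable f) : Continuous (𝓕 f) :=
  VectorFourier.fourierIntegral_continuous Real.continuous_fourierChar continuous_inner hf

lemma continuous_fourierInv_of_integrable {f : ℝ → ℂ} (hf : Integrable f) :
    Continuous (𝓕⁻ f) :=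
  ((continuous_fourier_of_integrable hf).comp continuous_neg).congr
    fun x => (Real.fourierInv_eq_fourier_neg _ x).symm

lemma norm_fourier_le_integral {f : ℝ → ℂ} (t : ℝ) : ‖𝓕 f t‖ ≤ ∫ r, ‖f r‖ :=
  VectorFourier.norm_fourierIntegral_le_integral_norm _ _ _ _ _

lemma norm_fourierInv_le_integral {f : ℝ → ℂ} (t : ℝ) : ‖𝓕⁻ f t‖ ≤ ∫ r, ‖f r‖ := by
  rw [Real.fourierInv_eq_fourier_neg]
  exact norm_fourier_le_integral _

/-- The dual Strichartz estimate `L^{4/3} ⊆ X^{0,-β}`. -/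
theorem exists_dual_strichartz {β : ℝ} (hβ : 3 / 8 < β) :
    ∃ C : ℝ≥0∞, C ≠ ∞ ∧ ∀ (J : Set ℝ), MeasurableSet J → volume J ≠ ∞ → ∀ (F : ℝ → DualL4T),
      MemLp F (4 / 3) (volume.restrict J) → ∀ s : Finset ℤ,
      ∑ k ∈ s, weightedSq (-β) (𝓕 (J.indicator (forcingCoeff F k))) ≤
        C * eLpNorm F (4 / 3) (volume.restrict J) ^ 2 := by
  obtain ⟨C, hC, hS⟩ := exists_strichartz hβ
  refine ⟨ENNReal.ofReal (2 * π) ^ 2 * C ^ (1 / 2 : ℝ), by finiteness,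
    fun J hJ hJv F hF s => ?_⟩
  have : IsFiniteMeasure (volume.restrict J) := isFiniteMeasure_restrict.2 hJv
  set g : ℤ → ℝ → ℂ := fun k => J.indicator (forcingCoeff F k)
  have hg : ∀ k, Integrable (g k) := fun k =>
    (integrable_indicator_iff hJ).2 (integrable_forcingCoeff hF k)
  have hgc : ∀ k, Continuous (𝓕 (g k)) := fun k => continuous_fourier_of_integrable (hg k)
  set A : ℤ → ℝ → ℝ≥0∞ := fun k R => ∫⁻ r in Icc (-R) R,
    ENNReal.ofReal (freqWeight r ^ (-β)) * ‖𝓕 (g k) r‖ₑ ^ 2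
  have key : ∀ R : ℝ, ∑ k ∈ s, A k R ≤
      ENNReal.ofReal (2 * π) ^ 2 * C ^ (1 / 2 : ℝ) *
        eLpNorm F (4 / 3) (volume.restrict J) ^ 2 := by
    intro R
    -- The extremal test function for the dual norm, cut to `|r| ≤ R`. Its weighted norm with
    -- exponent `β` is the truncated norm of `𝓕 (g k)` with exponent `-β`, and so is the pairing.
    set φ : ℤ → ℝ → ℂ := fun k => (Icc (-R) R).indicator
      fun r => ((freqWeight r ^ (-β) : ℝ) : ℂ) * 𝓕 (g k) r
    have hφc : ∀ k, Continuous fun r => ((freqWeight r ^ (-β) : ℝ) : ℂ) * 𝓕 (g k) r := by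
      intro k
      have := hgc k
      fun_prop
    have hφm : ∀ k, Measurable (φ k) := fun k => (hφc k).measurable.indicator measurableSet_Icc
    have hφi : ∀ k, Integrable (φ k) := fun k =>
      (integrable_indicator_iff measurableSet_Icc).2
        ((hφc k).continuousOn.integrableOn_compact isCompact_Icc)
    have hqi : ∀ k, IntegrableOn (fun r => freqWeight r ^ (-β) * ‖𝓕 (g k) r‖ ^ 2) (Icc (-R) R) := by
      intro k
      have h1 := hgc k
      have : Continuous fun r => freqWeight r ^ (-β) * ‖𝓕 (g k) r‖ ^ 2 := by fun_prop
      exact this.continuousOn.integrableOn_compact isCompact_Icc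
    have hA : ∀ k, A k R =
        ENNReal.ofReal (∫ r in Icc (-R) R, freqWeight r ^ (-β) * ‖𝓕 (g k) r‖ ^ 2) := by
      intro k
      rw [ofReal_integral_eq_lintegral_ofReal (hqi k) (Filter.Eventually.of_forall fun r => by
        have := freqWeight_pos r
        positivity)]
      refine lintegral_congr fun r => ?_
      have := freqWeight_pos r
      rw [ENNReal.ofReal_mul (by positivity), ENNReal.ofReal_pow (by positivity), ofReal_norm]
    have hX : ∑ k ∈ s, A k R ≠ ∞ := by
      refine (ENNReal.sum_lt_top.2 fun k _ => ?_).ne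
      rw [hA]; finiteness
    have hw : ∀ k, weightedSq β (φ k) = A k R := by
      intro k
      simp only [A]
      rw [← lintegral_indicator measurableSet_Icc, weightedSq]
      refine lintegral_congr fun r => ?_
      have h0 := freqWeight_pos r
      by_cases hr : r ∈ Icc (-R) R
      · simp only [φ, indicator_of_mem hr]
        rw [enorm_mul, mul_pow, ← mul_assoc]
        congr 1
        rw [← ofReal_norm, Complex.norm_real, Real.norm_of_nonneg (by positivity),
          ← ENNReal.ofReal_pow (by positivity), ← ENNReal.ofReal_mul (by positivity), sq,
          ← Real.rpow_add h0, ← Real.rpow_add h0]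
        congr 2; ring
      · simp [φ, indicator_of_notMem hr]
    have h1 := enorm_sum_integral_conj_mul_forcingCoeff_le hF s (fun k => 𝓕⁻ (φ k))
      (fun k => continuous_fourierInv_of_integrable (hφi k))
      (fun k => ⟨_, fun t => norm_fourierInv_le_integral t⟩)
    have h2 : ∀ k, ∫ t in J, starRingEnd ℂ (𝓕⁻ (φ k) t) * forcingCoeff F k t =
        ((∫ r in Icc (-R) R, freqWeight r ^ (-β) * ‖𝓕 (g k) r‖ ^ 2 : ℝ) : ℂ) := by
      intro k
      rw [← integral_indicator hJ]
      have e1 : (J.indicator fun t => starRingEnd ℂ (𝓕⁻ (φ k) t) * forcingCoeff F k t) =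
          fun t => 𝓕 (fun r => starRingEnd ℂ (φ k r)) t * g k t := by
        ext t
        rw [← conj_fourierInv]
        by_cases ht : t ∈ J
        · simp [g, ht]
        · simp [g, ht]
      rw [e1, integral_fourier_mul_comm ?_ (hg k)]
      · rw [← integral_complex_ofReal, ← integral_indicator measurableSet_Icc]
        refine integral_congr_ae (Filter.Eventually.of_forall fun r => ?_)
        simp only
        by_cases hr : r ∈ Icc (-R) R
        · simp only [φ, indicator_of_mem hr]
          rw [map_mul, Complex.conj_ofReal, mul_assoc, Complex.conj_mul']
          push_cast
          rfl
        · simp [φ, indicator_of_notMem hr]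
      · exact (hφi k).norm.mono' (Complex.continuous_conj.comp_aestronglyMeasurable
          (hφi k).1) (Filter.Eventually.of_forall fun r => by simp)
    have h3 : ‖∑ k ∈ s, ∫ t in J, starRingEnd ℂ (𝓕⁻ (φ k) t) * forcingCoeff F k t‖ₑ =
        ∑ k ∈ s, A k R := by
      simp_rw [h2, hA]
      rw [← Complex.ofReal_sum, ← ofReal_norm, Complex.norm_real,
        ← ENNReal.ofReal_sum_of_nonneg, Real.norm_of_nonneg]
      · exact Finset.sum_nonneg fun k _ => integral_nonneg fun r => by
          have := freqWeight_pos r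
          positivity
      · exact fun k _ => integral_nonneg fun r => by
          have := freqWeight_pos r
          positivity
    rw [h3] at h1
    have h4 := hS s φ hφm hφi
    simp_rw [hw] at h4
    have h5 : (∫⁻ t in J, ‖trigPoly s fun k => schrodingerPhase k t * 𝓕⁻ (φ k) t‖ₑ ^ 4) ^
        (1 / 4 : ℝ) ≤ C ^ (1 / 4 : ℝ) * (∑ k ∈ s, A k R) ^ (1 / 2 : ℝ) := by
      calc _ ≤ (C * (∑ k ∈ s, A k R) ^ 2) ^ (1 / 4 : ℝ) := by
            gcongr
            exact (setLIntegral_le_lintegral _ _).trans h4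
        _ = _ := by
            rw [ENNReal.mul_rpow_of_nonneg _ _ (by norm_num), ← ENNReal.rpow_natCast,
              ← ENNReal.rpow_mul]
            norm_num
    have h6 : ∑ k ∈ s, A k R ≤ (ENNReal.ofReal (2 * π) * eLpNorm F (4 / 3) (volume.restrict J) *
        C ^ (1 / 4 : ℝ)) * (∑ k ∈ s, A k R) ^ (1 / 2 : ℝ) := by
      refine h1.trans ?_
      rw [mul_assoc _ (C ^ (1 / 4 : ℝ)) _]
      gcongr
    refine (ENNReal_le_sq_of_le_mul_sqrt hX h6).trans (le_of_eq ?_)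
    have h7 : (C ^ (1 / 4 : ℝ)) ^ 2 = C ^ (1 / 2 : ℝ) := by
      rw [← ENNReal.rpow_natCast, ← ENNReal.rpow_mul]; norm_num
    rw [mul_pow, mul_pow, h7]
    ring
  have hlim : Filter.Tendsto (fun n : ℕ => ∑ k ∈ s, A k n) Filter.atTop
      (nhds (∑ k ∈ s, weightedSq (-β) (𝓕 (g k)))) := by
    refine tendsto_finsetSum _ fun k _ => ?_
    have hcov : AECover volume Filter.atTop fun n : ℕ => Icc (-(n : ℝ)) (n : ℝ) :=
      aecover_Icc (Filter.tendsto_neg_atTop_atBot.comp tendsto_natCast_atTop_atTop)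
        tendsto_natCast_atTop_atTop
    refine hcov.lintegral_tendsto_of_countably_generated ?_
    have h1 := hgc k
    have h2 : Continuous fun r => freqWeight r ^ (-β) := by fun_prop
    exact (h2.measurable.ennreal_ofReal.mul ((hgc k).enorm.measurable.pow_const 2)).aemeasurable
  exact le_of_tendsto' hlim fun n => key n

/-! ### Fourier coefficients and the Schrödinger group on `L²(𝕋)`. -/

/-- The normalised characters `(2π)^{-1/2} e^{ikx}` in `L²(𝕋)`. -/
def normalizedMode (k : ℤ) : L2T :=
  ((√(2 * π))⁻¹ : ℂ) • ContinuousMap.toLp 2 volume ℂ (fourier k)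

lemma ofReal_sqrt_two_pi_ne_zero : ((√(2 * π) : ℝ) : ℂ) ≠ 0 := by
  have : 0 < √(2 * π) := Real.sqrt_pos.2 (by positivity)
  exact_mod_cast this.ne'

lemma sqrt_two_pi_mul_self : ((√(2 * π) : ℝ) : ℂ) * ((√(2 * π) : ℝ) : ℂ) = 2 * π := by
  rw [← Complex.ofReal_mul, Real.mul_self_sqrt (by positivity)]; push_cast; rfl

lemma orthonormal_normalizedMode : Orthonormal ℂ normalizedMode := by
  rw [orthonormal_iff_ite]
  intro i j
  rw [normalizedMode, normalizedMode, inner_smul_left, inner_smul_right,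
    ContinuousMap.inner_toLp (volume : Measure Torus) (fourier i) (fourier j)]
  have : ∫ x : Torus, fourier j x * starRingEnd ℂ (fourier i x) = if i = j then (2 * π : ℂ) else 0 := by
    simp_rw [← fourier_neg, ← fourier_add]
    rw [integral_fourier]
    by_cases h : i = j
    · simp [h]
    · rw [if_neg h, if_neg (by omega)]
  rw [this, map_inv₀, Complex.conj_ofReal]
  have h0 := ofReal_sqrt_two_pi_ne_zero
  by_cases h : i = j
  · rw [if_pos h, if_pos h, ← sqrt_two_pi_mul_self]
    field_simp
  · simp [h]

lemma span_normalizedMode_closure_eq_top :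
    (Submodule.span ℂ (range normalizedMode)).topologicalClosure = ⊤ := by
  have h : (Submodule.span ℂ (range fun k : ℤ =>
      (ContinuousMap.toLp 2 (volume : Measure Torus) ℂ (fourier k) : L2T))).topologicalClosure = ⊤ := by
    convert! (ContinuousMap.toLp_denseRange ℂ (volume : Measure Torus) ℂ
      (p := 2) (by simp)).topologicalClosure_map_submodule span_fourier_closure_eq_top
    rw [Submodule.map_span, ← Set.range_comp]
    rfl
  rw [eq_top_iff, ← h]
  refine Submodule.topologicalClosure_mono (Submodule.span_le.2 ?_)
  rintro _ ⟨k, rfl⟩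
  have : (ContinuousMap.toLp 2 (volume : Measure Torus) ℂ (fourier k) : L2T) =
      (√(2 * π) : ℂ) • normalizedMode k := by
    rw [normalizedMode, smul_smul, mul_inv_cancel₀ ofReal_sqrt_two_pi_ne_zero, one_smul]
  simp only [this]
  exact Submodule.smul_mem _ _ (Submodule.subset_span ⟨k, rfl⟩)

/-- The Hilbert basis of `L²(𝕋)` of normalised characters. -/
def modeBasis : HilbertBasis ℤ ℂ L2T :=
  HilbertBasis.mk orthonormal_normalizedMode span_normalizedMode_closure_eq_top.ge

/-- The spatial Fourier coefficient as a continuous linear functional on `L²(𝕋)`. -/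
def coeffL2 (k : ℤ) : L2T →L[ℂ] ℂ := (√(2 * π) : ℂ) • innerSL ℂ (normalizedMode k)

lemma coeffL2_eq_repr (k : ℤ) (u : L2T) : coeffL2 k u = (√(2 * π) : ℂ) * modeBasis.repr u k := by
  rw [HilbertBasis.repr_apply_apply, modeBasis, HilbertBasis.coe_mk, coeffL2]
  rfl

lemma spaceFourier_congr_ae {g h : Torus → ℂ} (hgh : g =ᵐ[volume] h) (k : ℤ) :
    spaceFourier g k = spaceFourier h k :=
  integral_congr_ae (by filter_upwards [hgh] with x hx; rw [hx])

lemma coeffL2_apply (k : ℤ) (u : L2T) : coeffL2 k u = spaceFourier u k := by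
  have : coeffL2 k u = (√(2 * π) : ℂ) * inner ℂ (normalizedMode k) u := rfl
  rw [this, normalizedMode, inner_smul_left, map_inv₀, Complex.conj_ofReal,
    mul_inv_cancel_left₀ ofReal_sqrt_two_pi_ne_zero, L2.inner_def, spaceFourier]
  refine integral_congr_ae ?_
  filter_upwards [ContinuousMap.coeFn_toLp (p := 2) (𝕜 := ℂ) (volume : Measure Torus) (fourier k)]
    with x hx
  rw [hx, fourier_neg, RCLike.inner_apply, mul_comm]

lemma hasSum_sq_coeffL2 (u : L2T) : HasSum (fun k => ‖coeffL2 k u‖ ^ 2) (2 * π * ‖u‖ ^ 2) := by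
  have h : HasSum (fun i => ‖modeBasis.repr u i‖ ^ 2) (‖modeBasis.repr u‖ ^ 2) := by
    apply_mod_cast lp.hasSum_norm ?_ (modeBasis.repr u)
    simp
  rw [LinearIsometryEquiv.norm_map] at h
  have h2 := h.mul_left (2 * π)
  refine h2.congr_fun fun k => ?_
  rw [coeffL2_eq_repr, norm_mul, mul_pow, Complex.norm_real, Real.norm_of_nonneg (Real.sqrt_nonneg _),
    Real.sq_sqrt (by positivity)]

lemma tsum_enorm_sq_coeffL2 (u : L2T) :
    ∑' k, ‖coeffL2 k u‖ₑ ^ 2 = ENNReal.ofReal (2 * π) * ‖u‖ₑ ^ 2 := by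
  have h := hasSum_sq_coeffL2 u
  have h2 := ENNReal.ofReal_tsum_of_nonneg (fun k => by positivity) h.summable
  rw [h.tsum_eq, ENNReal.ofReal_mul (by positivity), ENNReal.ofReal_pow (by positivity),
    ofReal_norm] at h2
  rw [h2]
  refine tsum_congr fun k => ?_
  rw [ENNReal.ofReal_pow (by positivity), ofReal_norm]

lemma ext_coeffL2 {u v : L2T} (h : ∀ k, coeffL2 k u = coeffL2 k v) : u = v := by
  have h1 := hasSum_sq_coeffL2 (u - v)
  have h2 : (fun k => ‖coeffL2 k (u - v)‖ ^ 2) = fun _ => 0 := by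
    ext k; rw [map_sub, h k]; simp
  rw [h2] at h1
  have h3 := h1.unique hasSum_zero
  have hπ := Real.pi_pos
  have : ‖u - v‖ ^ 2 = 0 := by
    rcases mul_eq_zero.1 h3 with h | h
    · exact absurd h (by positivity)
    · exact h
  exact sub_eq_zero.1 (norm_eq_zero.1 (by simpa using this))

lemma exists_coeffL2_eq {a : ℤ → ℂ} (ha : Summable fun k => ‖a k‖ ^ 2) :
    ∃ u : L2T, ∀ k, coeffL2 k u = a k := by
  have hm : Memℓp (fun k => (√(2 * π) : ℂ)⁻¹ * a k) 2 := by
    refine memℓp_gen ?_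
    simp only [ENNReal.toReal_ofNat, Real.rpow_ofNat, norm_mul, mul_pow]
    exact ha.mul_left _
  refine ⟨modeBasis.repr.symm ⟨_, hm⟩, fun k => ?_⟩
  rw [coeffL2_eq_repr, LinearIsometryEquiv.apply_symm_apply]
  exact mul_inv_cancel_left₀ ofReal_sqrt_two_pi_ne_zero _

/-- The free Schrödinger group `e^{it∂ₓ²}` on `L²(𝕋)`. -/
def freeFlow (t : ℝ) : L2T →ₗᵢ[ℂ] L2T :=
  have h : ∀ u : L2T, ∃ v : L2T, ∀ k, coeffL2 k v = schrodingerPhase k t * coeffL2 k u := fun u =>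
    exists_coeffL2_eq (by
      simp only [norm_mul, norm_schrodingerPhase, one_mul]
      exact (hasSum_sq_coeffL2 u).summable)
  { toFun := fun u => (h u).choose
    map_add' := fun u v => ext_coeffL2 fun k => by
      rw [map_add, (h _).choose_spec, (h _).choose_spec, (h _).choose_spec, map_add, mul_add]
    map_smul' := fun z u => ext_coeffL2 fun k => by
      rw [map_smul, (h _).choose_spec, (h _).choose_spec, map_smul, RingHom.id_apply, smul_eq_mul,
        smul_eq_mul, mul_left_comm]
    norm_map' := fun u => by
      have h1 := hasSum_sq_coeffL2 (h u).choose
      simp only [(h u).choose_spec, norm_mul, norm_schrodingerPhase, one_mul] at h1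
      have h2 := h1.unique (hasSum_sq_coeffL2 u)
      have h3 := mul_left_cancel₀ (by positivity) h2
      exact (pow_left_inj₀ (norm_nonneg _) (norm_nonneg _) two_ne_zero).1 h3 }

lemma coeffL2_freeFlow (k : ℤ) (t : ℝ) (u : L2T) :
    coeffL2 k (freeFlow t u) = schrodingerPhase k t * coeffL2 k u := by
  have h : ∃ v : L2T, ∀ k, coeffL2 k v = schrodingerPhase k t * coeffL2 k u :=
    exists_coeffL2_eq (by
      simp only [norm_mul, norm_schrodingerPhase, one_mul]
      exact (hasSum_sq_coeffL2 u).summable)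
  exact h.choose_spec k

lemma schrodingerPhase_zero (k : ℤ) : schrodingerPhase k 0 = 1 := by
  simp [schrodingerPhase]

lemma schrodingerPhase_neg_mul (k : ℤ) (t : ℝ) :
    schrodingerPhase k (-t) * schrodingerPhase k t = 1 := by
  rw [← schrodingerPhase_add, neg_add_cancel, schrodingerPhase_zero]

lemma freeFlow_add (s t : ℝ) (u : L2T) : freeFlow (s + t) u = freeFlow s (freeFlow t u) :=
  ext_coeffL2 fun k => by
    rw [coeffL2_freeFlow, coeffL2_freeFlow, coeffL2_freeFlow, schrodingerPhase_add, mul_assoc]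

lemma freeFlow_zero (u : L2T) : freeFlow 0 u = u :=
  ext_coeffL2 fun k => by rw [coeffL2_freeFlow, schrodingerPhase_zero, one_mul]

lemma freeFlow_neg_freeFlow (t : ℝ) (u : L2T) : freeFlow (-t) (freeFlow t u) = u := by
  rw [← freeFlow_add, neg_add_cancel, freeFlow_zero]

lemma freeFlow_freeFlow_neg (t : ℝ) (u : L2T) : freeFlow t (freeFlow (-t) u) = u := by
  rw [← freeFlow_add, add_neg_cancel, freeFlow_zero]

/-- By Parseval the squared distance is a series of continuous functions of `t` dominated by
`4‖coeffL2 k u‖²`. -/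
lemma continuous_freeFlow_apply (u : L2T) : Continuous fun t => freeFlow t u := by
  rw [continuous_iff_continuousAt]
  intro t₀
  have h1 : Continuous fun t => ∑' k, ‖(schrodingerPhase k t - schrodingerPhase k t₀) *
      coeffL2 k u‖ ^ 2 := by
    refine continuous_tsum (u := fun k => 4 * ‖coeffL2 k u‖ ^ 2) (fun k => by fun_prop)
      ((hasSum_sq_coeffL2 u).summable.mul_left 4) fun k t => ?_
    rw [Real.norm_of_nonneg (by positivity), norm_mul, mul_pow]
    gcongr
    have : ‖schrodingerPhase k t - schrodingerPhase k t₀‖ ≤ 2 := by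
      refine (norm_sub_le _ _).trans ?_
      rw [norm_schrodingerPhase, norm_schrodingerPhase]; norm_num
    nlinarith [norm_nonneg (schrodingerPhase k t - schrodingerPhase k t₀)]
  have h2 : ∀ t, ∑' k, ‖(schrodingerPhase k t - schrodingerPhase k t₀) * coeffL2 k u‖ ^ 2 =
      2 * π * ‖freeFlow t u - freeFlow t₀ u‖ ^ 2 := by
    intro t
    rw [← (hasSum_sq_coeffL2 _).tsum_eq]
    refine tsum_congr fun k => ?_
    rw [map_sub, coeffL2_freeFlow, coeffL2_freeFlow, sub_mul]
  simp_rw [h2] at h1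
  have h4 : ∀ t, √((2 * π)⁻¹ • (2 * π * ‖freeFlow t u - freeFlow t₀ u‖ ^ 2)) =
      ‖freeFlow t u - freeFlow t₀ u‖ := by
    intro t
    rw [smul_eq_mul, inv_mul_cancel_left₀ (by positivity), Real.sqrt_sq (norm_nonneg _)]
  have h3 := (((h1.const_smul (2 * π)⁻¹).sqrt).congr h4).tendsto t₀
  simp only [sub_self, norm_zero] at h3
  exact tendsto_iff_norm_sub_tendsto_zero.2 h3

/-- Split `v t = (v t - v t₀) + v t₀`: the group is isometric on the first part and strongly
continuous on the second. -/
lemma continuousOn_freeFlow {J : Set ℝ} {v : ℝ → L2T} {s : ℝ → ℝ} (hs : Continuous s)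
    (hv : ContinuousOn v J) : ContinuousOn (fun t => freeFlow (s t) (v t)) J := by
  intro t₀ ht₀
  have h1 : Filter.Tendsto (fun t => freeFlow (s t) (v t₀)) (nhdsWithin t₀ J)
      (nhds (freeFlow (s t₀) (v t₀))) :=
    (((continuous_freeFlow_apply (v t₀)).comp hs).tendsto t₀).mono_left nhdsWithin_le_nhds
  have h2 : Filter.Tendsto (fun t => freeFlow (s t) (v t - v t₀)) (nhdsWithin t₀ J) (nhds 0) := by
    rw [tendsto_zero_iff_norm_tendsto_zero]
    simp_rw [LinearIsometry.norm_map]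
    exact tendsto_iff_norm_sub_tendsto_zero.1 (hv t₀ ht₀)
  have h3 := h2.add h1
  rw [zero_add] at h3
  refine h3.congr fun t => ?_
  rw [← map_add, sub_add_cancel]

/-- The inclusion `L⁴(𝕋) ⊆ L²(𝕋)`. -/
def inclL4 : L4T →L[ℂ] L2T :=
  have hm : ∀ f : L4T, MemLp f 2 (volume : Measure Torus) := fun f =>
    (Lp.memLp f).mono_exponent (by norm_num)
  LinearMap.mkContinuous
    { toFun := fun f => (hm f).toLp f
      map_add' := fun f g => by
        ext1
        filter_upwards [(hm (f + g)).coeFn_toLp, (hm f).coeFn_toLp, (hm g).coeFn_toLp,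
          Lp.coeFn_add f g, Lp.coeFn_add ((hm f).toLp f) ((hm g).toLp g)] with x h1 h2 h3 h4 h5
        rw [h1, h4, h5, Pi.add_apply, Pi.add_apply, h2, h3]
      map_smul' := fun z f => by
        ext1
        filter_upwards [(hm (z • f)).coeFn_toLp, (hm f).coeFn_toLp,
          Lp.coeFn_smul z f, Lp.coeFn_smul z ((hm f).toLp f)] with x h1 h2 h3 h4
        rw [h1, h3, RingHom.id_apply, h4, Pi.smul_apply, Pi.smul_apply, h2] }
    ((volume : Measure Torus) univ ^ (1 / 4 : ℝ)).toReal fun f => by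
      simp only [LinearMap.coe_mk, AddHom.coe_mk]
      rw [Lp.norm_toLp, Lp.norm_def, ← ENNReal.toReal_mul]
      refine ENNReal.toReal_mono (by finiteness) ?_
      have h := eLpNorm_le_eLpNorm_mul_rpow_measure_univ (p := 2) (q := 4) (by norm_num)
        (Lp.aestronglyMeasurable f)
      refine h.trans (le_of_eq ?_)
      rw [mul_comm]
      congr 2
      norm_num

lemma coeFn_inclL4 (f : L4T) : (inclL4 f : Torus → ℂ) =ᵐ[volume] f :=
  MemLp.coeFn_toLp ((Lp.memLp f).mono_exponent (by norm_num))

lemma inclL4_injective : Function.Injective inclL4 := by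
  intro f g h
  ext1
  have h1 := coeFn_inclL4 f
  rw [h] at h1
  exact h1.symm.trans (coeFn_inclL4 g)

/-- The spatial Fourier coefficient on `L⁴(𝕋)`. -/
def coeffL4 (k : ℤ) : L4T →L[ℂ] ℂ := (coeffL2 k).comp inclL4

lemma coeffL4_mode (k l : ℤ) : coeffL4 k (mode l) = if k = l then (2 * π : ℂ) else 0 := by
  have h1 : coeffL4 k (mode l) = spaceFourier (inclL4 (mode l)) k := coeffL2_apply k _
  rw [h1, spaceFourier_congr_ae ((coeFn_inclL4 _).trans (coeFn_mode l)), spaceFourier]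
  simp_rw [← fourier_add]
  rw [integral_fourier]
  by_cases h : k = l
  · simp [h]
  · rw [if_neg h, if_neg (by omega)]

lemma coeffL4_trigPoly (k : ℤ) (s : Finset ℤ) (c : ℤ → ℂ) :
    coeffL4 k (trigPoly s c) = if k ∈ s then c k else 0 := by
  have hπ : (2 * π : ℂ) ≠ 0 := by simp [Real.pi_ne_zero]
  rw [trigPoly, map_sum]
  simp_rw [map_smul, coeffL4_mode, smul_eq_mul, mul_ite, mul_zero]
  rw [Finset.sum_ite_eq]
  by_cases h : k ∈ s
  · rw [if_pos h, if_pos h]; field_simp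
  · rw [if_neg h, if_neg h]

/-! ### Absolutely continuous functions of time. -/

lemma AbsolutelyContinuousOnInterval.ofReal {f : ℝ → ℝ} {a b : ℝ}
    (hf : AbsolutelyContinuousOnInterval f a b) :
    AbsolutelyContinuousOnInterval (fun x => (f x : ℂ)) a b := by
  unfold AbsolutelyContinuousOnInterval at hf ⊢
  simpa only [Complex.isometry_ofReal.dist_eq] using hf

lemma absolutelyContinuousOnInterval_primitive {G : ℝ → ℂ} {a b c : ℝ}
    (h : IntervalIntegrable G volume a b) (hc : c ∈ uIcc a b) :
    AbsolutelyContinuousOnInterval (fun x => ∫ v in c..x, G v) a b := by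
  have h1 : IntervalIntegrable (fun x => (G x).re) volume a b :=
    ⟨h.1.re, h.2.re⟩
  have h2 : IntervalIntegrable (fun x => (G x).im) volume a b :=
    ⟨h.1.im, h.2.im⟩
  have h3 := (h1.absolutelyContinuousOnInterval_intervalIntegral hc).ofReal.add
    ((h2.absolutelyContinuousOnInterval_intervalIntegral hc).ofReal.const_smul Complex.I)
  have hcongr : ∀ x ∈ uIcc a b, ((fun x => ((∫ v in c..x, (G v).re : ℝ) : ℂ)) +
      fun x => Complex.I • ((∫ v in c..x, (G v).im : ℝ) : ℂ)) x = ∫ v in c..x, G v := by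
    intro x hx
    have hi : IntervalIntegrable G volume c x := h.mono_set (uIcc_subset_uIcc hc hx)
    simp only [Pi.add_apply, smul_eq_mul]
    rw [← intervalIntegral.integral_ofReal, ← intervalIntegral.integral_ofReal,
      ← intervalIntegral.integral_const_mul, ← intervalIntegral.integral_add]
    · refine intervalIntegral.integral_congr fun v _ => ?_
      exact (congrArg _ (mul_comm _ _)).trans (Complex.re_add_im _)
    · exact ⟨hi.1.re.ofReal, hi.2.re.ofReal⟩
    · exact ⟨hi.1.im.ofReal.const_mul _, hi.2.im.ofReal.const_mul _⟩
  rw [absolutelyContinuousOnInterval_iff] at h3 ⊢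
  intro ε hε
  obtain ⟨δ, hδ, h4⟩ := h3 ε hε
  refine ⟨δ, hδ, fun E hE hlt => ?_⟩
  refine lt_of_eq_of_lt (Finset.sum_congr rfl fun i hi => ?_) (h4 E hE hlt)
  have h5 := hE.1 i hi
  rw [hcongr _ h5.1, hcongr _ h5.2]

/-- Integration by parts for primitives of integrable functions. -/
lemma mul_primitive_sub_eq_integral {G H : ℝ → ℂ} {a b : ℝ} (c₀ d₀ : ℂ)
    (hG : IntervalIntegrable G volume a b) (hH : IntervalIntegrable H volume a b) :
    (c₀ + ∫ v in a..b, G v) * (d₀ + ∫ v in a..b, H v) - c₀ * d₀ =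
      ∫ t in a..b, (G t * (d₀ + ∫ v in a..t, H v) + (c₀ + ∫ v in a..t, G v) * H t) := by
  have hconst : ∀ z : ℂ, AbsolutelyContinuousOnInterval (fun _ : ℝ => z) a b := fun z =>
    (LipschitzWith.const z).lipschitzOnWith.absolutelyContinuousOnInterval (K := 0)
  have hc := (hconst c₀).add (absolutelyContinuousOnInterval_primitive hG left_mem_uIcc)
  have hd := (hconst d₀).add (absolutelyContinuousOnInterval_primitive hH left_mem_uIcc)
  set c : ℝ → ℂ := fun t => c₀ + ∫ v in a..t, G v
  set d : ℝ → ℂ := fun t => d₀ + ∫ v in a..t, H v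
  have hc' : AbsolutelyContinuousOnInterval c a b := hc
  have hd' : AbsolutelyContinuousOnInterval d a b := hd
  have hi : IntervalIntegrable (fun t => G t * d t + c t * H t) volume a b :=
    (hG.mul_continuousOn hd'.continuousOn).add (hH.continuousOn_mul hc'.continuousOn)
  -- The product minus the primitive of its a.e. derivative is absolutely continuous with a.e. zero
  -- derivative, hence constant.
  have hg := (hc'.smul hd').sub (absolutelyContinuousOnInterval_primitive hi left_mem_uIcc)
  obtain ⟨K, hK⟩ := hg.const_of_ae_hasDerivAt_zero (by
    filter_upwards [hG.ae_hasDerivAt_integral, hH.ae_hasDerivAt_integral,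
      hi.ae_hasDerivAt_integral] with x h1 h2 h3 hx
    have e1 : HasDerivAt c (G x) x := by
      have := (h1 hx a left_mem_uIcc).const_add c₀
      exact this
    have e2 : HasDerivAt d (H x) x := by
      have := (h2 hx a left_mem_uIcc).const_add d₀
      exact this
    have e3 := (e1.mul e2).sub (h3 hx a left_mem_uIcc)
    rw [sub_self] at e3
    exact e3)
  have h1 := hK a left_mem_uIcc
  have h2 := hK b right_mem_uIcc
  simp only [Pi.sub_apply, smul_eq_mul, Pi.mul_apply, intervalIntegral.integral_same,
    sub_zero] at h1 h2
  have ha : c a * d a = c₀ * d₀ := by simp [c, d]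
  rw [ha] at h1
  rw [h1]
  linear_combination h2

/-- The Fourier transform of an absolutely continuous function with compact support. -/
lemma fourier_eq_of_primitive {V H : ℝ → ℂ} {A B : ℝ} (hAB : A ≤ B)
    (hH : ∀ s t, IntervalIntegrable H volume s t) (hV : ∀ s t, V t - V s = ∫ v in s..t, H v)
    (hV0 : ∀ t, t ∉ Ioo A B → V t = 0) (hH0 : ∀ t, t ∉ Ioc A B → H t = 0) (r : ℝ) :
    𝓕 H r = (2 * π * r * Complex.I) * 𝓕 V r := by
  set e : ℝ → ℂ := fun t => Complex.exp (((-2 * π * t * r : ℝ) : ℂ) * Complex.I)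
  set e' : ℝ → ℂ := fun t => e t * (((-2 * π * r : ℝ) : ℂ) * Complex.I)
  have hde : ∀ t, HasDerivAt e (e' t) t := by
    intro t
    have h1 : HasDerivAt (fun t : ℝ => ((-2 * π * t * r : ℝ) : ℂ)) ((-2 * π * r : ℝ) : ℂ) t := by
      refine HasDerivAt.ofReal_comp ?_
      have := ((hasDerivAt_id t).const_mul (-2 * π)).mul_const r
      simpa using this
    exact (h1.mul_const Complex.I).cexp
  have hec : Continuous e := by simp only [e]; fun_prop
  have he'c : Continuous e' := by simp only [e']; fun_prop
  have hA : V A = 0 := hV0 A (by simp)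
  have hB : V B = 0 := hV0 B (by simp)
  have hVt : ∀ t, (0 : ℂ) + ∫ v in A..t, H v = V t := by
    intro t
    rw [← hV A t, hA]; ring
  have het : ∀ t, e A + ∫ v in A..t, e' v = e t := by
    intro t
    rw [intervalIntegral.integral_eq_sub_of_hasDerivAt (fun x _ => hde x)
      (he'c.intervalIntegrable _ _)]
    ring
  -- Integration by parts against the character; the boundary terms vanish because `V` does at `A`
  -- and `B`.
  have h := mul_primitive_sub_eq_integral (0 : ℂ) (e A) (hH A B) (he'c.intervalIntegrable A B)
  simp only [hVt, het] at h
  rw [hB, zero_mul, zero_mul, sub_zero] at h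
  have hVc : ContinuousOn V (uIcc A B) := by
    have h1 := (absolutelyContinuousOnInterval_primitive (hH A B) left_mem_uIcc).continuousOn
    refine h1.congr fun t _ => ?_
    rw [← hVt t]; simp
  rw [intervalIntegral.integral_add ((hH A B).mul_continuousOn hec.continuousOn)
    ((he'c.intervalIntegrable A B).continuousOn_mul hVc)] at h
  have f1 : 𝓕 H r = ∫ t in A..B, H t * e t := by
    rw [Real.fourier_real_eq_integral_exp_smul, intervalIntegral.integral_of_le hAB,
      ← integral_indicator measurableSet_Ioc]
    refine integral_congr_ae (Filter.Eventually.of_forall fun t => ?_)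
    by_cases ht : t ∈ Ioc A B
    · simp only [indicator_of_mem ht, smul_eq_mul]; exact mul_comm _ _
    · simp [indicator_of_notMem ht, hH0 t ht]
  have f2 : 𝓕 V r = ∫ t in A..B, V t * e t := by
    rw [Real.fourier_real_eq_integral_exp_smul, intervalIntegral.integral_of_le hAB,
      ← integral_indicator measurableSet_Ioc]
    refine integral_congr_ae (Filter.Eventually.of_forall fun t => ?_)
    by_cases ht : t ∈ Ioc A B
    · simp only [indicator_of_mem ht, smul_eq_mul]; exact mul_comm _ _
    · simp [indicator_of_notMem ht, hV0 t (fun h => ht ⟨h.1, h.2.le⟩)]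
  have f3 : ∫ t in A..B, V t * e' t = (((-2 * π * r : ℝ) : ℂ) * Complex.I) * 𝓕 V r := by
    rw [f2, ← intervalIntegral.integral_const_mul]
    refine intervalIntegral.integral_congr fun t _ => ?_
    simp only [e']; ring
  rw [← f1, f3] at h
  push_cast at h
  linear_combination -h

end

noncomputable section

open Filter
open scoped Topology

/-! ### The embedding of `X^{0,b}` in `L⁴`. -/

/-- Symmetric partial sums of the Fourier series with coefficients `c`. -/
def partialSum (n : ℕ) (c : ℤ → ℂ) : L4T := trigPoly (Finset.Icc (-(n : ℤ)) n) c

lemma trigPoly_sub_of_subset {s t : Finset ℤ} (h : s ⊆ t) (c : ℤ → ℂ) :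
    trigPoly t c - trigPoly s c = trigPoly (t \ s) c := by
  rw [trigPoly, trigPoly, trigPoly, ← Finset.sum_sdiff h, add_sub_cancel_right]

lemma continuous_trigPoly {s : Finset ℤ} {c : ℤ → ℝ → ℂ} (hc : ∀ k, Continuous (c k)) :
    Continuous fun t => trigPoly s fun k => c k t := by
  unfold trigPoly
  fun_prop

/-- Functions with summable weighted Fourier norms belong to `L⁴(ℝ; L⁴(𝕋))`, and their partial
Fourier sums converge there. -/
theorem exists_L4_of_weightedSq {β : ℝ} (hβ : 3 / 8 < β) :
    ∃ C : ℝ≥0∞, C ≠ ∞ ∧ ∀ φ : ℤ → ℝ → ℂ, (∀ k, Measurable (φ k)) → (∀ k, Integrable (φ k)) →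
      ∑' k, weightedSq β (φ k) ≠ ∞ →
      ∃ f : ℝ → L4T, MemLp f 4 volume ∧
        eLpNorm f 4 volume ≤ C * (∑' k, weightedSq β (φ k)) ^ (1 / 2 : ℝ) ∧
        Tendsto (fun n => eLpNorm (fun t => f t -
          partialSum n fun k => schrodingerPhase k t * 𝓕⁻ (φ k) t) 4 volume) atTop (𝓝 0) ∧
        ∀ᵐ t, ∀ k, coeffL4 k (f t) = schrodingerPhase k t * 𝓕⁻ (φ k) t := by
  obtain ⟨C, hC, hS⟩ := exists_strichartz hβ
  refine ⟨C ^ (1 / 4 : ℝ), by finiteness, fun φ hm hi hfin => ?_⟩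
  set c : ℤ → ℝ → ℂ := fun k t => schrodingerPhase k t * 𝓕⁻ (φ k) t
  have hc : ∀ k, Continuous (c k) := fun k =>
    (continuous_schrodingerPhase k).mul (continuous_fourierInv_of_integrable (hi k))
  have hbound : ∀ s : Finset ℤ, eLpNorm (fun t => trigPoly s fun k => c k t) 4 volume ≤
      C ^ (1 / 4 : ℝ) * (∑ k ∈ s, weightedSq β (φ k)) ^ (1 / 2 : ℝ) := by
    intro s
    rw [eLpNorm_four_eq]
    calc _ ≤ (C * (∑ k ∈ s, weightedSq β (φ k)) ^ 2) ^ (1 / 4 : ℝ) := by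
          gcongr
          exact hS s φ hm hi
      _ = _ := by
          rw [ENNReal.mul_rpow_of_nonneg _ _ (by norm_num), ← ENNReal.rpow_natCast,
            ← ENNReal.rpow_mul]
          norm_num
  have hmem : ∀ s : Finset ℤ, MemLp (fun t => trigPoly s fun k => c k t) 4 volume := by
    intro s
    refine ⟨(continuous_trigPoly hc).aestronglyMeasurable, (hbound s).trans_lt ?_⟩
    have : ∑ k ∈ s, weightedSq β (φ k) ≠ ∞ := ne_top_of_le_ne_top hfin (ENNReal.sum_le_tsum s)
    finiteness
  set S : ℕ → Finset ℤ := fun n => Finset.Icc (-(n : ℤ)) n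
  have hSmono : Monotone S := fun m n hmn => Finset.Icc_subset_Icc (by omega) (by omega)
  have hSatTop : Tendsto S atTop atTop := by
    refine tendsto_atTop_finset_of_monotone hSmono fun k => ⟨k.natAbs, ?_⟩
    simp only [S, Finset.mem_Icc]; omega
  set q : ℕ → Lp L4T 4 (volume : Measure ℝ) := fun n => (hmem (S n)).toLp _
  -- Two partial sums differ by a polynomial with frequencies outside the smaller index set, so
  -- Strichartz bounds their distance by a tail of the convergent series.
  set tail : ℕ → ℝ≥0∞ := fun n => ∑' k : { x // x ∉ S n }, weightedSq β (φ k)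
  have htail : Tendsto tail atTop (𝓝 0) :=
    (ENNReal.tendsto_tsum_compl_atTop_zero hfin).comp hSatTop
  have hdist : ∀ m n, m ≤ n → edist (q n) (q m) ≤ C ^ (1 / 4 : ℝ) * tail m ^ (1 / 2 : ℝ) := by
    intro m n hmn
    rw [Lp.edist_toLp_toLp]
    have e : ((fun t => trigPoly (S n) fun k => c k t) - fun t => trigPoly (S m) fun k => c k t) =
        fun t => trigPoly (S n \ S m) fun k => c k t := by
      ext1 t
      exact trigPoly_sub_of_subset (hSmono hmn) _
    rw [e]
    refine (hbound _).trans ?_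
    gcongr
    have : ∑ k ∈ S n \ S m, weightedSq β (φ k) =
        ∑ k ∈ (S n \ S m).subtype (· ∉ S m), weightedSq β (φ k) := by
      rw [Finset.sum_subtype_of_mem fun k => weightedSq β (φ k)]
      intro x hx
      exact (Finset.mem_sdiff.1 hx).2
    rw [this]
    exact ENNReal.sum_le_tsum _
  have hlim0 : Tendsto (fun m => C ^ (1 / 4 : ℝ) * tail m ^ (1 / 2 : ℝ)) atTop (𝓝 0) := by
    have h1 := (ENNReal.continuous_rpow_const (y := (1 / 2 : ℝ))).tendsto 0 |>.comp htail
    rw [ENNReal.zero_rpow_of_pos (by norm_num)] at h1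
    have h2 := ENNReal.Tendsto.const_mul h1 (Or.inr (show C ^ (1 / 4 : ℝ) ≠ ∞ by finiteness))
    rwa [mul_zero] at h2
  have hcauchy : CauchySeq q := by
    rw [EMetric.cauchySeq_iff_le_tendsto_0]
    refine ⟨fun N => C ^ (1 / 4 : ℝ) * tail N ^ (1 / 2 : ℝ) +
      C ^ (1 / 4 : ℝ) * tail N ^ (1 / 2 : ℝ), fun n m N hn hm' => ?_, by
        simpa using hlim0.add hlim0⟩
    refine (edist_triangle_right (q n) (q m) (q N)).trans ?_
    exact add_le_add (hdist N n hn) (hdist N m hm')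
  obtain ⟨F, hF⟩ := cauchySeq_tendsto_of_complete hcauchy
  have hFlim : Tendsto (fun n => eLpNorm ((fun t => trigPoly (S n) fun k => c k t) - (F : ℝ → L4T)) 4 volume)
      atTop (𝓝 0) := by
    have h1 := (Lp.tendsto_Lp_iff_tendsto_eLpNorm' q F).1 hF
    refine h1.congr fun n => ?_
    exact eLpNorm_congr_ae ((hmem (S n)).coeFn_toLp.sub (ae_eq_refl _))
  refine ⟨F, Lp.memLp F, ?_, ?_, ?_⟩
  · have h1 : Tendsto (fun n => ‖q n‖ₑ) atTop (𝓝 ‖F‖ₑ) := hF.enorm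
    rw [← Lp.enorm_def]
    refine le_of_tendsto' h1 fun n => ?_
    rw [Lp.enorm_def, eLpNorm_congr_ae (hmem (S n)).coeFn_toLp]
    refine (hbound _).trans ?_
    gcongr
    exact ENNReal.sum_le_tsum _
  · refine hFlim.congr fun n => ?_
    rw [← eLpNorm_neg]
    congr 1
    ext1 t
    simp only [Pi.neg_apply, Pi.sub_apply, neg_sub]
    rfl
  -- A subsequence converges for a.e. `t`, and the `k`-th coefficient of the partial sums is
  -- eventually constant, which identifies that of the limit.
  · have hmeas := tendstoInMeasure_of_tendsto_eLpNorm (p := 4) (by norm_num)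
      (fun n => (hmem (S n)).1) (Lp.aestronglyMeasurable F) hFlim
    obtain ⟨ns, hns, hae⟩ := hmeas.exists_seq_tendsto_ae
    filter_upwards [hae] with t ht k
    have h1 : Tendsto (fun i => coeffL4 k (trigPoly (S (ns i)) fun k => c k t)) atTop
        (𝓝 (coeffL4 k (F t))) := ((coeffL4 k).continuous.tendsto _).comp ht
    refine tendsto_nhds_unique h1 (tendsto_const_nhds.congr' ?_)
    filter_upwards [hns.tendsto_atTop.eventually_ge_atTop k.natAbs] with i hi'
    rw [coeffL4_trigPoly, if_pos]
    simp only [S, Finset.mem_Icc]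
    omega

lemma weightedSq_congr_ae {s : ℝ} {φ ψ : ℝ → ℂ} (h : φ =ᵐ[volume] ψ) :
    weightedSq s φ = weightedSq s ψ :=
  lintegral_congr_ae (by filter_upwards [h] with r hr; rw [hr])

/-- Cauchy-Schwarz against the weight to the power `-b`, which is integrable exactly because `b >
1/2`. It makes the inverse Fourier integrals meaningful at every time. -/
lemma integrable_of_weightedSq_ne_top {b : ℝ} (hb : 1 / 2 < b) {φ : ℝ → ℂ} (hm : Measurable φ)
    (h : weightedSq b φ ≠ ∞) : Integrable φ := by
  refine ⟨hm.aestronglyMeasurable, ?_⟩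
  have hW : ∀ s : ℝ, Measurable fun r => freqWeight r ^ s := fun s =>
    (continuous_freqWeight_rpow s).measurable
  have e : ∀ r, ‖φ r‖ₑ = ENNReal.ofReal (freqWeight r ^ (-b)) ^ (1 / 2 : ℝ) *
      (ENNReal.ofReal (freqWeight r ^ b) * ‖φ r‖ₑ ^ 2) ^ (1 / 2 : ℝ) := by
    intro r
    have h0 := freqWeight_pos r
    rw [← ENNReal.mul_rpow_of_nonneg _ _ (by norm_num), ← mul_assoc,
      ← ENNReal.ofReal_mul (by positivity), ← Real.rpow_add h0, neg_add_cancel, Real.rpow_zero,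
      ENNReal.ofReal_one, one_mul, ENNReal_sq_sqrt]
  have h1 := lintegral_sqrt_mul_sqrt_le (μ := volume)
    (f := fun r => ENNReal.ofReal (freqWeight r ^ (-b)))
    (g := fun r => ENNReal.ofReal (freqWeight r ^ b) * ‖φ r‖ₑ ^ 2)
    (hW _).ennreal_ofReal.aemeasurable
    ((hW b).ennreal_ofReal.mul (hm.enorm.pow_const 2)).aemeasurable
  rw [hasFiniteIntegral_iff_enorm]
  rw [lintegral_congr e]
  refine h1.trans_lt ?_
  have h2 := (integrable_freqWeight_rpow hb).lintegral_lt_top.ne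
  have h3 : ∫⁻ r, ENNReal.ofReal (freqWeight r ^ b) * ‖φ r‖ₑ ^ 2 ≠ ∞ := h
  exact ENNReal.mul_lt_top (ENNReal.rpow_lt_top_of_nonneg one_half_pos.le h2)
    (ENNReal.rpow_lt_top_of_nonneg one_half_pos.le h3)

/-- The Fourier transform in time of the `k`-th interaction-picture coefficient of `f`. -/
def bourgainSymbol (f : L2SpaceTime) (k : ℤ) (r : ℝ) : ℂ :=
  coeffL2 k ((𝓕 f : L2SpaceTime) (r - (k : ℝ) ^ 2 / (2 * π)))

lemma measurable_bourgainSymbol (f : L2SpaceTime) (k : ℤ) : Measurable (bourgainSymbol f k) := by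
  have h1 : StronglyMeasurable ((𝓕 f : L2SpaceTime) : ℝ → L2T) := Lp.stronglyMeasurable _
  have h2 : StronglyMeasurable fun r => coeffL2 k ((𝓕 f : L2SpaceTime) r) :=
    (coeffL2 k).continuous.comp_stronglyMeasurable h1
  exact h2.measurable.comp (measurable_id.sub_const _)

/-- The substitution `τ + k² = 2πr` turns `⟨τ + k²⟩^{2b}` into the weight at `r`; the factor `2π` is
its Jacobian. -/
lemma bourgainNorm_eq (b : ℝ) (f : L2SpaceTime) :
    bourgainNorm b f =
      (ENNReal.ofReal (2 * π) * ∑' k, weightedSq b (bourgainSymbol f k)) ^ (1 / 2 : ℝ) := by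
  have hπ := Real.pi_pos
  rw [bourgainNorm, ← ENNReal.tsum_mul_left]
  congr 2
  ext k
  set g : ℝ → ℝ≥0∞ := fun r => ENNReal.ofReal (freqWeight (r + (k : ℝ) ^ 2 / (2 * π)) ^ b) *
    ‖coeffL2 k ((𝓕 f : L2SpaceTime) r)‖ₑ ^ 2
  have e1 : ∀ τ : ℝ, (ENNReal.ofReal ((1 + (τ + (k : ℝ) ^ 2) ^ 2) ^ (b / 2)) *
      ‖spaceTimeFourier f k τ‖ₑ) ^ 2 = g ((2 * π)⁻¹ * τ) := by
    intro τ
    simp only [g]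
    rw [mul_pow, spaceTimeFourier, ← coeffL2_apply,
      show τ / (2 * π) = (2 * π)⁻¹ * τ from div_eq_inv_mul _ _]
    congr 1
    have h0 : 0 < 1 + (τ + (k : ℝ) ^ 2) ^ 2 := by positivity
    have h1 : freqWeight ((2 * π)⁻¹ * τ + (k : ℝ) ^ 2 / (2 * π)) = 1 + (τ + (k : ℝ) ^ 2) ^ 2 := by
      unfold freqWeight; field_simp
    rw [h1, ← ENNReal.ofReal_pow (by positivity), ← Real.rpow_natCast,
      ← Real.rpow_mul h0.le]
    congr 2
    push_cast; ring
  simp_rw [e1]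
  have e2 : ∫⁻ τ, g ((2 * π)⁻¹ * τ) = ENNReal.ofReal (2 * π) * ∫⁻ r, g r := by
    have hinj : MeasurableEmbedding fun τ : ℝ => (2 * π)⁻¹ * τ :=
      (Homeomorph.mulLeft₀ (2 * π)⁻¹ (by positivity)).measurableEmbedding
    rw [← hinj.lintegral_map, Real.map_volume_mul_left (by positivity), lintegral_smul_measure,
      inv_inv, abs_of_pos (by positivity), smul_eq_mul]
  rw [e2, weightedSq]
  congr 1
  rw [← lintegral_sub_right_eq_self g ((k : ℝ) ^ 2 / (2 * π))]
  refine lintegral_congr fun r => ?_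
  simp only [g, bourgainSymbol, sub_add_cancel]

lemma schrodingerPhase_mul_fourierInv_shift (k : ℤ) (φ : ℝ → ℂ) (t : ℝ) :
    schrodingerPhase k t * 𝓕⁻ (fun r => φ (r - (k : ℝ) ^ 2 / (2 * π))) t = 𝓕⁻ φ t := by
  rw [schrodingerPhase_mul_fourierInv, Real.fourierInv_eq_fourier_neg]
  simp only [add_sub_cancel_right]

lemma fourier_schrodingerPhase_mul (k : ℤ) (V : ℝ → ℂ) (r : ℝ) :
    𝓕 (fun t => schrodingerPhase k t * V t) (r - (k : ℝ) ^ 2 / (2 * π)) = 𝓕 V r := by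
  rw [Real.fourier_real_eq_integral_exp_smul, Real.fourier_real_eq_integral_exp_smul]
  refine integral_congr_ae (Filter.Eventually.of_forall fun t => ?_)
  simp only [smul_eq_mul]
  rw [schrodingerPhase, ← mul_assoc, ← Complex.exp_add]
  congr 2
  push_cast
  field_simp
  ring

/-- The `X^{0,b}` norm of a function given by its interaction-picture coefficients `V k`. -/
lemma bourgainNorm_eq_of_coeffL2 {b : ℝ} (f : L2SpaceTime) (V : ℤ → ℝ → ℂ)
    (hf : ∀ k, (fun t => coeffL2 k (f t)) =ᵐ[volume] fun t => schrodingerPhase k t * V k t)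
    (hV : ∀ k, Integrable (V k)) :
    bourgainNorm b f = (ENNReal.ofReal (2 * π) * ∑' k, weightedSq b (𝓕 (V k))) ^ (1 / 2 : ℝ) := by
  rw [bourgainNorm_eq]
  congr 3
  ext k
  refine weightedSq_congr_ae ?_
  have hi : Integrable fun t => coeffL2 k (f t) := by
    refine Integrable.congr ?_ (hf k).symm
    exact (hV k).bdd_mul (c := 1) (continuous_schrodingerPhase k).aestronglyMeasurable
      (Eventually.of_forall fun t => (norm_schrodingerPhase k t).le)
  have h1 := clm_fourier_L2_ae_eq f (coeffL2 k) hi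
  have h2 := (measurePreserving_sub_right volume
    ((k : ℝ) ^ 2 / (2 * π))).quasiMeasurePreserving.ae h1
  filter_upwards [h2] with r hr
  rw [bourgainSymbol, hr, Real.fourier_congr_ae (hf k), fourier_schrodingerPhase_mul]

/-- `X^{0,b} ⊆ L⁴` for `b > 1/2`. -/
theorem exists_L4_of_bourgainNorm_lt_top {b : ℝ} (hb : 1 / 2 < b) (f : L2SpaceTime)
    (hf : bourgainNorm b f < ∞) :
    ∃ g : ℝ → L4T, MemLp g 4 volume ∧ ∀ᵐ t, inclL4 (g t) = f t := by
  have hπ := Real.pi_pos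
  obtain ⟨C, -, h⟩ := exists_L4_of_weightedSq (β := b) (by linarith)
  have hfin : ∑' k, weightedSq b (bourgainSymbol f k) ≠ ∞ := by
    intro htop
    rw [bourgainNorm_eq, htop, ENNReal.mul_top (by simp [hπ]), ENNReal.top_rpow_of_pos (by norm_num)]
      at hf
    exact lt_irrefl _ hf
  have hi : ∀ k, Integrable (bourgainSymbol f k) := fun k =>
    integrable_of_weightedSq_ne_top hb (measurable_bourgainSymbol f k)
      (ENNReal.ne_top_of_tsum_ne_top hfin k)
  obtain ⟨g, hg, -, -, hgc⟩ := h (bourgainSymbol f) (measurable_bourgainSymbol f) hi hfin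
  refine ⟨g, hg, ?_⟩
  have h2 : ∀ᵐ t, ∀ k, coeffL2 k (f t) = schrodingerPhase k t * 𝓕⁻ (bourgainSymbol f k) t := by
    rw [ae_all_iff]
    intro k
    have hi' : Integrable fun r => coeffL2 k ((𝓕 f : L2SpaceTime) r) := by
      refine ((hi k).comp_add_right ((k : ℝ) ^ 2 / (2 * π))).congr (Eventually.of_forall fun r => ?_)
      simp only [bourgainSymbol, add_sub_cancel_right]
    filter_upwards [clm_L2_ae_eq_fourierInv f (coeffL2 k) hi'] with t ht
    rw [ht]
    exact (schrodingerPhase_mul_fourierInv_shift k _ t).symm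
  filter_upwards [hgc, h2] with t h3 h4
  exact ext_coeffL2 fun k => (h3 k).trans (h4 k).symm

/-! ### The linear equation with `L^{4/3}` forcing: oscillation, existence and continuity. -/

/-- `u` solves the Schrödinger equation `∂ₜu = i ∂ₓ²u + F` on `J`, in the sense of Duhamel's formula
for the Fourier coefficients in the interaction picture. -/
def IsDuhamel (J : Set ℝ) (F : ℝ → DualL4T) (u : ℝ → L2T) : Prop :=
  ∀ s ∈ J, ∀ t ∈ J, ∀ k,
    coeffL2 k (freeFlow (-t) (u t) - freeFlow (-s) (u s)) = ∫ τ in s..t, forcingCoeff F k τ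

lemma IsDuhamel.mono {J J' : Set ℝ} {F : ℝ → DualL4T} {u : ℝ → L2T} (h : IsDuhamel J F u)
    (hJ : J' ⊆ J) : IsDuhamel J' F u := fun s hs t ht => h s (hJ hs) t (hJ ht)

lemma uIoc_subset_Icc_of_mem {a c s t : ℝ} (hs : s ∈ Icc a c) (ht : t ∈ Icc a c) :
    uIoc s t ⊆ Icc a c := fun _ hx =>
  ⟨(le_min hs.1 ht.1).trans hx.1.le, hx.2.trans (max_le hs.2 ht.2)⟩

lemma isFiniteMeasure_restrict_Icc (a c : ℝ) : IsFiniteMeasure (volume.restrict (Icc a c)) :=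
  isFiniteMeasure_restrict.2 (by simp)

lemma intervalIntegrable_forcingCoeff {a c s t : ℝ} {F : ℝ → DualL4T}
    (hF : MemLp F (4 / 3) (volume.restrict (Icc a c))) (hs : s ∈ Icc a c) (ht : t ∈ Icc a c)
    (k : ℤ) : IntervalIntegrable (forcingCoeff F k) volume s t := by
  have := isFiniteMeasure_restrict_Icc a c
  rw [intervalIntegrable_iff]
  exact IntegrableOn.mono_set (integrable_forcingCoeff hF k) (uIoc_subset_Icc_of_mem hs ht)

lemma exists_tsum_integral_forcingCoeff_le {β : ℝ} (hβ : 3 / 8 < β) (hβ1 : β ≤ 1) :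
    ∃ C : ℝ≥0∞, C ≠ ∞ ∧ ∀ (L : ℝ), 0 < L → ∀ (a c : ℝ), c - a ≤ L → ∀ (F : ℝ → DualL4T),
      MemLp F (4 / 3) (volume.restrict (Icc a c)) → ∀ s ∈ Icc a c, ∀ t ∈ Icc a c,
      ∑' k, ‖∫ τ in s..t, forcingCoeff F k τ‖ₑ ^ 2 ≤
        C * ENNReal.ofReal (cutoffScale β L) *
          eLpNorm F (4 / 3) (volume.restrict (uIoc s t)) ^ 2 := by
  obtain ⟨C, hC, h⟩ := exists_dual_homogeneous_strichartz hβ hβ1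
  refine ⟨C, hC, fun L hL a c hac F hF s hs t ht => ?_⟩
  have hsub := uIoc_subset_Icc_of_mem hs ht
  rw [ENNReal.tsum_eq_iSup_sum]
  refine iSup_le fun S => ?_
  have h1 := h L hL a (uIoc s t) (fun x hx => ⟨by linarith [(hsub hx).1], by linarith [(hsub hx).2]⟩)
    F (hF.mono_measure (Measure.restrict_mono hsub le_rfl)) S
  refine le_trans (le_of_eq (Finset.sum_congr rfl fun k _ => ?_)) h1
  rw [← ofReal_norm, intervalIntegral.norm_intervalIntegral_eq, ofReal_norm]

lemma enorm_freeFlow (t : ℝ) (u : L2T) : ‖freeFlow t u‖ₑ = ‖u‖ₑ :=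
  (freeFlow t).enorm_map u

/-- By Parseval the increment in the interaction picture is the `ℓ²` sum of the time integrals of
the forcing coefficients, which the dual homogeneous estimate bounds by the forcing between `s` and
`t`. Continuity with values in `L²` comes from here. -/
lemma exists_oscillation_le {β : ℝ} (hβ : 3 / 8 < β) (hβ1 : β ≤ 1) :
    ∃ C : ℝ≥0∞, C ≠ ∞ ∧ ∀ (L : ℝ), 0 < L → ∀ (a c : ℝ), c - a ≤ L → ∀ (F : ℝ → DualL4T),
      MemLp F (4 / 3) (volume.restrict (Icc a c)) → ∀ (u : ℝ → L2T), IsDuhamel (Icc a c) F u →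
      ∀ s ∈ Icc a c, ∀ t ∈ Icc a c,
      ‖freeFlow (-t) (u t) - freeFlow (-s) (u s)‖ₑ ≤
        C * ENNReal.ofReal (cutoffScale β L) ^ (1 / 2 : ℝ) *
          eLpNorm F (4 / 3) (volume.restrict (uIoc s t)) := by
  have hπ : (1 : ℝ) ≤ 2 * π := by linarith [Real.pi_gt_three]
  obtain ⟨C, hC, h⟩ := exists_tsum_integral_forcingCoeff_le hβ hβ1
  refine ⟨C ^ (1 / 2 : ℝ), by finiteness, fun L hL a c hac F hF u hu s hs t ht => ?_⟩
  have h1 := h L hL a c hac F hF s hs t ht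
  simp_rw [← hu s hs t ht] at h1
  rw [tsum_enorm_sq_coeffL2] at h1
  have h2 : ‖freeFlow (-t) (u t) - freeFlow (-s) (u s)‖ₑ ^ 2 ≤ C * ENNReal.ofReal (cutoffScale β L) *
          eLpNorm F (4 / 3) (volume.restrict (uIoc s t)) ^ 2 := by
    refine le_trans ?_ h1
    calc _ = 1 * ‖freeFlow (-t) (u t) - freeFlow (-s) (u s)‖ₑ ^ 2 := (one_mul _).symm
      _ ≤ _ := by
        refine mul_le_mul_left ?_ _
        rw [ENNReal.one_le_ofReal]; exact hπ
  have h3 := ENNReal.rpow_le_rpow h2 one_half_pos.le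
  rwa [ENNReal_sq_sqrt, ENNReal.mul_rpow_of_nonneg _ _ one_half_pos.le,
    ENNReal.mul_rpow_of_nonneg _ _ one_half_pos.le, ENNReal_sq_sqrt] at h3

/-- Existence for the linear equation. -/
lemma exists_isDuhamel {a c t₀ : ℝ} {F : ℝ → DualL4T}
    (hF : MemLp F (4 / 3) (volume.restrict (Icc a c))) (ht₀ : t₀ ∈ Icc a c) (u₀ : L2T) :
    ∃ u : ℝ → L2T, IsDuhamel (Icc a c) F u ∧ u t₀ = u₀ := by
  obtain ⟨C, hC, h⟩ := exists_tsum_integral_forcingCoeff_le (β := 1 / 2) (by norm_num) (by norm_num)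
  have hac := ht₀.1.trans ht₀.2
  have hw : ∀ t, ∃ w : L2T, t ∈ Icc a c →
      ∀ k, coeffL2 k w = ∫ τ in t₀..t, forcingCoeff F k τ := by
    intro t
    by_cases ht : t ∈ Icc a c
    · have h1 := h (c - a + 1) (by linarith) a c (by linarith) F hF t₀ ht₀ t ht
      have hF' := (hF.mono_measure (Measure.restrict_mono (uIoc_subset_Icc_of_mem ht₀ ht) le_rfl)).2.ne
      have h2 : ∑' k, ‖∫ τ in t₀..t, forcingCoeff F k τ‖ₑ ^ 2 ≠ ∞ :=
        ne_top_of_le_ne_top (by finiteness) h1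
      have h3 := ENNReal.summable_toReal h2
      obtain ⟨w, hw⟩ := exists_coeffL2_eq (a := fun k => ∫ τ in t₀..t, forcingCoeff F k τ)
        (h3.congr fun k => by simp)
      exact ⟨w, fun _ => hw⟩
    · exact ⟨0, fun h => absurd h ht⟩
  choose w hw using hw
  have hw0 : w t₀ = 0 := ext_coeffL2 fun k => by rw [hw t₀ ht₀]; simp
  refine ⟨fun t => freeFlow t (freeFlow (-t₀) u₀ + w t), fun s hs t ht k => ?_, ?_⟩
  · simp only [freeFlow_neg_freeFlow]
    rw [add_sub_add_left_eq_sub, map_sub, hw t ht, hw s hs]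
    exact intervalIntegral.integral_interval_sub_left
      (intervalIntegrable_forcingCoeff hF ht₀ ht k) (intervalIntegrable_forcingCoeff hF ht₀ hs k)
  · simp only [hw0, add_zero, freeFlow_freeFlow_neg]

/-- Absolute continuity of the integral of `‖F‖^{4/3}`. -/
lemma tendsto_eLpNorm_restrict_uIoc {E : Type*} [NormedAddCommGroup E] {F : ℝ → E} {J : Set ℝ}
    (hF : MemLp F (4 / 3) (volume.restrict J)) {t₀ : ℝ} (hJ : ∀ t ∈ J, uIoc t₀ t ⊆ J) :
    Tendsto (fun t => eLpNorm F (4 / 3) (volume.restrict (uIoc t₀ t))) (𝓝[J] t₀) (𝓝 0) := by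
  have h43 : (4 / 3 : ℝ≥0∞).toReal = 4 / 3 := by simp
  have h430 : (4 / 3 : ℝ≥0∞) ≠ 0 := by simp
  have h43t : (4 / 3 : ℝ≥0∞) ≠ ∞ := by finiteness
  have h1 : ∫⁻ t in J, ‖F t‖ₑ ^ (4 / 3 : ℝ) ≠ ∞ := by
    have := lintegral_rpow_enorm_lt_top_of_eLpNorm_lt_top h430 h43t hF.2
    rw [h43] at this
    exact this.ne
  have h2 : Tendsto (fun t => volume.restrict J (uIoc t₀ t)) (𝓝[J] t₀) (𝓝 0) := by
    have h3 : Tendsto (fun t : ℝ => ENNReal.ofReal |t - t₀|) (𝓝[J] t₀) (𝓝 0) := by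
      refine Tendsto.mono_left ?_ nhdsWithin_le_nhds
      have : Continuous fun t : ℝ => ENNReal.ofReal |t - t₀| :=
        ENNReal.continuous_ofReal.comp (by fun_prop)
      exact this.tendsto' _ _ (by simp)
    refine tendsto_of_tendsto_of_tendsto_of_le_of_le tendsto_const_nhds h3 (fun _ => zero_le) fun t => ?_
    exact (Measure.restrict_apply_le _ _).trans_eq (by rw [Real.volume_uIoc])
  have h4 := tendsto_setLIntegral_zero (s := fun t => uIoc t₀ t) h1 h2
  have h5 := ((ENNReal.continuous_rpow_const (y := (3 / 4 : ℝ))).tendsto 0).comp h4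
  rw [ENNReal.zero_rpow_of_pos (by norm_num)] at h5
  refine h5.congr' ?_
  filter_upwards [self_mem_nhdsWithin] with t ht
  rw [eLpNorm_eq_lintegral_rpow_enorm_toReal h430 h43t, h43, Function.comp_apply,
    Measure.restrict_restrict measurableSet_uIoc, inter_eq_left.2 (hJ t ht)]
  norm_num

lemma IsDuhamel.continuousOn_freeFlow_neg {a c : ℝ} {F : ℝ → DualL4T} {u : ℝ → L2T}
    (h : IsDuhamel (Icc a c) F u) (hF : MemLp F (4 / 3) (volume.restrict (Icc a c))) :
    ContinuousOn (fun t => freeFlow (-t) (u t)) (Icc a c) := by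
  obtain ⟨C, hC, hosc⟩ := exists_oscillation_le (β := 1 / 2) (by norm_num) (by norm_num)
  intro t₀ ht₀
  have hac := ht₀.1.trans ht₀.2
  set K := C * ENNReal.ofReal (cutoffScale (1 / 2) (c - a + 1)) ^ (1 / 2 : ℝ)
  have hK : K ≠ ∞ := by
    have : ENNReal.ofReal (cutoffScale (1 / 2) (c - a + 1)) ^ (1 / 2 : ℝ) ≠ ∞ := by finiteness
    exact ENNReal.mul_ne_top hC this
  have h1 := tendsto_eLpNorm_restrict_uIoc hF (t₀ := t₀) fun t ht => uIoc_subset_Icc_of_mem ht₀ ht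
  have h2 := ENNReal.Tendsto.const_mul h1 (Or.inr hK)
  rw [mul_zero] at h2
  rw [ContinuousWithinAt, tendsto_iff_edist_tendsto_0]
  refine tendsto_of_tendsto_of_tendsto_of_le_of_le' tendsto_const_nhds h2
    (Eventually.of_forall fun _ => zero_le) ?_
  filter_upwards [self_mem_nhdsWithin] with t ht
  rw [edist_eq_enorm_sub]
  exact hosc _ (by linarith) a c (by linarith) F hF u h t₀ ht₀ t ht

lemma IsDuhamel.continuousOn {a c : ℝ} {F : ℝ → DualL4T} {u : ℝ → L2T}
    (h : IsDuhamel (Icc a c) F u) (hF : MemLp F (4 / 3) (volume.restrict (Icc a c))) :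
    ContinuousOn u (Icc a c) :=
  (continuousOn_freeFlow continuous_id (h.continuousOn_freeFlow_neg hF)).congr fun t _ =>
    (freeFlow_freeFlow_neg t (u t)).symm

/-- The projection of the real line onto `[p, q]`. -/
def clampTo (p q t : ℝ) : ℝ := max p (min q t)

@[fun_prop]
lemma continuous_clampTo (p q : ℝ) : Continuous (clampTo p q) := by
  unfold clampTo; fun_prop

lemma clampTo_mem {p q : ℝ} (h : p ≤ q) (t : ℝ) : clampTo p q t ∈ Icc p q :=
  ⟨le_max_left _ _, max_le h (min_le_left _ _)⟩

lemma clampTo_of_mem {p q t : ℝ} (h : t ∈ Icc p q) : clampTo p q t = t := by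
  rw [clampTo, min_eq_right h.2, max_eq_right h.1]

lemma clampTo_of_le {p q t : ℝ} (h : t ≤ p) : clampTo p q t = p :=
  max_eq_left ((min_le_right _ _).trans h)

lemma clampTo_of_ge {p q t : ℝ} (hpq : p ≤ q) (h : q ≤ t) : clampTo p q t = q := by
  rw [clampTo, min_eq_left h, max_eq_right hpq]

lemma clampTo_mono (p q : ℝ) : Monotone (clampTo p q) := fun _ _ h =>
  max_le_max le_rfl (min_le_min le_rfl h)

lemma intervalIntegral_indicator_Ioc {p q : ℝ} (G : ℝ → ℂ) (s t : ℝ) :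
    ∫ τ in s..t, (Ioc p q).indicator G τ = ∫ τ in clampTo p q s..clampTo p q t, G τ := by
  have key : ∀ s t : ℝ, s ≤ t →
      ∫ τ in s..t, (Ioc p q).indicator G τ = ∫ τ in clampTo p q s..clampTo p q t, G τ := by
    intro s t hst
    rw [intervalIntegral.integral_of_le hst, intervalIntegral.integral_of_le (clampTo_mono p q hst),
      setIntegral_indicator measurableSet_Ioc]
    congr 2
    ext x
    simp only [clampTo, mem_inter_iff, mem_Ioc, max_lt_iff, min_lt_iff, le_max_iff, le_min_iff]
    constructor
    · rintro ⟨⟨h1, h2⟩, h3, h4⟩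
      exact ⟨⟨h3, Or.inr h1⟩, Or.inr ⟨h4, h2⟩⟩
    · rintro ⟨⟨h1, h2⟩, h3⟩
      rcases h3 with h3 | ⟨h3, h4⟩
      · exact absurd h1 (not_lt.2 h3)
      · rcases h2 with h2 | h2
        · exact absurd h2 (not_lt.2 h3)
        · exact ⟨⟨h2, h4⟩, h1, h3⟩
  rcases le_total s t with h | h
  · exact key s t h
  · rw [intervalIntegral.integral_symm, key t s h, intervalIntegral.integral_symm, neg_neg]

/-! ### Extension to the whole line and the linear estimate in `X^{0,b}`. -/

lemma freqWeight_rpow_le_one {s : ℝ} (hs : s ≤ 0) (r : ℝ) : freqWeight r ^ s ≤ 1 :=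
  Real.rpow_le_one_of_one_le_of_nonpos (one_le_freqWeight r) hs

lemma weightedSq_le_of_nonpos {s : ℝ} (hs : s ≤ 0) {f : ℝ → ℂ} (hf : Integrable f)
    (hf2 : MemLp f 2) : weightedSq s (𝓕 f) ≤ ∫⁻ t, ‖f t‖ₑ ^ 2 := by
  rw [← lintegral_enorm_fourier_sq hf hf2]
  refine lintegral_mono fun r => ?_
  calc _ ≤ 1 * ‖𝓕 f r‖ₑ ^ 2 := by
        refine mul_le_mul_left ?_ _
        rw [ENNReal.ofReal_le_one]
        exact freqWeight_rpow_le_one hs r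
    _ = _ := one_mul _

/-- Control of the `H^b` norm in time by the `L²` norm and the `H^{b-1}` norm of the derivative. -/
lemma weightedSq_le_of_primitive {b : ℝ} (hb : b ≤ 1) {V H : ℝ → ℂ} {A B : ℝ} (hAB : A ≤ B)
    (hH : ∀ s t, IntervalIntegrable H volume s t) (hV : ∀ s t, V t - V s = ∫ v in s..t, H v)
    (hV0 : ∀ t, t ∉ Ioo A B → V t = 0) (hH0 : ∀ t, t ∉ Ioc A B → H t = 0)
    (hVi : Integrable V) (hV2 : MemLp V 2) :
    weightedSq b (𝓕 V) ≤ (∫⁻ t, ‖V t‖ₑ ^ 2) + weightedSq (b - 1) (𝓕 H) := by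
  have e := fourier_eq_of_primitive hAB hH hV hV0 hH0
  -- One power of the weight is split as `1 + (2πr)²`, and `2πr` times the transform of `V` is that
  -- of its derivative `H`, up to a factor `i`.
  have h1 : weightedSq b (𝓕 V) = weightedSq (b - 1) (𝓕 V) + weightedSq (b - 1) (𝓕 H) := by
    unfold weightedSq
    rw [← lintegral_add_left]
    · refine lintegral_congr fun r => ?_
      have h0 := freqWeight_pos r
      have h2 : freqWeight r ^ b = freqWeight r ^ (b - 1) * freqWeight r := by
        rw [← Real.rpow_add_one h0.ne']; congr 1; ring
      have h3 : ‖𝓕 H r‖ₑ ^ 2 = ENNReal.ofReal ((2 * π * r) ^ 2) * ‖𝓕 V r‖ₑ ^ 2 := by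
        rw [e r, enorm_mul, mul_pow]
        congr 1
        rw [← ofReal_norm, ← ENNReal.ofReal_pow (norm_nonneg _)]
        congr 1
        rw [norm_mul, Complex.norm_I, mul_one,
          show (2 * π * r : ℂ) = ((2 * π * r : ℝ) : ℂ) by push_cast; rfl, Complex.norm_real,
          Real.norm_eq_abs, sq_abs]
      rw [h3, ← mul_assoc, ← ENNReal.ofReal_mul (by positivity), ← add_mul,
        ← ENNReal.ofReal_add (by positivity) (by positivity), h2]
      congr 2
      unfold freqWeight; ring
    · exact ((continuous_freqWeight_rpow _).measurable.ennreal_ofReal.mul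
        ((continuous_fourier_of_integrable hVi).measurable.enorm.pow_const 2))
  rw [h1]
  exact add_le_add (weightedSq_le_of_nonpos (sub_nonpos.2 hb) hVi hV2) le_rfl

lemma weightedSq_add_le (s : ℝ) {f g h : ℝ → ℂ} (hf : Measurable f) (hg : Measurable g) :
    weightedSq s (fun r => f r + g r + h r) ≤
      3 * (weightedSq s f + weightedSq s g + weightedSq s h) := by
  have hW : Measurable fun r => ENNReal.ofReal (freqWeight r ^ s) :=
    (continuous_freqWeight_rpow s).measurable.ennreal_ofReal
  have hf' : Measurable fun r => ENNReal.ofReal (freqWeight r ^ s) * ‖f r‖ₑ ^ 2 :=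
    hW.mul (hf.enorm.pow_const 2)
  have hg' : Measurable fun r => ENNReal.ofReal (freqWeight r ^ s) * ‖g r‖ₑ ^ 2 :=
    hW.mul (hg.enorm.pow_const 2)
  have hfg : Measurable fun r => ENNReal.ofReal (freqWeight r ^ s) * ‖f r‖ₑ ^ 2 +
      ENNReal.ofReal (freqWeight r ^ s) * ‖g r‖ₑ ^ 2 := hf'.add hg'
  unfold weightedSq
  rw [← lintegral_add_left hf', ← lintegral_add_left hfg,
    ← lintegral_const_mul' _ _ (by simp)]
  refine lintegral_mono fun r => ?_
  rw [← mul_add, ← mul_add, mul_left_comm]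
  refine mul_le_mul_right ?_ _
  have h1 : ‖f r + g r + h r‖ ^ 2 ≤ 3 * (‖f r‖ ^ 2 + ‖g r‖ ^ 2 + ‖h r‖ ^ 2) := by
    have h2 : ‖f r + g r + h r‖ ≤ ‖f r‖ + ‖g r‖ + ‖h r‖ := norm_add₃_le
    have h3 := pow_le_pow_left₀ (norm_nonneg _) h2 2
    nlinarith [sq_nonneg (‖f r‖ - ‖g r‖), sq_nonneg (‖f r‖ - ‖h r‖), sq_nonneg (‖g r‖ - ‖h r‖)]
  have h4 := ENNReal.ofReal_le_ofReal h1
  rwa [ENNReal.ofReal_mul (by norm_num), ENNReal.ofReal_add (by positivity) (by positivity),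
    ENNReal.ofReal_add (by positivity) (by positivity), ENNReal.ofReal_pow (by positivity),
    ENNReal.ofReal_pow (by positivity), ENNReal.ofReal_pow (by positivity),
    ENNReal.ofReal_pow (by positivity), ofReal_norm, ofReal_norm, ofReal_norm, ofReal_norm,
    ENNReal.ofReal_ofNat] at h4

lemma weightedSq_const_mul (s : ℝ) (z : ℂ) (f : ℝ → ℂ) :
    weightedSq s (fun r => z * f r) = ‖z‖ₑ ^ 2 * weightedSq s f := by
  unfold weightedSq
  rw [← lintegral_const_mul' _ _ (by finiteness)]
  refine lintegral_congr fun r => ?_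
  rw [enorm_mul, mul_pow]; ring

lemma weightedSq_fourier_indicator_le {s : ℝ} (hs : s ≤ 0) (p : ℝ) :
    weightedSq s (𝓕 ((Ioc p (p + 1)).indicator fun _ => (1 : ℂ))) ≤ 1 := by
  have hm : MemLp ((Ioc p (p + 1)).indicator fun _ => (1 : ℂ)) 2 volume :=
    memLp_indicator_const 2 measurableSet_Ioc _ (Or.inr (by simp))
  have hi : Integrable ((Ioc p (p + 1)).indicator fun _ => (1 : ℂ)) volume :=
    memLp_one_iff_integrable.1 (memLp_indicator_const 1 measurableSet_Ioc _ (Or.inr (by simp)))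
  refine (weightedSq_le_of_nonpos hs hi hm).trans ?_
  have : ∀ t, ‖(Ioc p (p + 1)).indicator (fun _ => (1 : ℂ)) t‖ₑ ^ 2 =
      (Ioc p (p + 1)).indicator (fun _ => (1 : ℝ≥0∞)) t := by
    intro t
    by_cases h : t ∈ Ioc p (p + 1)
    · simp [indicator_of_mem h]
    · simp [indicator_of_notMem h]
  simp_rw [this]
  rw [lintegral_indicator measurableSet_Ioc]
  simp

/-- The oscillation bound together with the isometry of the group. Any exponent in `(3/8, 1]` would
serve; `1/2` is used. -/
lemma exists_enorm_le_of_isDuhamel (L : ℝ) (hL : 0 < L) :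
    ∃ C : ℝ≥0∞, C ≠ ∞ ∧ ∀ (a c : ℝ), c - a ≤ L → ∀ (F : ℝ → DualL4T),
      MemLp F (4 / 3) (volume.restrict (Icc a c)) → ∀ (u : ℝ → L2T), IsDuhamel (Icc a c) F u →
      ∀ s ∈ Icc a c, ∀ t ∈ Icc a c,
        ‖u t‖ₑ ≤ C * (‖u s‖ₑ + eLpNorm F (4 / 3) (volume.restrict (Icc a c))) := by
  obtain ⟨C, hC, hosc⟩ := exists_oscillation_le (β := 1 / 2) (by norm_num) (by norm_num)
  set K := C * ENNReal.ofReal (cutoffScale (1 / 2) L) ^ (1 / 2 : ℝ)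
  have hK : K ≠ ∞ := by
    have : ENNReal.ofReal (cutoffScale (1 / 2) L) ^ (1 / 2 : ℝ) ≠ ∞ := by finiteness
    exact ENNReal.mul_ne_top hC this
  refine ⟨1 + K, by finiteness, fun a c hac F hF u hu s hs t ht => ?_⟩
  have h1 := hosc L hL a c hac F hF u hu s hs t ht
  have h2 : eLpNorm F (4 / 3) (volume.restrict (uIoc s t)) ≤
      eLpNorm F (4 / 3) (volume.restrict (Icc a c)) :=
    eLpNorm_mono_measure _ (Measure.restrict_mono (uIoc_subset_Icc_of_mem hs ht) le_rfl)
  calc ‖u t‖ₑ = ‖freeFlow (-s) (u s) + (freeFlow (-t) (u t) - freeFlow (-s) (u s))‖ₑ := by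
        rw [add_sub_cancel, enorm_freeFlow]
    _ ≤ ‖u s‖ₑ + K * eLpNorm F (4 / 3) (volume.restrict (Icc a c)) := by
        refine (enorm_add_le _ _).trans ?_
        rw [enorm_freeFlow]
        exact add_le_add le_rfl (h1.trans (mul_le_mul_right h2 _))
    _ ≤ _ := by
        rw [mul_add, add_mul, add_mul, one_mul, one_mul]
        exact add_le_add le_self_add le_add_self

/-- Extension of a function on `[a, c]` to the real line by linear ramps of length one. -/
def rampExtension (a c : ℝ) (v : ℝ → L2T) (t : ℝ) : L2T :=
  ((clampTo (a - 1) a t - (a - 1) : ℝ) : ℂ) • v a + (v (clampTo a c t) - v a) +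
    (-((clampTo c (c + 1) t - c : ℝ) : ℂ)) • v c

/-- The derivative of the coefficients of the extension by linear ramps. -/
def rampForcing (a c : ℝ) (z w : ℂ) (G : ℝ → ℂ) (t : ℝ) : ℂ :=
  z * (Ioc (a - 1) a).indicator (fun _ => 1) t + (Ioc a c).indicator G t +
    (-w) * (Ioc c (c + 1)).indicator (fun _ => 1) t

section
variable {a c : ℝ} {v : ℝ → L2T}

lemma rampExtension_of_mem {t : ℝ} (ht : t ∈ Icc a c) :
    rampExtension a c v t = v t := by
  rw [rampExtension, clampTo_of_ge (by linarith) ht.1, clampTo_of_mem ht, clampTo_of_le ht.2]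
  simp

lemma rampExtension_of_notMem (hac : a ≤ c) {t : ℝ} (ht : t ∉ Ioo (a - 1) (c + 1)) :
    rampExtension a c v t = 0 := by
  by_cases h : t ≤ a - 1
  · rw [rampExtension, clampTo_of_le h, clampTo_of_le (by linarith : t ≤ a),
      clampTo_of_le (by linarith : t ≤ c)]
    simp
  · have h2 : c + 1 ≤ t := by
      by_contra h3
      exact ht ⟨not_le.1 h, not_le.1 h3⟩
    rw [rampExtension, clampTo_of_ge (by linarith) (by linarith : a ≤ t),
      clampTo_of_ge hac (by linarith : c ≤ t), clampTo_of_ge (by linarith) h2]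
    simp

lemma continuous_rampExtension (hac : a ≤ c) (hv : ContinuousOn v (Icc a c)) :
    Continuous (rampExtension a c v) := by
  have h1 : Continuous fun t => v (clampTo a c t) :=
    hv.comp_continuous (continuous_clampTo a c) fun t => clampTo_mem hac t
  have h2 : ∀ p q x : ℝ, Continuous fun t => ((clampTo p q t - x : ℝ) : ℂ) := fun p q x =>
    Complex.continuous_ofReal.comp ((continuous_clampTo p q).sub continuous_const)
  exact (((h2 _ _ _).smul continuous_const).add (h1.sub continuous_const)).add
    ((h2 _ _ _).neg.smul continuous_const)

lemma enorm_rampExtension_le (hac : a ≤ c) {N : ℝ≥0∞} (hN : ∀ t ∈ Icc a c, ‖v t‖ₑ ≤ N) (t : ℝ) :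
    ‖rampExtension a c v t‖ₑ ≤ 4 * N := by
  have h1 : ∀ p q : ℝ, q = p + 1 → ‖((clampTo p q t - p : ℝ) : ℂ)‖ₑ ≤ 1 := by
    intro p q hq
    have h := clampTo_mem (by linarith : p ≤ q) t
    rw [← ofReal_norm, Complex.norm_real, Real.norm_eq_abs, abs_of_nonneg (by linarith [h.1]),
      ENNReal.ofReal_le_one]
    linarith [h.2]
  have ha := hN a (left_mem_Icc.2 hac)
  have hc := hN c (right_mem_Icc.2 hac)
  have ht := hN _ (clampTo_mem hac t)
  unfold rampExtension
  calc _ ≤ ‖((clampTo (a - 1) a t - (a - 1) : ℝ) : ℂ) • v a‖ₑ + (‖v (clampTo a c t)‖ₑ + ‖v a‖ₑ) +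
        ‖(-((clampTo c (c + 1) t - c : ℝ) : ℂ)) • v c‖ₑ := by
        refine (enorm_add_le _ _).trans (add_le_add ((enorm_add_le _ _).trans
          (add_le_add le_rfl enorm_sub_le)) le_rfl)
    _ ≤ 1 * N + (N + N) + 1 * N := by
        rw [enorm_smul, enorm_smul, enorm_neg]
        exact add_le_add (add_le_add (mul_le_mul' (h1 _ _ (by ring)) ha) (add_le_add ht ha))
          (mul_le_mul' (h1 _ _ rfl) hc)
    _ = _ := by ring

lemma intervalIntegrable_indicator_one (p q s t : ℝ) :
    IntervalIntegrable ((Ioc p q).indicator fun _ => (1 : ℂ)) volume s t := by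
  refine Integrable.intervalIntegrable ?_
  exact memLp_one_iff_integrable.1 (memLp_indicator_const 1 measurableSet_Ioc _ (Or.inr (by simp)))

lemma integral_rampForcing {G : ℝ → ℂ} (hG : IntegrableOn G (Ioc a c)) (z w : ℂ) (s t : ℝ) :
    ∫ τ in s..t, rampForcing a c z w G τ =
      z * (clampTo (a - 1) a t - clampTo (a - 1) a s : ℝ) +
        (∫ τ in clampTo a c s..clampTo a c t, G τ) +
        (-w) * (clampTo c (c + 1) t - clampTo c (c + 1) s : ℝ) := by
  have h1 : IntervalIntegrable ((Ioc a c).indicator G) volume s t :=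
    ((integrable_indicator_iff measurableSet_Ioc).2 hG).intervalIntegrable
  unfold rampForcing
  rw [intervalIntegral.integral_add
      (((intervalIntegrable_indicator_one _ _ _ _).const_mul _).add h1)
      ((intervalIntegrable_indicator_one _ _ _ _).const_mul _),
    intervalIntegral.integral_add ((intervalIntegrable_indicator_one _ _ _ _).const_mul _) h1,
    intervalIntegral.integral_const_mul, intervalIntegral.integral_const_mul,
    intervalIntegral_indicator_Ioc, intervalIntegral_indicator_Ioc, intervalIntegral_indicator_Ioc]
  simp only [intervalIntegral.integral_const, Complex.real_smul, mul_one]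

lemma coeffL2_rampExtension_sub (hac : a ≤ c) {G : ℝ → ℂ} (hG : IntegrableOn G (Ioc a c)) {k : ℤ}
    (hv : ∀ s ∈ Icc a c, ∀ t ∈ Icc a c, coeffL2 k (v t - v s) = ∫ τ in s..t, G τ) (s t : ℝ) :
    coeffL2 k (rampExtension a c v t) - coeffL2 k (rampExtension a c v s) =
      ∫ τ in s..t, rampForcing a c (coeffL2 k (v a)) (coeffL2 k (v c)) G τ := by
  rw [integral_rampForcing hG, ← hv _ (clampTo_mem hac s) _ (clampTo_mem hac t)]
  unfold rampExtension
  simp only [map_add, map_smul, map_sub, smul_eq_mul]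
  push_cast
  ring

end

lemma fourier_add_apply {f g : ℝ → ℂ} (hf : Integrable f) (hg : Integrable g) (r : ℝ) :
    𝓕 (fun t => f t + g t) r = 𝓕 f r + 𝓕 g r := by
  simp_rw [Real.fourier_real_eq_integral_exp_smul, smul_add]
  refine integral_add ?_ ?_
  · refine hf.bdd_mul (c := 1) (by fun_prop) (Eventually.of_forall fun t => ?_)
    rw [Complex.norm_exp_ofReal_mul_I]
  · refine hg.bdd_mul (c := 1) (by fun_prop) (Eventually.of_forall fun t => ?_)
    rw [Complex.norm_exp_ofReal_mul_I]

lemma fourier_const_mul_apply (z : ℂ) (f : ℝ → ℂ) (r : ℝ) :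
    𝓕 (fun t => z * f t) r = z * 𝓕 f r := by
  simp_rw [Real.fourier_real_eq_integral_exp_smul, smul_eq_mul]
  rw [← integral_const_mul]
  exact integral_congr_ae (Eventually.of_forall fun t => mul_left_comm _ _ _)

lemma integrable_rampForcing {a c : ℝ} {G : ℝ → ℂ} (hG : IntegrableOn G (Ioc a c)) (z w : ℂ) :
    Integrable (rampForcing a c z w G) := by
  have h : ∀ p q : ℝ, Integrable ((Ioc p q).indicator fun _ => (1 : ℂ)) := fun p q =>
    memLp_one_iff_integrable.1 (memLp_indicator_const 1 measurableSet_Ioc _ (Or.inr (by simp)))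
  exact (((h _ _).const_mul _).add ((integrable_indicator_iff measurableSet_Ioc).2 hG)).add
    ((h _ _).const_mul _)

/-- The ramps contribute indicators of intervals of unit length, whose norms are at most `1` by
Plancherel because the exponent is not positive. Only the middle term is left to the dual Strichartz
estimate. -/
lemma weightedSq_fourier_rampForcing_le {s : ℝ} (hs : s ≤ 0) {a c : ℝ} {G : ℝ → ℂ}
    (hG : IntegrableOn G (Ioc a c)) (z w : ℂ) :
    weightedSq s (𝓕 (rampForcing a c z w G)) ≤
      3 * (‖z‖ₑ ^ 2 + weightedSq s (𝓕 ((Ioc a c).indicator G)) + ‖w‖ₑ ^ 2) := by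
  have h : ∀ p q : ℝ, Integrable ((Ioc p q).indicator fun _ => (1 : ℂ)) := fun p q =>
    memLp_one_iff_integrable.1 (memLp_indicator_const 1 measurableSet_Ioc _ (Or.inr (by simp)))
  have hG' : Integrable ((Ioc a c).indicator G) := (integrable_indicator_iff measurableSet_Ioc).2 hG
  have e : 𝓕 (rampForcing a c z w G) = fun r =>
      z * 𝓕 ((Ioc (a - 1) a).indicator fun _ => (1 : ℂ)) r + 𝓕 ((Ioc a c).indicator G) r +
        (-w) * 𝓕 ((Ioc c (c + 1)).indicator fun _ => (1 : ℂ)) r := by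
    ext r
    unfold rampForcing
    have h1 : Integrable fun t => z * (Ioc (a - 1) a).indicator (fun _ => 1) t +
        (Ioc a c).indicator G t := ((h _ _).const_mul z).add hG'
    rw [fourier_add_apply h1 ((h _ _).const_mul _),
      fourier_add_apply ((h _ _).const_mul _) hG', fourier_const_mul_apply, fourier_const_mul_apply]
  have hm : ∀ f : ℝ → ℂ, Integrable f → Measurable (𝓕 f) := fun f hf =>
    (continuous_fourier_of_integrable hf).measurable
  rw [e]
  refine (weightedSq_add_le s ((hm _ (h _ _)).const_mul _) (hm _ hG')).trans ?_
  rw [weightedSq_const_mul, weightedSq_const_mul, enorm_neg]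
  have h1 := weightedSq_fourier_indicator_le hs (a - 1)
  rw [sub_add_cancel] at h1
  have h2 := weightedSq_fourier_indicator_le hs c
  refine mul_le_mul_right (add_le_add (add_le_add ?_ le_rfl) ?_) _
  · exact (mul_le_mul_right h1 _).trans_eq (mul_one _)
  · exact (mul_le_mul_right h2 _).trans_eq (mul_one _)

lemma memLp_of_continuous_of_support {E : Type*} [NormedAddCommGroup E] {f : ℝ → E} {A B : ℝ}
    (hf : Continuous f) (h0 : ∀ t, t ∉ Ioo A B → f t = 0) (p : ℝ≥0∞) : MemLp f p volume :=
  hf.memLp_of_hasCompactSupport (HasCompactSupport.intro (K := Icc A B) isCompact_Icc fun t ht =>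
    h0 t fun h => ht (Ioo_subset_Icc_self h))

/-- The extension of a solution of the linear equation to a global function of time, with the
`X^{0,b}` bound. -/
lemma exists_extension_estimate {b : ℝ} (hb : 1 / 2 < b) (hb' : b < 5 / 8) (L : ℝ) (hL : 0 < L) :
    ∃ C : ℝ≥0∞, C ≠ ∞ ∧ ∀ (a c : ℝ), a ≤ c → c - a ≤ L → ∀ (F : ℝ → DualL4T),
      MemLp F (4 / 3) (volume.restrict (Icc a c)) → ∀ (u : ℝ → L2T), IsDuhamel (Icc a c) F u →
      ∀ s ∈ Icc a c, ∃ w : ℝ → L2T, Continuous w ∧ (∀ t, t ∉ Ioo (a - 1) (c + 1) → w t = 0) ∧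
        (∀ t ∈ Icc a c, w t = freeFlow (-t) (u t)) ∧
        ∑' k, weightedSq b (𝓕 fun t => coeffL2 k (w t)) ≤
          C * (‖u s‖ₑ + eLpNorm F (4 / 3) (volume.restrict (Icc a c))) ^ 2 := by
  obtain ⟨K, hK, hsup⟩ := exists_enorm_le_of_isDuhamel L hL
  -- Here `b < 5/8` enters, as `1 - b > 3/8`.
  obtain ⟨D, hD, hdual⟩ := exists_dual_strichartz (β := 1 - b) (by linarith)
  set P := ENNReal.ofReal (2 * π)
  refine ⟨P * (16 * K ^ 2 * ENNReal.ofReal (L + 2)) + 3 * (P * K ^ 2 + D + P * K ^ 2),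
    by finiteness, fun a c hac hL' F hF u hu s hs => ?_⟩
  set M := ‖u s‖ₑ + eLpNorm F (4 / 3) (volume.restrict (Icc a c))
  set v : ℝ → L2T := fun t => freeFlow (-t) (u t)
  have hvcont : ContinuousOn v (Icc a c) := hu.continuousOn_freeFlow_neg hF
  have hN : ∀ t ∈ Icc a c, ‖v t‖ₑ ≤ K * M := fun t ht => by
    rw [enorm_freeFlow]
    exact hsup a c hL' F hF u hu s hs t ht
  -- With linear ramps in place of a multiplicative cutoff, the derivative of each coefficient is
  -- the forcing on `(a, c]` plus constants on the ramps. No multiplier estimate in `H^b` is needed,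
  -- and the sharp cutoff falls only on the forcing, where the dual estimate allows it.
  set w := rampExtension a c v
  have hw : Continuous w := continuous_rampExtension hac hvcont
  have hw0 : ∀ t, t ∉ Ioo (a - 1) (c + 1) → w t = 0 := fun t ht => rampExtension_of_notMem hac ht
  refine ⟨w, hw, hw0, fun t ht => rampExtension_of_mem ht, ?_⟩
  have hFioc : MemLp F (4 / 3) (volume.restrict (Ioc a c)) :=
    hF.mono_measure (Measure.restrict_mono Ioc_subset_Icc_self le_rfl)
  have : IsFiniteMeasure (volume.restrict (Ioc a c)) := isFiniteMeasure_restrict.2 (by simp)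
  have hG : ∀ k, IntegrableOn (forcingCoeff F k) (Ioc a c) := fun k =>
    integrable_forcingCoeff hFioc k
  set V : ℤ → ℝ → ℂ := fun k t => coeffL2 k (w t)
  set H : ℤ → ℝ → ℂ := fun k => rampForcing a c (coeffL2 k (v a)) (coeffL2 k (v c)) (forcingCoeff F k)
  have hVc : ∀ k, Continuous (V k) := fun k => (coeffL2 k).continuous.comp hw
  have hV0 : ∀ k t, t ∉ Ioo (a - 1) (c + 1) → V k t = 0 := fun k t ht => by
    simp only [V, hw0 t ht, map_zero]
  have hk : ∀ k, weightedSq b (𝓕 (V k)) ≤ (∫⁻ t, ‖V k t‖ₑ ^ 2) +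
      3 * (‖coeffL2 k (v a)‖ₑ ^ 2 +
        weightedSq (-(1 - b)) (𝓕 ((Ioc a c).indicator (forcingCoeff F k))) +
        ‖coeffL2 k (v c)‖ₑ ^ 2) := by
    intro k
    refine (weightedSq_le_of_primitive (by linarith) (by linarith : a - 1 ≤ c + 1)
      (H := H k) (fun s t => (integrable_rampForcing (hG k) _ _).intervalIntegrable)
      (fun s t => ?_) (hV0 k) (fun t ht => ?_)
      (memLp_one_iff_integrable.1 (memLp_of_continuous_of_support (hVc k) (hV0 k) 1))
      (memLp_of_continuous_of_support (hVc k) (hV0 k) 2)).trans ?_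
    · exact coeffL2_rampExtension_sub hac (hG k) (fun s hs t ht => hu s hs t ht k) s t
    · simp only [H, rampForcing]
      have h1 : t ∉ Ioc (a - 1) a := fun h => ht ⟨h.1, by linarith [h.2]⟩
      have h2 : t ∉ Ioc a c := fun h => ht ⟨by linarith [h.1], by linarith [h.2]⟩
      have h3 : t ∉ Ioc c (c + 1) := fun h => ht ⟨by linarith [h.1], h.2⟩
      rw [indicator_of_notMem h1, indicator_of_notMem h2, indicator_of_notMem h3]
      simp
    · refine add_le_add le_rfl ?_
      have e : b - 1 = -(1 - b) := by ring
      rw [e]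
      exact weightedSq_fourier_rampForcing_le (by linarith) (hG k) _ _
  have h1 : ∑' k, ∫⁻ t, ‖V k t‖ₑ ^ 2 ≤ P * (16 * K ^ 2 * ENNReal.ofReal (L + 2)) * M ^ 2 := by
    rw [← lintegral_tsum fun k => ((hVc k).measurable.enorm.pow_const 2).aemeasurable]
    have e : ∀ t, ∑' k, ‖V k t‖ₑ ^ 2 = P * ‖w t‖ₑ ^ 2 := fun t => tsum_enorm_sq_coeffL2 _
    simp_rw [e]
    rw [lintegral_const_mul' _ _ ENNReal.ofReal_ne_top]
    rw [mul_assoc]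
    refine mul_le_mul_right ?_ _
    calc ∫⁻ t, ‖w t‖ₑ ^ 2 ≤ ∫⁻ t, (Ioo (a - 1) (c + 1)).indicator (fun _ => (4 * (K * M)) ^ 2) t := by
          refine lintegral_mono fun t => ?_
          by_cases ht : t ∈ Ioo (a - 1) (c + 1)
          · rw [indicator_of_mem ht]
            exact pow_le_pow_left₀ zero_le (enorm_rampExtension_le hac hN t) 2
          · rw [indicator_of_notMem ht, hw0 t ht]; simp
      _ = (4 * (K * M)) ^ 2 * ENNReal.ofReal (c + 1 - (a - 1)) := by
          rw [lintegral_indicator measurableSet_Ioo, setLIntegral_const, Real.volume_Ioo]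
      _ ≤ (4 * (K * M)) ^ 2 * ENNReal.ofReal (L + 2) :=
          mul_le_mul_right (ENNReal.ofReal_le_ofReal (by linarith)) _
      _ = _ := by ring
  have h2 : ∑' k, weightedSq (-(1 - b)) (𝓕 ((Ioc a c).indicator (forcingCoeff F k))) ≤
      D * M ^ 2 := by
    rw [ENNReal.tsum_eq_iSup_sum]
    refine iSup_le fun S => (hdual _ measurableSet_Ioc (by simp) F hFioc S).trans ?_
    refine mul_le_mul_right (pow_le_pow_left₀ zero_le ?_ 2) _
    exact (eLpNorm_mono_measure _ (Measure.restrict_mono Ioc_subset_Icc_self le_rfl)).trans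
      le_add_self
  have h3 : ∀ t ∈ Icc a c, ∑' k, ‖coeffL2 k (v t)‖ₑ ^ 2 ≤ P * K ^ 2 * M ^ 2 := by
    intro t ht
    rw [tsum_enorm_sq_coeffL2, mul_assoc, ← mul_pow]
    exact mul_le_mul_right (pow_le_pow_left₀ zero_le (hN t ht) 2) _
  calc _ ≤ ∑' k, ((∫⁻ t, ‖V k t‖ₑ ^ 2) +
      3 * (‖coeffL2 k (v a)‖ₑ ^ 2 +
        weightedSq (-(1 - b)) (𝓕 ((Ioc a c).indicator (forcingCoeff F k))) +
        ‖coeffL2 k (v c)‖ₑ ^ 2)) := ENNReal.tsum_le_tsum hk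
    _ = (∑' k, ∫⁻ t, ‖V k t‖ₑ ^ 2) + 3 * ((∑' k, ‖coeffL2 k (v a)‖ₑ ^ 2) +
        (∑' k, weightedSq (-(1 - b)) (𝓕 ((Ioc a c).indicator (forcingCoeff F k)))) +
        ∑' k, ‖coeffL2 k (v c)‖ₑ ^ 2) := by
        rw [ENNReal.tsum_add, ENNReal.tsum_mul_left, ENNReal.tsum_add, ENNReal.tsum_add]
    _ ≤ P * (16 * K ^ 2 * ENNReal.ofReal (L + 2)) * M ^ 2 +
        3 * (P * K ^ 2 * M ^ 2 + D * M ^ 2 + P * K ^ 2 * M ^ 2) :=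
        add_le_add h1 (mul_le_mul_right (add_le_add (add_le_add
          (h3 a (left_mem_Icc.2 hac)) h2) (h3 c (right_mem_Icc.2 hac))) _)
    _ = _ := by ring

/-- The linear estimate for the Schrödinger equation with forcing in `L^{4/3}`. -/
theorem exists_linear_estimate {b : ℝ} (hb : 1 / 2 < b) (hb' : b < 5 / 8) (L : ℝ) (hL : 0 < L) :
    ∃ C : ℝ≥0∞, C ≠ ∞ ∧ ∀ (a c : ℝ), a ≤ c → c - a ≤ L → ∀ (F : ℝ → DualL4T),
      MemLp F (4 / 3) (volume.restrict (Icc a c)) → ∀ (u : ℝ → L2T), IsDuhamel (Icc a c) F u →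
      ∀ s ∈ Icc a c, ∃ f : ℝ → L4T, MemLp f 4 (volume.restrict (Icc a c)) ∧
        (∀ᵐ t ∂(volume.restrict (Icc a c)), inclL4 (f t) = u t) ∧
        eLpNorm f 4 (volume.restrict (Icc a c)) ≤
          C * (‖u s‖ₑ + eLpNorm F (4 / 3) (volume.restrict (Icc a c))) ∧
        restrictedNorm b (Icc a c) u ≤
          C * (‖u s‖ₑ + eLpNorm F (4 / 3) (volume.restrict (Icc a c))) ∧
        Tendsto (fun n => eLpNorm (fun t => f t - partialSum n fun k => coeffL2 k (u t)) 4
          (volume.restrict (Icc a c))) atTop (𝓝 0) := by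
  obtain ⟨C, hC, hext⟩ := exists_extension_estimate hb hb' L hL
  obtain ⟨D, hD, hS⟩ := exists_L4_of_weightedSq (β := b) (by linarith)
  set P := ENNReal.ofReal (2 * π)
  refine ⟨D * C ^ (1 / 2 : ℝ) + (P * C) ^ (1 / 2 : ℝ), by finiteness,
    fun a c hac hL' F hF u hu s hs => ?_⟩
  obtain ⟨w, hw, hw0, hwu, hest⟩ := hext a c hac hL' F hF u hu s hs
  set M := ‖u s‖ₑ + eLpNorm F (4 / 3) (volume.restrict (Icc a c))
  have hM : M ≠ ∞ := by
    have := hF.2.ne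
    finiteness
  set V : ℤ → ℝ → ℂ := fun k t => coeffL2 k (w t)
  have hVc : ∀ k, Continuous (V k) := fun k => (coeffL2 k).continuous.comp hw
  have hV0 : ∀ k t, t ∉ Ioo (a - 1) (c + 1) → V k t = 0 := fun k t ht => by
    simp only [V, hw0 t ht, map_zero]
  have hVi : ∀ k, Integrable (V k) := fun k =>
    memLp_one_iff_integrable.1 (memLp_of_continuous_of_support (hVc k) (hV0 k) 1)
  have hfin : ∑' k, weightedSq b (𝓕 (V k)) ≠ ∞ := ne_top_of_le_ne_top (by finiteness) hest
  have hm : ∀ k, Measurable (𝓕 (V k)) := fun k => (continuous_fourier_of_integrable (hVi k)).measurable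
  have hi : ∀ k, Integrable (𝓕 (V k)) := fun k =>
    integrable_of_weightedSq_ne_top hb (hm k) (ENNReal.ne_top_of_tsum_ne_top hfin k)
  -- Since `b > 1/2` the transforms are integrable, so Fourier inversion holds at every time.
  have hinv : ∀ k, 𝓕⁻ (𝓕 (V k)) = V k := fun k =>
    (hVc k).fourierInv_fourier_eq (hVi k) (hi k)
  obtain ⟨f, hf, hfn, hft, hfc⟩ := hS (fun k => 𝓕 (V k)) hm hi hfin
  simp only [hinv] at hft hfc
  have hVu : ∀ t ∈ Icc a c, ∀ k, schrodingerPhase k t * V k t = coeffL2 k (u t) := by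
    intro t ht k
    simp only [V, hwu t ht]
    rw [← coeffL2_freeFlow, freeFlow_freeFlow_neg]
  have hsqrt : (C * M ^ 2) ^ (1 / 2 : ℝ) = C ^ (1 / 2 : ℝ) * M := by
    rw [ENNReal.mul_rpow_of_nonneg _ _ one_half_pos.le, ENNReal_sq_sqrt]
  refine ⟨f, hf.mono_measure Measure.restrict_le_self, ?_, ?_, ?_, ?_⟩
  · filter_upwards [ae_restrict_of_ae hfc, ae_restrict_mem measurableSet_Icc] with t h1 h2
    exact ext_coeffL2 fun k => (h1 k).trans (hVu t h2 k)
  · calc _ ≤ eLpNorm f 4 volume := eLpNorm_mono_measure _ Measure.restrict_le_self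
      _ ≤ D * (C * M ^ 2) ^ (1 / 2 : ℝ) :=
          hfn.trans (mul_le_mul_right (ENNReal.rpow_le_rpow hest one_half_pos.le) _)
      _ = D * C ^ (1 / 2 : ℝ) * M := by rw [hsqrt, mul_assoc]
      _ ≤ _ := mul_le_mul_left le_self_add _
  -- The competitor in the infimum defining `restrictedNorm` is `e^{it∂ₓ²} w(t)`, which equals `u`
  -- on `[a, c]`.
  · have hUc : Continuous fun t => freeFlow t (w t) :=
      continuousOn_univ.1 (continuousOn_freeFlow continuous_id hw.continuousOn)
    have hU : MemLp (fun t => freeFlow t (w t)) 2 volume :=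
      memLp_of_continuous_of_support (A := a - 1) (B := c + 1) hUc
        (fun t ht => by rw [hw0 t ht, map_zero]) 2
    have h1 : bourgainNorm b (hU.toLp _) = (P * ∑' k, weightedSq b (𝓕 (V k))) ^ (1 / 2 : ℝ) := by
      refine bourgainNorm_eq_of_coeffL2 _ V (fun k => ?_) hVi
      filter_upwards [hU.coeFn_toLp] with t ht
      rw [ht, coeffL2_freeFlow]
    calc restrictedNorm b (Icc a c) u ≤ bourgainNorm b (hU.toLp _) := by
          refine iInf₂_le _ ?_
          filter_upwards [ae_restrict_of_ae hU.coeFn_toLp, ae_restrict_mem measurableSet_Icc]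
            with t h2 h3
          rw [h2, hwu t h3, freeFlow_freeFlow_neg]
      _ ≤ (P * (C * M ^ 2)) ^ (1 / 2 : ℝ) := by
          rw [h1]
          exact ENNReal.rpow_le_rpow (mul_le_mul_right hest _) one_half_pos.le
      _ = (P * C) ^ (1 / 2 : ℝ) * M := by
          rw [← mul_assoc, ENNReal.mul_rpow_of_nonneg _ _ one_half_pos.le, ENNReal_sq_sqrt]
      _ ≤ _ := mul_le_mul_left le_add_self _
  · refine tendsto_of_tendsto_of_tendsto_of_le_of_le tendsto_const_nhds hft
      (fun _ => zero_le) fun n => ?_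
    refine le_trans (le_of_eq (eLpNorm_congr_ae ?_))
      (eLpNorm_mono_measure _ (Measure.restrict_le_self (s := Icc a c)))
    filter_upwards [ae_restrict_mem measurableSet_Icc] with t ht
    simp only [hVu t ht]

/-! ### The cubic nonlinearity from `L⁴` to `L^{4/3}`. -/

instance instHolderTripleTwoFour : ENNReal.HolderTriple 2 4 (4 / 3) where
  inv_add_inv_eq_inv := by
    have h : (4 / 3 : ℝ≥0∞)⁻¹ ≠ ∞ := by rw [ENNReal.inv_ne_top]; simp
    rw [← ENNReal.toReal_eq_toReal_iff' (by finiteness) h,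
      ENNReal.toReal_add (by finiteness) (by finiteness)]
    norm_num

instance instHolderTripleFourThirdsFour : ENNReal.HolderTriple (4 / 3) 4 1 where
  inv_add_inv_eq_inv := by
    have h : (4 / 3 : ℝ≥0∞)⁻¹ ≠ ∞ := by rw [ENNReal.inv_ne_top]; simp
    rw [← ENNReal.toReal_eq_toReal_iff' (by finiteness) (by finiteness),
      ENNReal.toReal_add h (by finiteness)]
    norm_num

instance instHolderTripleFourFourThirds : ENNReal.HolderTriple 4 (4 / 3) 1 :=
  ENNReal.HolderTriple.symm

lemma eLpNorm_norm_sq_two {α E : Type*} [MeasurableSpace α] [NormedAddCommGroup E] (μ : Measure α)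
    (f : α → E) : eLpNorm (fun x => ‖f x‖ ^ 2) 2 μ = eLpNorm f 4 μ ^ 2 := by
  have h := eLpNorm_norm_rpow (p := 2) (q := 2) (μ := μ) f (by norm_num)
  have e : (2 : ℝ≥0∞) * ENNReal.ofReal 2 = 4 := by rw [ENNReal.ofReal_ofNat]; norm_num
  rw [e] at h
  simpa using h

/-- Hölder's inequality for cubic expressions. -/
lemma eLpNorm_cubic_le {α E E' : Type*} [MeasurableSpace α] [NormedAddCommGroup E]
    [NormedAddCommGroup E'] {μ : Measure α} {f g : α → E} {h : α → E'}
    (hf : AEStronglyMeasurable f μ) (hg : AEStronglyMeasurable g μ)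
    (hh : AEStronglyMeasurable h μ) :
    eLpNorm (fun x => (1 + ‖f x‖ ^ 2 + ‖g x‖ ^ 2) * ‖h x‖) (4 / 3) μ ≤
      (μ univ ^ (1 / 2 : ℝ) + eLpNorm f 4 μ ^ 2 + eLpNorm g 4 μ ^ 2) * eLpNorm h 4 μ := by
  have hf2 : AEStronglyMeasurable (fun x => ‖f x‖ ^ 2) μ := hf.norm.pow 2
  have hg2 : AEStronglyMeasurable (fun x => ‖g x‖ ^ 2) μ := hg.norm.pow 2
  have h1 : AEStronglyMeasurable (fun _ : α => (1 : ℝ)) μ := aestronglyMeasurable_const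
  have h2 : eLpNorm (fun _ : α => (1 : ℝ)) 2 μ ≤ μ univ ^ (1 / 2 : ℝ) := by
    by_cases hμ : μ = 0
    · simp [hμ]
    · rw [eLpNorm_const _ (by norm_num) hμ]; simp
  set a : α → ℝ := fun _ => 1
  set p : α → ℝ := fun x => ‖f x‖ ^ 2
  set q : α → ℝ := fun x => ‖g x‖ ^ 2
  have h3 : eLpNorm (a + p + q) 2 μ ≤ eLpNorm a 2 μ + eLpNorm p 2 μ + eLpNorm q 2 μ :=
    (eLpNorm_add_le (h1.add hf2) hg2 one_le_two).trans
      (add_le_add (eLpNorm_add_le h1 hf2 one_le_two) le_rfl)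
  have key := eLpNorm_le_eLpNorm_mul_eLpNorm_of_nnnorm (p := 2) (q := 4) (r := 4 / 3)
    ((h1.add hf2).add hg2) hh.norm
    (fun x y => x * y) 1 (Eventually.of_forall fun x => by rw [nnnorm_mul, one_mul])
  rw [eLpNorm_norm, ENNReal.coe_one, one_mul] at key
  have hp : eLpNorm p 2 μ = eLpNorm f 4 μ ^ 2 := eLpNorm_norm_sq_two μ f
  have hq : eLpNorm q 2 μ = eLpNorm g 4 μ ^ 2 := eLpNorm_norm_sq_two μ g
  rw [hp, hq] at h3
  exact key.trans (mul_le_mul_left (h3.trans (add_le_add (add_le_add h2 le_rfl) le_rfl)) _)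

/-- The nonlinearity `ξ z - (σ + i) |z|² z`. -/
def cubicTerm (ξ σ : ℝ) (z : ℂ) : ℂ :=
  (ξ : ℂ) * z - ((σ : ℂ) + Complex.I) * (((‖z‖ ^ 2 : ℝ) : ℂ) * z)

@[fun_prop]
lemma continuous_cubicTerm (ξ σ : ℝ) : Continuous (cubicTerm ξ σ) := by
  unfold cubicTerm; fun_prop

lemma cubicTerm_zero (ξ σ : ℝ) : cubicTerm ξ σ 0 = 0 := by simp [cubicTerm]

lemma norm_sq_mul_sub_le (z w : ℂ) :
    ‖((‖z‖ ^ 2 : ℝ) : ℂ) * z - ((‖w‖ ^ 2 : ℝ) : ℂ) * w‖ ≤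
      2 * ((‖z‖ ^ 2 + ‖w‖ ^ 2) * ‖z - w‖) := by
  have e : ((‖z‖ ^ 2 : ℝ) : ℂ) * z - ((‖w‖ ^ 2 : ℝ) : ℂ) * w =
      ((‖z‖ ^ 2 : ℝ) : ℂ) * (z - w) + ((‖z‖ ^ 2 - ‖w‖ ^ 2 : ℝ) : ℂ) * w := by push_cast; ring
  rw [e]
  refine (norm_add_le _ _).trans ?_
  rw [norm_mul, norm_mul, Complex.norm_real, Complex.norm_real, Real.norm_eq_abs, Real.norm_eq_abs,
    abs_of_nonneg (by positivity), sq_sub_sq, abs_mul, abs_of_nonneg (by positivity : 0 ≤ ‖z‖ + ‖w‖)]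
  have h1 := abs_norm_sub_norm_le z w
  have h2 : (‖z‖ + ‖w‖) * |‖z‖ - ‖w‖| * ‖w‖ ≤ (‖z‖ + ‖w‖) * ‖z - w‖ * ‖w‖ := by gcongr
  nlinarith [mul_nonneg (norm_nonneg (z - w)) (sq_nonneg (‖z‖ - ‖w‖)), norm_nonneg z, norm_nonneg w,
    mul_nonneg (norm_nonneg (z - w)) (sq_nonneg (‖z‖))]

lemma norm_cubicTerm_sub_le (ξ σ : ℝ) (z w : ℂ) :
    ‖cubicTerm ξ σ z - cubicTerm ξ σ w‖ ≤
      (|ξ| + 2 * (|σ| + 1)) * ((1 + ‖z‖ ^ 2 + ‖w‖ ^ 2) * ‖z - w‖) := by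
  have e : cubicTerm ξ σ z - cubicTerm ξ σ w = (ξ : ℂ) * (z - w) -
      ((σ : ℂ) + Complex.I) * (((‖z‖ ^ 2 : ℝ) : ℂ) * z - ((‖w‖ ^ 2 : ℝ) : ℂ) * w) := by
    unfold cubicTerm; ring
  rw [e]
  refine (norm_sub_le _ _).trans ?_
  rw [norm_mul, norm_mul, Complex.norm_real, Real.norm_eq_abs]
  have h1 : ‖(σ : ℂ) + Complex.I‖ ≤ |σ| + 1 := by
    refine (norm_add_le _ _).trans ?_
    rw [Complex.norm_real, Complex.norm_I, Real.norm_eq_abs]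
  have h2 := mul_le_mul h1 (norm_sq_mul_sub_le z w) (norm_nonneg _) (by positivity)
  have h3 : 0 ≤ |ξ| * ((‖z‖ ^ 2 + ‖w‖ ^ 2) * ‖z - w‖) := by positivity
  have h4 : 0 ≤ (|σ| + 1) * ‖z - w‖ := by positivity
  nlinarith

lemma memLp_conj (φ : L4T) : MemLp (fun x => starRingEnd ℂ (φ x)) 4 (volume : Measure Torus) :=
  (Lp.memLp φ).star

lemma memLp_conj_mul {g : Torus → ℂ} (hg : MemLp g (4 / 3) volume) (φ : L4T) :
    MemLp (fun x => starRingEnd ℂ (φ x) * g x) 1 volume :=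
  MemLp.mul' (p := 4) (q := 4 / 3) hg (memLp_conj φ)

lemma integrable_dualPairing {g : Torus → ℂ} (hg : MemLp g (4 / 3) volume) (φ : L4T) :
    Integrable (fun x => starRingEnd ℂ (φ x) * g x) :=
  memLp_one_iff_integrable.1 (memLp_conj_mul hg φ)

lemma enorm_dualPairing_le {g : Torus → ℂ} (hg : MemLp g (4 / 3) volume) (φ : L4T) :
    ‖∫ x, starRingEnd ℂ (φ x) * g x‖ₑ ≤ eLpNorm g (4 / 3) volume * ‖φ‖ₑ := by
  refine (enorm_integral_le_lintegral_enorm _).trans ?_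
  rw [← eLpNorm_one_eq_lintegral_enorm]
  have h := eLpNorm_le_eLpNorm_mul_eLpNorm_of_nnnorm (p := 4) (q := 4 / 3) (r := 1)
    (memLp_conj φ).1 hg.1 (fun x y => x * y) 1
    (Eventually.of_forall fun x => by rw [nnnorm_mul, one_mul])
  refine h.trans_eq ?_
  rw [ENNReal.coe_one, one_mul, mul_comm, Lp.enorm_def]
  congr 1
  exact eLpNorm_congr_norm_ae (Eventually.of_forall fun x => RCLike.norm_conj _)

/-- The functional `φ ↦ ∫ g φ̄` on `L⁴(𝕋)` defined by `g ∈ L^{4/3}(𝕋)`. -/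
def dualPairing (g : Torus → ℂ) (hg : MemLp g (4 / 3) volume) : DualL4T :=
  LinearMap.mkContinuous
    { toFun := fun φ => ∫ x, starRingEnd ℂ (φ x) * g x
      map_add' := fun φ ψ => by
        rw [← integral_add (integrable_dualPairing hg φ) (integrable_dualPairing hg ψ)]
        refine integral_congr_ae ?_
        filter_upwards [Lp.coeFn_add φ ψ] with x hx
        rw [hx, Pi.add_apply, map_add, add_mul]
      map_smul' := fun z φ => by
        rw [smul_eq_mul, ← integral_const_mul]
        refine integral_congr_ae ?_
        filter_upwards [Lp.coeFn_smul z φ] with x hx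
        rw [hx, Pi.smul_apply, smul_eq_mul, map_mul, mul_assoc] }
    (eLpNorm g (4 / 3) volume).toReal fun φ => by
      simp only [LinearMap.coe_mk, AddHom.coe_mk]
      rw [← toReal_enorm, ← toReal_enorm, ← ENNReal.toReal_mul]
      exact ENNReal.toReal_mono (ENNReal.mul_ne_top hg.2.ne enorm_ne_top) (enorm_dualPairing_le hg φ)

lemma dualPairing_apply (g : Torus → ℂ) (hg : MemLp g (4 / 3) volume) (φ : L4T) :
    dualPairing g hg φ = ∫ x, starRingEnd ℂ (φ x) * g x := rfl

lemma norm_dualPairing_le (g : Torus → ℂ) (hg : MemLp g (4 / 3) volume) :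
    ‖dualPairing g hg‖ ≤ (eLpNorm g (4 / 3) volume).toReal :=
  LinearMap.mkContinuous_norm_le _ ENNReal.toReal_nonneg _

lemma dualPairing_sub {g h : Torus → ℂ} (hg : MemLp g (4 / 3) volume)
    (hh : MemLp h (4 / 3) volume) :
    dualPairing g hg - dualPairing h hh = dualPairing (g - h) (hg.sub hh) := by
  ext φ
  rw [sub_apply, dualPairing_apply, dualPairing_apply, dualPairing_apply,
    ← integral_sub (integrable_dualPairing hg φ) (integrable_dualPairing hh φ)]
  simp only [Pi.sub_apply, mul_sub]

lemma eLpNorm_cubicTerm_sub_le (ξ σ : ℝ) (f g : L4T) :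
    eLpNorm (fun x => cubicTerm ξ σ (f x) - cubicTerm ξ σ (g x)) (4 / 3) volume ≤
      ENNReal.ofReal (|ξ| + 2 * (|σ| + 1)) *
        (((volume : Measure Torus) univ ^ (1 / 2 : ℝ) + ‖f‖ₑ ^ 2 + ‖g‖ₑ ^ 2) * ‖f - g‖ₑ) := by
  have hf := Lp.aestronglyMeasurable f
  have hg := Lp.aestronglyMeasurable g
  calc _ ≤ ENNReal.ofReal (|ξ| + 2 * (|σ| + 1)) *
        eLpNorm (fun x => (1 + ‖f x‖ ^ 2 + ‖g x‖ ^ 2) * ‖f x - g x‖) (4 / 3) volume := by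
        refine eLpNorm_le_mul_eLpNorm_of_ae_le_mul (Eventually.of_forall fun x => ?_) _
        refine (norm_cubicTerm_sub_le ξ σ (f x) (g x)).trans_eq ?_
        rw [Real.norm_of_nonneg (by positivity)]
    _ ≤ _ := by
        refine mul_le_mul_right ((eLpNorm_cubic_le hf hg (hf.sub hg)).trans_eq ?_) _
        rw [Lp.enorm_def, Lp.enorm_def, Lp.enorm_def]
        congr 1
        exact eLpNorm_congr_ae (Lp.coeFn_sub f g).symm

lemma memLp_cubicTerm (ξ σ : ℝ) (f : L4T) :
    MemLp (fun x => cubicTerm ξ σ (f x)) (4 / 3) (volume : Measure Torus) := by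
  refine ⟨(continuous_cubicTerm ξ σ).comp_aestronglyMeasurable (Lp.aestronglyMeasurable f), ?_⟩
  have h := eLpNorm_cubicTerm_sub_le ξ σ f 0
  have e : eLpNorm (fun x => cubicTerm ξ σ (f x)) (4 / 3) (volume : Measure Torus) =
      eLpNorm (fun x => cubicTerm ξ σ (f x) - cubicTerm ξ σ ((0 : L4T) x)) (4 / 3) volume := by
    refine eLpNorm_congr_ae ?_
    filter_upwards [Lp.coeFn_zero ℂ 4 (volume : Measure Torus)] with x hx
    rw [hx, Pi.zero_apply, cubicTerm_zero, sub_zero]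
  rw [e]
  refine h.trans_lt ?_
  rw [sub_zero, enorm_zero]
  finiteness

/-- The nonlinearity as a map from `L⁴(𝕋)` to its dual. -/
def nonlinearity (ξ σ : ℝ) (f : L4T) : DualL4T :=
  dualPairing (fun x => cubicTerm ξ σ (f x)) (memLp_cubicTerm ξ σ f)

/-- Hölder in space. Once `|𝕋|^{1/2}` is absorbed in the constant, the factor `1 + ‖f‖² + ‖g‖²` has
the form to which `eLpNorm_cubic_le` applies again, now in time. -/
lemma exists_enorm_nonlinearity_sub_le (ξ σ : ℝ) :
    ∃ A : ℝ≥0∞, A ≠ ∞ ∧ ∀ f g : L4T, ‖nonlinearity ξ σ f - nonlinearity ξ σ g‖ₑ ≤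
      A * ((1 + ‖f‖ₑ ^ 2 + ‖g‖ₑ ^ 2) * ‖f - g‖ₑ) := by
  refine ⟨ENNReal.ofReal (|ξ| + 2 * (|σ| + 1)) *
    (1 + (volume : Measure Torus) univ ^ (1 / 2 : ℝ)), by finiteness, fun f g => ?_⟩
  set m := (volume : Measure Torus) univ ^ (1 / 2 : ℝ)
  rw [nonlinearity, nonlinearity, dualPairing_sub]
  have hmem := (memLp_cubicTerm ξ σ f).sub (memLp_cubicTerm ξ σ g)
  have h1 := norm_dualPairing_le _ hmem
  have h2 := eLpNorm_cubicTerm_sub_le ξ σ f g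
  calc _ ≤ eLpNorm (fun x => cubicTerm ξ σ (f x) - cubicTerm ξ σ (g x)) (4 / 3) volume := by
        rw [← ofReal_norm]
        exact ENNReal.ofReal_le_of_le_toReal h1
    _ ≤ ENNReal.ofReal (|ξ| + 2 * (|σ| + 1)) * ((m + ‖f‖ₑ ^ 2 + ‖g‖ₑ ^ 2) * ‖f - g‖ₑ) := h2
    _ ≤ ENNReal.ofReal (|ξ| + 2 * (|σ| + 1)) *
        ((1 + m) * (1 + ‖f‖ₑ ^ 2 + ‖g‖ₑ ^ 2) * ‖f - g‖ₑ) := by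
        refine mul_le_mul_right (mul_le_mul_left ?_ _) _
        calc m + ‖f‖ₑ ^ 2 + ‖g‖ₑ ^ 2 ≤ (m + ‖f‖ₑ ^ 2 + ‖g‖ₑ ^ 2) + (1 + m * (‖f‖ₑ ^ 2 + ‖g‖ₑ ^ 2)) :=
              le_self_add
          _ = _ := by ring
    _ = _ := by ring

lemma nonlinearity_zero (ξ σ : ℝ) : nonlinearity ξ σ 0 = 0 := by
  ext φ
  rw [nonlinearity, dualPairing_apply, zero_apply]
  refine integral_eq_zero_of_ae ?_
  filter_upwards [Lp.coeFn_zero ℂ 4 (volume : Measure Torus)] with x hx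
  rw [hx, Pi.zero_apply, cubicTerm_zero, mul_zero]

lemma continuous_nonlinearity (ξ σ : ℝ) : Continuous (nonlinearity ξ σ) := by
  obtain ⟨A, hA, h⟩ := exists_enorm_nonlinearity_sub_le ξ σ
  rw [continuous_iff_continuousAt]
  intro g
  rw [ContinuousAt, tendsto_iff_edist_tendsto_0]
  have h1 : Tendsto (fun f : L4T => A * ((1 + ‖f‖ₑ ^ 2 + ‖g‖ₑ ^ 2) * ‖f - g‖ₑ)) (𝓝 g) (𝓝 0) := by
    have h2 : Tendsto (fun f : L4T => 1 + ‖f‖ₑ ^ 2 + ‖g‖ₑ ^ 2) (𝓝 g)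
        (𝓝 (1 + ‖g‖ₑ ^ 2 + ‖g‖ₑ ^ 2)) := by
      have : Continuous fun f : L4T => 1 + ‖f‖ₑ ^ 2 + ‖g‖ₑ ^ 2 := by fun_prop
      exact this.tendsto g
    have h3 : Tendsto (fun f : L4T => ‖f - g‖ₑ) (𝓝 g) (𝓝 0) := by
      have : Continuous fun f : L4T => ‖f - g‖ₑ := by fun_prop
      exact this.tendsto' _ _ (by simp)
    have h4 := ENNReal.Tendsto.mul h2 (Or.inr (by simp)) h3 (Or.inr (by finiteness))
    rw [mul_zero] at h4
    have h5 := ENNReal.Tendsto.const_mul h4 (Or.inr hA)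
    rwa [mul_zero] at h5
  refine tendsto_of_tendsto_of_tendsto_of_le_of_le tendsto_const_nhds h1 (fun _ => zero_le)
    fun f => ?_
  rw [edist_eq_enorm_sub]
  exact h f g

/-- The local Lipschitz bound for the nonlinearity from `L⁴` to `L^{4/3}` in time. -/
lemma exists_eLpNorm_nonlinearity_sub_le (ξ σ : ℝ) :
    ∃ A : ℝ≥0∞, A ≠ ∞ ∧ ∀ (μ : Measure ℝ) (f g : ℝ → L4T), AEStronglyMeasurable f μ →
      AEStronglyMeasurable g μ →
      eLpNorm (fun t => nonlinearity ξ σ (f t) - nonlinearity ξ σ (g t)) (4 / 3) μ ≤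
        A * ((μ univ ^ (1 / 2 : ℝ) + eLpNorm f 4 μ ^ 2 + eLpNorm g 4 μ ^ 2) *
          eLpNorm (fun t => f t - g t) 4 μ) := by
  obtain ⟨A, hA, h⟩ := exists_enorm_nonlinearity_sub_le ξ σ
  refine ⟨A, hA, fun μ f g hf hg => ?_⟩
  lift A to NNReal using hA
  refine le_trans ?_ (mul_le_mul_right (eLpNorm_cubic_le hf hg (hf.sub hg)) _)
  refine eLpNorm_le_mul_eLpNorm_of_ae_le_mul' (Eventually.of_forall fun t => ?_) _
  have h2 : ‖(1 + ‖f t‖ ^ 2 + ‖g t‖ ^ 2) * ‖f t - g t‖‖ₑ =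
      (1 + ‖f t‖ₑ ^ 2 + ‖g t‖ₑ ^ 2) * ‖f t - g t‖ₑ := by
    rw [← ofReal_norm, Real.norm_of_nonneg (by positivity), ENNReal.ofReal_mul (by positivity),
      ENNReal.ofReal_add (by positivity) (by positivity),
      ENNReal.ofReal_add (by positivity) (by positivity), ENNReal.ofReal_pow (by positivity),
      ENNReal.ofReal_pow (by positivity), ofReal_norm, ofReal_norm, ofReal_norm,
      ENNReal.ofReal_one]
  exact (h (f t) (g t)).trans_eq (congrArg _ h2.symm)

lemma memLp_nonlinearity (ξ σ : ℝ) {μ : Measure ℝ} [IsFiniteMeasure μ] {f : ℝ → L4T}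
    (hf : MemLp f 4 μ) : MemLp (fun t => nonlinearity ξ σ (f t)) (4 / 3) μ := by
  refine ⟨(continuous_nonlinearity ξ σ).comp_aestronglyMeasurable hf.1, ?_⟩
  obtain ⟨A, hA, h⟩ := exists_eLpNorm_nonlinearity_sub_le ξ σ
  have h1 := h μ f (fun _ => 0) hf.1 aestronglyMeasurable_const
  simp only [nonlinearity_zero, sub_zero] at h1
  refine h1.trans_lt ?_
  have h2 := hf.2.ne
  have h3 : eLpNorm (fun _ : ℝ => (0 : L4T)) 4 μ = 0 := eLpNorm_zero'
  rw [h3]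
  finiteness

/-- The bridge between the forcing as a functional and the integrand of Duhamel's formula in
`IsSolutionOn`: pairing with a character, conjugated, is a Fourier coefficient. -/
lemma nonlinearity_mode (ξ σ : ℝ) {f : L4T} {u : L2T} (h : inclL4 f = u) (k : ℤ) :
    nonlinearity ξ σ f (mode k) = (ξ : ℂ) * spaceFourier u k -
      ((σ : ℂ) + Complex.I) * spaceFourier (fun x => ((‖u x‖ ^ 2 : ℝ) : ℂ) * u x) k := by
  have hu : (u : Torus → ℂ) =ᵐ[volume] f := h ▸ coeFn_inclL4 f
  have h1 : spaceFourier u k = ∫ x, starRingEnd ℂ (mode k x) * f x := by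
    refine integral_congr_ae ?_
    filter_upwards [hu, coeFn_mode k] with x h1 h2
    rw [h1, h2, fourier_neg]
  have h2 : spaceFourier (fun x => ((‖u x‖ ^ 2 : ℝ) : ℂ) * u x) k =
      ∫ x, starRingEnd ℂ (mode k x) * (((‖f x‖ ^ 2 : ℝ) : ℂ) * f x) := by
    refine integral_congr_ae ?_
    filter_upwards [hu, coeFn_mode k] with x h1 h2
    simp only [h1, h2, fourier_neg]
  have i1 : Integrable (fun x => starRingEnd ℂ (mode k x) * f x) :=
    integrable_dualPairing ((Lp.memLp f).mono_exponent (by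
      rw [ENNReal.div_le_iff_le_mul (by simp) (by simp)]; norm_num)) (mode k)
  have i2 : Integrable (fun x => starRingEnd ℂ (mode k x) * (((‖f x‖ ^ 2 : ℝ) : ℂ) * f x)) := by
    -- For `ξ = σ = 0` the nonlinearity is `-i|f|²f`, so multiplying by `i` isolates the cubic part.
    refine ((integrable_dualPairing (memLp_cubicTerm 0 0 f) (mode k)).const_mul Complex.I).congr
      (Eventually.of_forall fun x => ?_)
    simp only [cubicTerm]
    push_cast
    linear_combination (-(starRingEnd ℂ (mode k x)) * ((‖f x‖ ^ 2 : ℂ) * f x)) * Complex.I_sq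
  rw [h1, h2, nonlinearity, dualPairing_apply, ← integral_const_mul, ← integral_const_mul,
    ← integral_sub (i1.const_mul _) (i2.const_mul _)]
  refine integral_congr_ae (Eventually.of_forall fun x => ?_)
  simp only [cubicTerm]
  ring

/-! ### Solutions with an `L⁴` representative. -/

/-- A solution on `[a, c]` with a representative in `L⁴([a, c]; L⁴(𝕋))`. -/
structure IsL4Solution (ξ σ a c : ℝ) (u : ℝ → L2T) (f : ℝ → L4T) : Prop where
  memLp : MemLp f 4 (volume.restrict (Icc a c))
  ae_eq : ∀ᵐ t ∂(volume.restrict (Icc a c)), inclL4 (f t) = u t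
  duhamel : IsDuhamel (Icc a c) (fun t => nonlinearity ξ σ (f t)) u

namespace IsL4Solution

variable {ξ σ a c : ℝ} {u : ℝ → L2T} {f : ℝ → L4T}

lemma mono (h : IsL4Solution ξ σ a c u f) {a' c' : ℝ} (hsub : Icc a' c' ⊆ Icc a c) :
    IsL4Solution ξ σ a' c' u f :=
  ⟨h.memLp.mono_measure (Measure.restrict_mono hsub le_rfl), ae_restrict_of_ae_restrict_of_subset hsub h.ae_eq,
    h.duhamel.mono hsub⟩

lemma memLp_nonlinearity (h : IsL4Solution ξ σ a c u f) :
    MemLp (fun t => nonlinearity ξ σ (f t)) (4 / 3) (volume.restrict (Icc a c)) :=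
  have := isFiniteMeasure_restrict_Icc a c
  _root_.memLp_nonlinearity ξ σ h.memLp

lemma continuousOn (h : IsL4Solution ξ σ a c u f) : ContinuousOn u (Icc a c) :=
  h.duhamel.continuousOn h.memLp_nonlinearity

end IsL4Solution

section
variable {ξ σ b : ℝ} {I : Set ℝ} {u₀ : L2T} {u : ℝ → L2T}

lemma IsSolutionOn.apply_zero (h : IsSolutionOn ξ σ b I u₀ u) (h0 : (0 : ℝ) ∈ I) : u 0 = u₀ := by
  refine ext_coeffL2 fun k => ?_
  rw [coeffL2_apply, coeffL2_apply, h.duhamel 0 h0 k]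
  simp

/-- The integrand of Duhamel's formula in terms of the `L⁴` representative. -/
lemma duhamel_integrand_eq {t τ : ℝ} {f : L4T} {v : L2T} (h : inclL4 f = v) (k : ℤ) :
    Complex.exp (-(Complex.I * (k : ℂ) ^ 2 * ((t - τ : ℝ) : ℂ))) *
        ((ξ : ℂ) * spaceFourier v k -
          ((σ : ℂ) + Complex.I) *
            spaceFourier (fun x => ((‖v x‖ ^ 2 : ℝ) : ℂ) * v x) k) =
      schrodingerPhase k t * (schrodingerPhase k (-τ) * nonlinearity ξ σ f (mode k)) := by
  rw [← nonlinearity_mode ξ σ h, ← mul_assoc, ← schrodingerPhase_add, ← sub_eq_add_neg]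
  rfl

/-- A finite restricted norm provides an extension in `X^{0,b} ⊆ L⁴` that agrees with `u` a.e. on
the interval. Duhamel's formula starts at `0`; subtracting two instances gives it between any two
times. -/
lemma exists_isL4Solution (hb : 1 / 2 < b) (h : IsSolutionOn ξ σ b I u₀ u) {a c : ℝ}
    (hsub : Icc a c ⊆ I) (h0 : (0 : ℝ) ∈ Icc a c) : ∃ f, IsL4Solution ξ σ a c u f := by
  have h1 := h.mem_restricted a c hsub
  rw [restrictedNorm] at h1
  simp only [iInf_lt_iff] at h1
  obtain ⟨G, hG, hGn⟩ := h1
  obtain ⟨f, hf, hfG⟩ := exists_L4_of_bourgainNorm_lt_top hb G hGn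
  have hae : ∀ᵐ t ∂(volume.restrict (Icc a c)), inclL4 (f t) = u t := by
    filter_upwards [hG, ae_restrict_of_ae hfG] with t h2 h3
    rw [h3, h2]
  have hmem : MemLp f 4 (volume.restrict (Icc a c)) := hf.mono_measure Measure.restrict_le_self
  have := isFiniteMeasure_restrict_Icc a c
  have hN := memLp_nonlinearity ξ σ hmem
  have key : ∀ t ∈ Icc a c, ∀ k, coeffL2 k (freeFlow (-t) (u t)) = coeffL2 k u₀ +
      ∫ τ in (0 : ℝ)..t, forcingCoeff (fun t => nonlinearity ξ σ (f t)) k τ := by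
    intro t ht k
    rw [coeffL2_freeFlow, coeffL2_apply, h.duhamel t (hsub ht) k, ← coeffL2_apply]
    have e : ∫ τ in (0 : ℝ)..t, Complex.exp (-(Complex.I * (k : ℂ) ^ 2 * ((t - τ : ℝ) : ℂ))) *
        ((ξ : ℂ) * spaceFourier (u τ) k -
          ((σ : ℂ) + Complex.I) *
            spaceFourier (fun x => ((‖u τ x‖ ^ 2 : ℝ) : ℂ) * u τ x) k) =
        ∫ τ in (0 : ℝ)..t, schrodingerPhase k t *
          forcingCoeff (fun t => nonlinearity ξ σ (f t)) k τ := by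
      refine intervalIntegral.integral_congr_ae ?_
      rw [ae_restrict_iff' measurableSet_Icc] at hae
      filter_upwards [hae] with τ h2 h3
      exact duhamel_integrand_eq (h2 (uIoc_subset_Icc_of_mem h0 ht h3)) k
    rw [e, intervalIntegral.integral_const_mul]
    change _ * (schrodingerPhase k t * _ + _) = _
    rw [← mul_add, ← mul_assoc, schrodingerPhase_neg_mul, one_mul]
  refine ⟨f, hmem, hae, fun s hs t ht k => ?_⟩
  rw [map_sub, key t ht k, key s hs k, add_sub_add_left_eq_sub]
  exact intervalIntegral.integral_interval_sub_left
    (intervalIntegrable_forcingCoeff hN h0 ht k) (intervalIntegrable_forcingCoeff hN h0 hs k)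

lemma restrictedNorm_mono {J J' : Set ℝ} (hJ : J ⊆ J') (u : ℝ → L2T) :
    restrictedNorm b J u ≤ restrictedNorm b J' u := by
  refine le_iInf₂ fun f hf => iInf₂_le f ?_
  exact ae_restrict_of_ae_restrict_of_subset hJ hf

lemma ENNReal_pow_three_le (y : ℝ≥0∞) : y ^ 3 ≤ 1 + y ^ 4 := by
  rcases le_total y 1 with h | h
  · exact (pow_le_one₀ zero_le h).trans le_self_add
  · exact (pow_le_pow_right₀ h (by norm_num)).trans le_add_self

lemma IsL4Solution.restrictedNorm_lt_top {a c : ℝ} {f : ℝ → L4T} (hb : 1 / 2 < b) (hb' : b < 5 / 8)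
    (h : IsL4Solution ξ σ a c u f) (hac : a ≤ c) : restrictedNorm b (Icc a c) u < ∞ := by
  obtain ⟨C, hC, hlin⟩ := exists_linear_estimate hb hb' (c - a + 1) (by linarith)
  obtain ⟨-, -, -, -, hle, -⟩ := hlin a c hac (by linarith) _ h.memLp_nonlinearity u h.duhamel a
    (left_mem_Icc.2 hac)
  refine hle.trans_lt ?_
  have := h.memLp_nonlinearity.2.ne
  exact ENNReal.mul_lt_top hC.lt_top (by finiteness)

lemma IsL4Solution.lintegral_cube_lt_top {a c : ℝ} {f : ℝ → L4T} (h : IsL4Solution ξ σ a c u f) :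
    ∫⁻ t in Icc a c, ∫⁻ x : Torus, ‖u t x‖ₑ ^ 3 < ∞ := by
  have h1 : ∀ᵐ t ∂(volume.restrict (Icc a c)), ∫⁻ x : Torus, ‖u t x‖ₑ ^ 3 ≤
      (volume : Measure Torus) univ + ‖f t‖ₑ ^ 4 := by
    filter_upwards [h.ae_eq] with t ht
    have hu : (u t : Torus → ℂ) =ᵐ[volume] f t := ht ▸ coeFn_inclL4 (f t)
    calc ∫⁻ x : Torus, ‖u t x‖ₑ ^ 3 ≤ ∫⁻ x : Torus, (1 + ‖f t x‖ₑ ^ 4) := by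
          refine lintegral_mono_ae ?_
          filter_upwards [hu] with x hx
          rw [hx]
          exact ENNReal_pow_three_le _
      _ = _ := by
          rw [lintegral_add_left measurable_const, lintegral_one, enorm_L4_pow_four]
  refine (lintegral_mono_ae h1).trans_lt ?_
  rw [lintegral_add_left measurable_const, ← eLpNorm_four_pow]
  have h2 := h.memLp.2.ne
  simp only [lintegral_const, Measure.restrict_apply_univ, Real.volume_Icc]
  finiteness

/-- The converse passage. A compact interval in `[a₀, ∞)` is enlarged to one that starts at `a₀` and
contains `0`, where the linear estimate and Duhamel's formula from `0` are available. -/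
lemma isSolutionOn_of_isL4Solution (hb : 1 / 2 < b) (hb' : b < 5 / 8) {a₀ : ℝ} (ha₀ : a₀ ≤ 0)
    (h : ∀ T, 0 ≤ T → ∃ f, IsL4Solution ξ σ a₀ T u f) : IsSolutionOn ξ σ b (Ici a₀) (u 0) u := by
  have hcov : ∀ a c : ℝ, Icc a c ⊆ Ici a₀ → Icc a c ⊆ Icc a₀ (max c 0) := fun a c hsub x hx =>
    ⟨hsub hx, hx.2.trans (le_max_left _ _)⟩
  refine ⟨fun t ht => ?_, fun a c hsub => ?_, fun a c hsub => ?_, fun t ht k => ?_⟩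
  · obtain ⟨f, hf⟩ := h (max (t + 1) 0) (le_max_right _ _)
    have h1 := hf.continuousOn t ⟨ht, by linarith [le_max_left (t + 1) 0]⟩
    refine h1.mono_of_mem_nhdsWithin ?_
    have h2 : Iio (t + 1) ∈ 𝓝[Ici a₀] t := mem_nhdsWithin_of_mem_nhds (Iio_mem_nhds (by linarith))
    filter_upwards [h2, self_mem_nhdsWithin] with x hx hx'
    exact ⟨hx', (le_of_lt hx).trans (le_max_left _ _)⟩
  · obtain ⟨f, hf⟩ := h (max c 0) (le_max_right _ _)
    exact (restrictedNorm_mono (hcov a c hsub) u).trans_lt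
      (hf.restrictedNorm_lt_top hb hb' (ha₀.trans (le_max_right _ _)))
  · obtain ⟨f, hf⟩ := h (max c 0) (le_max_right _ _)
    exact (lintegral_mono_set (hcov a c hsub)).trans_lt hf.lintegral_cube_lt_top
  · obtain ⟨f, hf⟩ := h (max t 0) (le_max_right _ _)
    have h0 : (0 : ℝ) ∈ Icc a₀ (max t 0) := ⟨ha₀, le_max_right _ _⟩
    have ht' : t ∈ Icc a₀ (max t 0) := ⟨ht, le_max_left _ _⟩
    have h1 := hf.duhamel 0 h0 t ht' k
    rw [map_sub, neg_zero, freeFlow_zero, coeffL2_freeFlow, sub_eq_iff_eq_add] at h1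
    have e : ∫ τ in (0 : ℝ)..t, Complex.exp (-(Complex.I * (k : ℂ) ^ 2 * ((t - τ : ℝ) : ℂ))) *
        ((ξ : ℂ) * spaceFourier (u τ) k -
          ((σ : ℂ) + Complex.I) *
            spaceFourier (fun x => ((‖u τ x‖ ^ 2 : ℝ) : ℂ) * u τ x) k) =
        ∫ τ in (0 : ℝ)..t, schrodingerPhase k t *
          forcingCoeff (fun t => nonlinearity ξ σ (f t)) k τ := by
      refine intervalIntegral.integral_congr_ae ?_
      have hae := hf.ae_eq
      rw [ae_restrict_iff' measurableSet_Icc] at hae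
      filter_upwards [hae] with τ h2 h3
      exact duhamel_integrand_eq (h2 (uIoc_subset_Icc_of_mem h0 ht' h3)) k
    rw [e, intervalIntegral.integral_const_mul, ← coeffL2_apply, ← coeffL2_apply]
    change _ = schrodingerPhase k t * _ + _
    rw [← mul_add, add_comm (coeffL2 k (u 0)), ← h1, ← mul_assoc, mul_comm (schrodingerPhase k t),
      schrodingerPhase_neg_mul, one_mul]

end

/-! ### Linear estimates with a small constant on short intervals. -/

lemma forcingCoeff_sub (F G : ℝ → DualL4T) (k : ℤ) (t : ℝ) :
    forcingCoeff (fun t => F t - G t) k t = forcingCoeff F k t - forcingCoeff G k t := by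
  simp only [forcingCoeff, sub_apply, mul_sub]

lemma IsDuhamel.sub {a c : ℝ} {F G : ℝ → DualL4T} {u v : ℝ → L2T} (hu : IsDuhamel (Icc a c) F u)
    (hv : IsDuhamel (Icc a c) G v) (hF : MemLp F (4 / 3) (volume.restrict (Icc a c)))
    (hG : MemLp G (4 / 3) (volume.restrict (Icc a c))) :
    IsDuhamel (Icc a c) (fun t => F t - G t) fun t => u t - v t := by
  intro s hs t ht k
  simp_rw [forcingCoeff_sub]
  rw [intervalIntegral.integral_sub (intervalIntegrable_forcingCoeff hF hs ht k)
    (intervalIntegrable_forcingCoeff hG hs ht k), ← hu s hs t ht k, ← hv s hs t ht k]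
  simp only [map_sub]
  ring

lemma memLp_zero_restrict_Icc (a c : ℝ) :
    MemLp (fun _ : ℝ => (0 : DualL4T)) (4 / 3) (volume.restrict (Icc a c)) :=
  have := isFiniteMeasure_restrict_Icc a c
  memLp_const 0

lemma isDuhamel_freeFlow (J : Set ℝ) (t₀ : ℝ) (x : L2T) :
    IsDuhamel J (fun _ => 0) fun t => freeFlow (t - t₀) x := by
  intro s _ t _ k
  rw [← freeFlow_add, ← freeFlow_add, show -t + (t - t₀) = -s + (s - t₀) by ring, sub_self, map_zero]
  simp [forcingCoeff]

/-- The free evolution is small in `L⁴` on short time intervals. -/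
lemma exists_free_L4_le {b : ℝ} (hb : 1 / 2 < b) (hb' : b < 5 / 8) :
    ∃ κ : ℝ → ℝ≥0∞, Tendsto κ (𝓝[>] 0) (𝓝 0) ∧ ∀ δ, 0 < δ → ∀ (t₀ : ℝ) (x : L2T),
      ∃ f : ℝ → L4T, MemLp f 4 (volume.restrict (Icc t₀ (t₀ + δ))) ∧
        (∀ᵐ t ∂(volume.restrict (Icc t₀ (t₀ + δ))), inclL4 (f t) = freeFlow (t - t₀) x) ∧
        eLpNorm f 4 (volume.restrict (Icc t₀ (t₀ + δ))) ≤ κ δ * ‖x‖ₑ := by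
  -- The exponent `1 - b` lies above `3/8`, so that Strichartz holds, and below `1/2`, so that the
  -- cutoff factor vanishes with `δ`.
  obtain ⟨C, hC, hS⟩ := exists_homogeneous_strichartz (β := 1 - b) (by linarith) (by linarith)
  set P := ENNReal.ofReal (2 * π)
  refine ⟨fun δ => C ^ (1 / 4 : ℝ) * (ENNReal.ofReal (cutoffScale (1 - b) δ) * P) ^ (1 / 2 : ℝ),
    ?_, fun δ hδ t₀ x => ?_⟩
  · have h1 := ENNReal.tendsto_ofReal (tendsto_cutoffScale (β := 1 - b) (by linarith))
    rw [ENNReal.ofReal_zero] at h1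
    have h2 := ENNReal.Tendsto.mul_const h1 (Or.inr (show P ≠ ∞ from ENNReal.ofReal_ne_top))
    rw [zero_mul] at h2
    have h3 := ((ENNReal.continuous_rpow_const (y := (1 / 2 : ℝ))).tendsto 0).comp h2
    rw [ENNReal.zero_rpow_of_pos one_half_pos] at h3
    have h4 := ENNReal.Tendsto.const_mul h3 (Or.inr (show C ^ (1 / 4 : ℝ) ≠ ∞ by finiteness))
    rwa [mul_zero] at h4
  -- Used only for an `L⁴` representative and the convergence of its partial sums. The small
  -- constant is proved for the partial sums and passes to the limit.
  obtain ⟨D, -, hlin⟩ := exists_linear_estimate hb hb' δ hδ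
  obtain ⟨f, hf, hfu, -, -, hlim⟩ := hlin t₀ (t₀ + δ) (by linarith) (by linarith) (fun _ => 0)
    (memLp_zero_restrict_Icc _ _) _ (isDuhamel_freeFlow _ t₀ x) t₀ (left_mem_Icc.2 (by linarith))
  refine ⟨f, hf, hfu, ?_⟩
  set μ := volume.restrict (Icc t₀ (t₀ + δ))
  set y := freeFlow (-t₀) x
  set p : ℕ → ℝ → L4T := fun n t => partialSum n fun k => coeffL2 k (freeFlow (t - t₀) x)
  have hp : ∀ n, p n = fun t => trigPoly (Finset.Icc (-(n : ℤ)) n) fun k =>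
      schrodingerPhase k t * coeffL2 k y := by
    intro n
    ext1 t
    simp only [p, partialSum, y, ← coeffL2_freeFlow, ← freeFlow_add, ← sub_eq_add_neg]
  have hpm : ∀ n, AEStronglyMeasurable (p n) μ := fun n => by
    rw [hp]
    exact (continuous_trigPoly fun k => by fun_prop).aestronglyMeasurable
  have hpn : ∀ n, eLpNorm (p n) 4 μ ≤
      C ^ (1 / 4 : ℝ) * (ENNReal.ofReal (cutoffScale (1 - b) δ) * P) ^ (1 / 2 : ℝ) * ‖x‖ₑ := by
    intro n
    rw [hp, eLpNorm_four_eq]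
    have h1 : ∑ k ∈ Finset.Icc (-(n : ℤ)) n, ‖coeffL2 k y‖ₑ ^ 2 ≤ P * ‖x‖ₑ ^ 2 := by
      refine (ENNReal.sum_le_tsum _).trans_eq ?_
      rw [tsum_enorm_sq_coeffL2, enorm_freeFlow]
    have h2 := hS δ hδ t₀ (Finset.Icc (-(n : ℤ)) n) fun k => coeffL2 k y
    calc _ ≤ (C * (ENNReal.ofReal (cutoffScale (1 - b) δ) * (P * ‖x‖ₑ ^ 2)) ^ 2) ^ (1 / 4 : ℝ) := by
          refine ENNReal.rpow_le_rpow ?_ (by norm_num)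
          refine (lintegral_mono_set (Icc_subset_Icc (by linarith) le_rfl)).trans (h2.trans ?_)
          exact mul_le_mul_right (pow_le_pow_left₀ zero_le (mul_le_mul_right h1 _) 2) _
      _ = _ := by
          rw [← mul_assoc (ENNReal.ofReal _) P, mul_assoc (C ^ (1 / 4 : ℝ)),
            ENNReal.mul_rpow_of_nonneg _ _ (by norm_num)]
          congr 1
          rw [← ENNReal.rpow_natCast, ← ENNReal.rpow_mul,
            ENNReal.mul_rpow_of_nonneg _ _ (by norm_num), ← ENNReal.rpow_natCast ‖x‖ₑ,
            ← ENNReal.rpow_mul]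
          norm_num
  have hle : ∀ n, eLpNorm f 4 μ ≤ eLpNorm (fun t => f t - p n t) 4 μ +
      C ^ (1 / 4 : ℝ) * (ENNReal.ofReal (cutoffScale (1 - b) δ) * P) ^ (1 / 2 : ℝ) * ‖x‖ₑ := by
    intro n
    have h1 := eLpNorm_add_le (p := 4) (hf.1.sub (hpm n)) (hpm n) (by norm_num)
    rw [sub_add_cancel] at h1
    exact h1.trans (add_le_add le_rfl (hpn n))
  have hlim' := hlim.add_const
    (C ^ (1 / 4 : ℝ) * (ENNReal.ofReal (cutoffScale (1 - b) δ) * P) ^ (1 / 2 : ℝ) * ‖x‖ₑ)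
  rw [zero_add] at hlim'
  exact ge_of_tendsto' hlim' hle

/-- The linear estimate on short time intervals. -/
lemma exists_local_linear_estimate {b : ℝ} (hb : 1 / 2 < b) (hb' : b < 5 / 8) :
    ∃ C : ℝ≥0∞, C ≠ ∞ ∧ ∃ κ : ℝ → ℝ≥0∞, Tendsto κ (𝓝[>] 0) (𝓝 0) ∧ ∀ δ, 0 < δ → δ ≤ 1 →
      ∀ (t₀ : ℝ) (F : ℝ → DualL4T), MemLp F (4 / 3) (volume.restrict (Icc t₀ (t₀ + δ))) →
      ∀ u : ℝ → L2T, IsDuhamel (Icc t₀ (t₀ + δ)) F u →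
      ∃ f : ℝ → L4T, MemLp f 4 (volume.restrict (Icc t₀ (t₀ + δ))) ∧
        (∀ᵐ t ∂(volume.restrict (Icc t₀ (t₀ + δ))), inclL4 (f t) = u t) ∧
        eLpNorm f 4 (volume.restrict (Icc t₀ (t₀ + δ))) ≤ κ δ * ‖u t₀‖ₑ +
          C * eLpNorm F (4 / 3) (volume.restrict (Icc t₀ (t₀ + δ))) := by
  obtain ⟨κ, hκ, hfree⟩ := exists_free_L4_le hb hb'
  obtain ⟨C, hC, hlin⟩ := exists_linear_estimate hb hb' 1 one_pos
  refine ⟨C, hC, κ, hκ, fun δ hδ hδ1 t₀ F hF u hu => ?_⟩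
  obtain ⟨f, hf, hfu, hfn⟩ := hfree δ hδ t₀ (u t₀)
  -- Without its free part the solution vanishes at `t₀`, so the general estimate leaves only the
  -- forcing term.
  have hw := hu.sub (isDuhamel_freeFlow (Icc t₀ (t₀ + δ)) t₀ (u t₀)) hF (memLp_zero_restrict_Icc _ _)
  simp only [sub_zero] at hw
  obtain ⟨g, hg, hgu, hgn, -, -⟩ := hlin t₀ (t₀ + δ) (by linarith) (by linarith) F hF _ hw t₀
    (left_mem_Icc.2 (by linarith))
  simp only [sub_self, freeFlow_zero, enorm_zero, zero_add] at hgn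
  refine ⟨fun t => f t + g t, hf.add hg, ?_, ?_⟩
  · filter_upwards [hfu, hgu] with t h1 h2
    rw [map_add, h1, h2, add_sub_cancel]
  · exact (eLpNorm_add_le hf.1 hg.1 (by norm_num)).trans (add_le_add hfn hgn)

/-! ### Differences of solutions and uniqueness. -/

/-- The difference of two solutions on an interval of bounded length. -/
lemma exists_difference_estimate {b : ℝ} (hb : 1 / 2 < b) (hb' : b < 5 / 8) (ξ σ L : ℝ)
    (hL : 0 < L) :
    ∃ C : ℝ≥0∞, C ≠ ∞ ∧ ∀ (a c : ℝ), a ≤ c → c - a ≤ L → ∀ (u v : ℝ → L2T) (f g : ℝ → L4T),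
      IsL4Solution ξ σ a c u f → IsL4Solution ξ σ a c v g → ∀ s ∈ Icc a c, ∀ X : ℝ≥0∞,
      X = C * (‖u s - v s‖ₑ + (ENNReal.ofReal (c - a) ^ (1 / 2 : ℝ) +
        eLpNorm f 4 (volume.restrict (Icc a c)) ^ 2 + eLpNorm g 4 (volume.restrict (Icc a c)) ^ 2) *
        eLpNorm (fun t => f t - g t) 4 (volume.restrict (Icc a c))) →
      eLpNorm (fun t => f t - g t) 4 (volume.restrict (Icc a c)) ≤ X ∧
        restrictedNorm b (Icc a c) (fun t => u t - v t) ≤ X ∧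
        ∀ t ∈ Icc a c, ‖u t - v t‖ₑ ≤ X := by
  obtain ⟨C, hC, hlin⟩ := exists_linear_estimate hb hb' L hL
  obtain ⟨D, hD, hsup⟩ := exists_enorm_le_of_isDuhamel L hL
  obtain ⟨A, hA, hN⟩ := exists_eLpNorm_nonlinearity_sub_le ξ σ
  refine ⟨(C + D) * (1 + A), by finiteness, fun a c hac hcL u v f g hu hv s hs X hX => ?_⟩
  have hd := hu.duhamel.sub hv.duhamel hu.memLp_nonlinearity hv.memLp_nonlinearity
  have hm := hu.memLp_nonlinearity.sub hv.memLp_nonlinearity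
  obtain ⟨h, -, hhu, hhn, hhr, -⟩ := hlin a c hac hcL _ hm _ hd s hs
  have hs' := hsup a c hcL _ hm _ hd s hs
  have hNb := hN (volume.restrict (Icc a c)) f g hu.memLp.1 hv.memLp.1
  rw [Measure.restrict_apply_univ, Real.volume_Icc] at hNb
  set Y := (ENNReal.ofReal (c - a) ^ (1 / 2 : ℝ) +
        eLpNorm f 4 (volume.restrict (Icc a c)) ^ 2 + eLpNorm g 4 (volume.restrict (Icc a c)) ^ 2) *
        eLpNorm (fun t => f t - g t) 4 (volume.restrict (Icc a c))
  have hb1 : ‖u s - v s‖ₑ + eLpNorm (fun t => nonlinearity ξ σ (f t) - nonlinearity ξ σ (g t)) (4 / 3)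
      (volume.restrict (Icc a c)) ≤ (1 + A) * (‖u s - v s‖ₑ + Y) := by
    refine (add_le_add le_rfl hNb).trans ?_
    rw [add_mul, one_mul, mul_add, add_add_add_comm]
    calc _ ≤ ‖u s - v s‖ₑ + A * ‖u s - v s‖ₑ + A * Y := by
          rw [add_assoc]; exact add_le_add le_rfl le_add_self
      _ ≤ ‖u s - v s‖ₑ + A * ‖u s - v s‖ₑ + (Y + A * Y) := add_le_add le_rfl le_add_self
      _ = _ := by ring
  have hb2 : ∀ K ≤ C + D, K * (‖u s - v s‖ₑ + eLpNorm (fun t => nonlinearity ξ σ (f t) -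
      nonlinearity ξ σ (g t)) (4 / 3) (volume.restrict (Icc a c))) ≤ X := by
    intro K hK
    rw [hX, mul_assoc]
    exact mul_le_mul' hK hb1
  refine ⟨?_, hhr.trans (hb2 C le_self_add), fun t ht => (hs' t ht).trans (hb2 D le_add_self)⟩
  refine le_trans (le_of_eq (eLpNorm_congr_ae ?_)) (hhn.trans (hb2 C le_self_add))
  filter_upwards [hhu, hu.ae_eq, hv.ae_eq] with t h1 h2 h3
  exact inclL4_injective (by rw [map_sub, h1, h2, h3])

/-- Absorption: `C * Z * Y ≤ Y / 2` is moved to the left side, which is legitimate because `Y` is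
finite. -/
lemma ENNReal_le_two_mul_of_le {C Y e Z : ℝ≥0∞} (hY : Y ≠ ∞) (h : Y ≤ C * (e + Z * Y))
    (hCZ : C * Z ≤ 1 / 2) : C * (e + Z * Y) ≤ 2 * C * e := by
  have h1 : C * (e + Z * Y) ≤ C * e + Y / 2 := by
    rw [mul_add, ← mul_assoc C Z]
    refine add_le_add le_rfl ((mul_le_mul_left hCZ _).trans_eq ?_)
    rw [one_div, ENNReal.div_eq_inv_mul]
  have h2 : Y / 2 ≤ C * e := by
    have h3 : Y / 2 + Y / 2 ≤ C * e + Y / 2 := by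
      rw [ENNReal.add_halves]; exact h.trans h1
    exact (ENNReal.add_le_add_iff_right (by finiteness)).1 h3
  calc _ ≤ C * e + Y / 2 := h1
    _ ≤ C * e + C * e := add_le_add le_rfl h2
    _ = _ := by ring

/-- The Lipschitz estimate on intervals where the solutions are small in `L⁴`. -/
lemma exists_lipschitz_of_small {b : ℝ} (hb : 1 / 2 < b) (hb' : b < 5 / 8) (ξ σ L : ℝ)
    (hL : 0 < L) :
    ∃ C : ℝ≥0∞, C ≠ ∞ ∧ ∀ (a c : ℝ), a ≤ c → c - a ≤ L → ∀ (u v : ℝ → L2T) (f g : ℝ → L4T),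
      IsL4Solution ξ σ a c u f → IsL4Solution ξ σ a c v g → ∀ s ∈ Icc a c,
      C * (ENNReal.ofReal (c - a) ^ (1 / 2 : ℝ) +
        eLpNorm f 4 (volume.restrict (Icc a c)) ^ 2 + eLpNorm g 4 (volume.restrict (Icc a c)) ^ 2) ≤
        1 / 2 →
      eLpNorm (fun t => f t - g t) 4 (volume.restrict (Icc a c)) ≤ 2 * C * ‖u s - v s‖ₑ ∧
        ∀ t ∈ Icc a c, ‖u t - v t‖ₑ ≤ 2 * C * ‖u s - v s‖ₑ := by
  obtain ⟨C, hC, h⟩ := exists_difference_estimate hb hb' ξ σ L hL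
  refine ⟨C, hC, fun a c hac hcL u v f g hu hv s hs hsmall => ?_⟩
  obtain ⟨h1, -, h2⟩ := h a c hac hcL u v f g hu hv s hs _ rfl
  have h3 := ENNReal_le_two_mul_of_le (hu.memLp.sub hv.memLp).2.ne h1 hsmall
  exact ⟨h1.trans h3, fun t ht => (h2 t ht).trans h3⟩

/-- The bound `η ≤ 1` lets `η²` be replaced by `η`, and `1/8` leaves room for three such terms below
`1/2`. -/
lemma exists_pos_mul_ofReal_le {C : ℝ≥0∞} (hC : C ≠ ∞) :
    ∃ η : ℝ, 0 < η ∧ η ≤ 1 ∧ C * ENNReal.ofReal η ≤ 1 / 8 := by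
  have h1 : 0 < C.toReal + 1 := by positivity
  refine ⟨1 / (8 * (C.toReal + 1)), by positivity, ?_, ?_⟩
  · rw [div_le_one (by positivity)]; linarith [ENNReal.toReal_nonneg (a := C)]
  · calc C * ENNReal.ofReal (1 / (8 * (C.toReal + 1))) =
        ENNReal.ofReal (C.toReal * (1 / (8 * (C.toReal + 1)))) := by
          rw [ENNReal.ofReal_mul ENNReal.toReal_nonneg, ENNReal.ofReal_toReal hC]
      _ ≤ ENNReal.ofReal (1 / 8) := by
          refine ENNReal.ofReal_le_ofReal ?_
          rw [mul_one_div, div_le_div_iff₀ (by positivity) (by norm_num)]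
          linarith [ENNReal.toReal_nonneg (a := C)]
      _ = 1 / 8 := by
          rw [ENNReal.ofReal_div_of_pos (by norm_num)]; simp

/-- Absolute continuity of the `L⁴` norm, with `δ` uniform over all subintervals; this makes the
uniqueness argument a finite iteration. -/
lemma exists_eLpNorm_Icc_le {a c : ℝ} {f : ℝ → L4T} (hf : MemLp f 4 (volume.restrict (Icc a c)))
    {ε : ℝ} (hε : 0 < ε) : ∃ δ > 0, ∀ p q : ℝ, Icc p q ⊆ Icc a c → q - p ≤ δ →
      eLpNorm f 4 (volume.restrict (Icc p q)) ≤ ENNReal.ofReal ε := by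
  obtain ⟨δ, hδ, h⟩ := hf.eLpNorm_indicator_le (by norm_num) (by norm_num) hε
  refine ⟨δ, hδ, fun p q hpq hle => ?_⟩
  have h1 := h (Icc p q) measurableSet_Icc ((Measure.restrict_apply_le _ _).trans (by
    rw [Real.volume_Icc]; exact ENNReal.ofReal_le_ofReal hle))
  rwa [eLpNorm_indicator_eq_eLpNorm_restrict measurableSet_Icc,
    Measure.restrict_restrict measurableSet_Icc, inter_eq_left.2 hpq] at h1

/-- Uniqueness of solutions on a compact interval. -/
theorem IsL4Solution.eqOn {b : ℝ} (hb : 1 / 2 < b) (hb' : b < 5 / 8) {ξ σ a c : ℝ} {u v : ℝ → L2T}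
    {f g : ℝ → L4T} (hu : IsL4Solution ξ σ a c u f) (hv : IsL4Solution ξ σ a c v g) {s : ℝ}
    (hs : s ∈ Icc a c) (h : u s = v s) : EqOn u v (Icc a c) := by
  have hac := hs.1.trans hs.2
  obtain ⟨C, hC, hlip⟩ := exists_lipschitz_of_small hb hb' ξ σ (c - a + 1) (by linarith)
  obtain ⟨η, hη, hη1, hCη⟩ := exists_pos_mul_ofReal_le hC
  obtain ⟨δ₁, hδ₁, h₁⟩ := exists_eLpNorm_Icc_le hu.memLp hη
  obtain ⟨δ₂, hδ₂, h₂⟩ := exists_eLpNorm_Icc_le hv.memLp hη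
  -- The length of the interval enters the difference estimate through its square root, hence `η ^
  -- 2`.
  set δ := min (min δ₁ δ₂) (η ^ 2)
  have hδ : 0 < δ := by positivity
  have hsq : ENNReal.ofReal η ^ 2 ≤ ENNReal.ofReal η := by
    rw [sq]
    calc _ ≤ ENNReal.ofReal η * 1 := mul_le_mul_right (ENNReal.ofReal_le_one.2 hη1) _
      _ = _ := mul_one _
  have hstep : ∀ p q : ℝ, p ≤ q → Icc p q ⊆ Icc a c → q - p ≤ δ → ∀ s ∈ Icc p q, u s = v s →
      ∀ t ∈ Icc p q, u t = v t := by
    intro p q hpq hsub hle s hs h t ht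
    have hsub' := hsub
    rw [Icc_subset_Icc_iff hpq] at hsub'
    have h3 : ENNReal.ofReal (q - p) ^ (1 / 2 : ℝ) ≤ ENNReal.ofReal η := by
      calc _ ≤ ENNReal.ofReal (η ^ 2) ^ (1 / 2 : ℝ) :=
            ENNReal.rpow_le_rpow (ENNReal.ofReal_le_ofReal (hle.trans (min_le_right _ _)))
              one_half_pos.le
        _ = _ := by rw [ENNReal.ofReal_pow hη.le, ENNReal_sq_sqrt]
    have h4 := h₁ p q hsub (hle.trans ((min_le_left _ _).trans (min_le_left _ _)))
    have h5 := h₂ p q hsub (hle.trans ((min_le_left _ _).trans (min_le_right _ _)))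
    have hsmall : C * (ENNReal.ofReal (q - p) ^ (1 / 2 : ℝ) +
        eLpNorm f 4 (volume.restrict (Icc p q)) ^ 2 +
        eLpNorm g 4 (volume.restrict (Icc p q)) ^ 2) ≤ 1 / 2 := by
      calc _ ≤ C * (ENNReal.ofReal η + ENNReal.ofReal η + ENNReal.ofReal η) := by
            refine mul_le_mul_right (add_le_add (add_le_add h3 ?_) ?_) _
            · exact (pow_le_pow_left₀ zero_le h4 2).trans hsq
            · exact (pow_le_pow_left₀ zero_le h5 2).trans hsq
        _ = C * ENNReal.ofReal η * 3 := by ring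
        _ ≤ 1 / 8 * 4 := mul_le_mul' hCη (by norm_num)
        _ = 1 / 2 := by
            rw [← ENNReal.toReal_eq_toReal_iff' (by finiteness) (by finiteness)]; norm_num
    obtain ⟨-, h6⟩ := hlip p q hpq (by linarith [hsub'.1, hsub'.2]) u v f g (hu.mono hsub)
      (hv.mono hsub) s hs hsmall
    have h7 := h6 t ht
    rw [h, sub_self, enorm_zero, mul_zero, nonpos_iff_eq_zero, enorm_eq_zero] at h7
    exact sub_eq_zero.1 h7
  -- Equality spreads from `s` in both directions, by one step of length at most `δ` at a time.
  have hind : ∀ n : ℕ, ∀ t ∈ Icc a c, |t - s| ≤ n * δ → u t = v t := by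
    intro n
    induction n with
    | zero =>
      intro t _ h1
      have : t = s := by
        have h2 : |t - s| ≤ 0 := by simpa using h1
        exact sub_eq_zero.1 (abs_nonpos_iff.1 h2)
      rw [this, h]
    | succ n ih =>
      intro t ht h1
      push_cast at h1
      rw [abs_le] at h1
      have hn : 0 ≤ n * δ := by positivity
      rcases le_total s t with hst | hst
      · set p := max s (t - δ)
        have hp : p ∈ Icc a c := ⟨hs.1.trans (le_max_left _ _), (max_le hst (by linarith)).trans ht.2⟩
        have hpt : p ≤ t := max_le hst (by linarith)
        have hps : |p - s| ≤ n * δ := by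
          rw [abs_of_nonneg (by linarith [le_max_left s (t - δ)])]
          have : p ≤ n * δ + s := max_le (by linarith) (by linarith)
          linarith
        exact hstep p t hpt (Icc_subset_Icc hp.1 ht.2) (by linarith [le_max_right s (t - δ)]) p
          (left_mem_Icc.2 hpt) (ih p hp hps) t (right_mem_Icc.2 hpt)
      · set p := min s (t + δ)
        have hpt : t ≤ p := le_min hst (by linarith)
        have hp : p ∈ Icc a c := ⟨ht.1.trans hpt, (min_le_left _ _).trans hs.2⟩
        have hps : |p - s| ≤ n * δ := by
          rw [abs_sub_comm, abs_of_nonneg (by linarith [min_le_left s (t + δ)])]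
          have : s - n * δ ≤ p := le_min (by linarith) (by linarith)
          linarith
        exact hstep t p hpt (Icc_subset_Icc ht.1 hp.2) (by linarith [min_le_right s (t + δ)]) p
          (right_mem_Icc.2 hpt) (ih p hp hps) t (left_mem_Icc.2 hpt)
  intro t ht
  obtain ⟨n, hn⟩ := exists_nat_ge (|t - s| / δ)
  exact hind n t ht ((div_le_iff₀ hδ).1 hn)

/-! ### Local existence by contraction. -/

/-- Local existence, on intervals whose length depends only on the size of the data, with `L⁴`
norms as small as desired. -/
theorem exists_local_solution {b : ℝ} (hb : 1 / 2 < b) (hb' : b < 5 / 8) (ξ σ : ℝ)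
    {M C₀ : ℝ≥0∞} (hM : M ≠ ∞) (hC₀ : C₀ ≠ ∞) :
    ∃ δ : ℝ, 0 < δ ∧ δ ≤ 1 ∧ ∃ r : ℝ≥0∞, r ≠ ∞ ∧
      C₀ * (ENNReal.ofReal δ ^ (1 / 2 : ℝ) + r ^ 2 + r ^ 2) ≤ 1 / 2 ∧
      ∀ (t₀ : ℝ) (u₀ : L2T), ‖u₀‖ₑ ≤ M → ∃ (u : ℝ → L2T) (f : ℝ → L4T),
        IsL4Solution ξ σ t₀ (t₀ + δ) u f ∧ u t₀ = u₀ ∧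
        eLpNorm f 4 (volume.restrict (Icc t₀ (t₀ + δ))) ≤ r := by
  obtain ⟨C, hC, κ, hκ, hlin⟩ := exists_local_linear_estimate hb hb'
  obtain ⟨A, hA, hN⟩ := exists_eLpNorm_nonlinearity_sub_le ξ σ
  -- One constant for two purposes: `C * A` is the Lipschitz factor of the contraction, and `C₀` is
  -- the smallness required in the conclusion.
  set C₁ := C * A + C₀
  have hC₁ : C₁ ≠ ∞ := by finiteness
  obtain ⟨η, hη, hη1, hCη⟩ := exists_pos_mul_ofReal_le hC₁
  set r := ENNReal.ofReal η
  have hr0 : r ≠ 0 := by simpa [r] using hη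
  have hrsq : r ^ 2 ≤ r := by
    rw [sq]
    calc _ ≤ r * 1 := mul_le_mul_right (ENNReal.ofReal_le_one.2 hη1) _
      _ = _ := mul_one _
  -- The free evolution takes up half of the radius `r` and leaves the other half to the nonlinear
  -- term. The choice of `δ` sees only the bound `M`, not the data or the initial time.
  have hev1 : ∀ᶠ δ in 𝓝[>] (0 : ℝ), κ δ * M ≤ r / 2 := by
    have h1 := ENNReal.Tendsto.mul_const hκ (Or.inr hM)
    rw [zero_mul] at h1
    exact h1.eventually_le_const (ENNReal.half_pos hr0)
  have hev2 : ∀ᶠ δ in 𝓝[>] (0 : ℝ), C₁ * ENNReal.ofReal δ ^ (1 / 2 : ℝ) ≤ 1 / 8 := by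
    have h1 : Tendsto (fun δ : ℝ => ENNReal.ofReal δ ^ (1 / 2 : ℝ)) (𝓝[>] 0) (𝓝 0) := by
      have : Continuous fun δ : ℝ => ENNReal.ofReal δ ^ (1 / 2 : ℝ) :=
        ENNReal.continuous_rpow_const.comp ENNReal.continuous_ofReal
      exact (this.tendsto' 0 0 (by simp)).mono_left nhdsWithin_le_nhds
    have h2 := ENNReal.Tendsto.const_mul h1 (Or.inr hC₁)
    rw [mul_zero] at h2
    exact h2.eventually_le_const (by simp)
  have hev3 : ∀ᶠ δ in 𝓝[>] (0 : ℝ), δ ≤ 1 :=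
    mem_nhdsWithin_of_mem_nhds (Iic_mem_nhds one_pos)
  obtain ⟨δ, ⟨⟨hδ1, hδ2⟩, hδ3⟩, hδ⟩ :=
    (((hev1.and hev2).and hev3).and self_mem_nhdsWithin).exists
  have hδ0 : 0 < δ := hδ
  have hsmall : C₁ * (ENNReal.ofReal δ ^ (1 / 2 : ℝ) + r ^ 2 + r ^ 2) ≤ 1 / 2 := by
    calc _ ≤ C₁ * (ENNReal.ofReal δ ^ (1 / 2 : ℝ) + r + r) :=
          mul_le_mul_right (add_le_add (add_le_add le_rfl hrsq) hrsq) _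
      _ = C₁ * ENNReal.ofReal δ ^ (1 / 2 : ℝ) + C₁ * r + C₁ * r := by ring
      _ ≤ 1 / 8 + 1 / 8 + 1 / 8 := add_le_add (add_le_add hδ2 hCη) hCη
      _ ≤ 1 / 2 := by
          rw [← ENNReal.toReal_le_toReal (by finiteness) (by finiteness),
            ENNReal.toReal_add (by finiteness) (by finiteness),
            ENNReal.toReal_add (by finiteness) (by finiteness)]
          norm_num
  refine ⟨δ, hδ0, hδ3, r, ENNReal.ofReal_ne_top, (mul_le_mul_left le_add_self _).trans hsmall, fun t₀ u₀ hu₀ => ?_⟩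
  have hCA : C * A ≤ C₁ := le_self_add
  have ht₀ : t₀ ∈ Icc t₀ (t₀ + δ) := left_mem_Icc.2 (by linarith)
  set μ := volume.restrict (Icc t₀ (t₀ + δ))
  have hfin : IsFiniteMeasure μ := isFiniteMeasure_restrict_Icc _ _
  have hμ : μ univ = ENNReal.ofReal δ := by
    rw [Measure.restrict_apply_univ, Real.volume_Icc, add_sub_cancel_left]
  have hNm : ∀ g : Lp L4T 4 μ, MemLp (fun t => nonlinearity ξ σ (g t)) (4 / 3) μ := fun g =>
    memLp_nonlinearity ξ σ (Lp.memLp g)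
  -- The iteration map sends `g` to the `L⁴` representative `p` of the solution of the linear
  -- equation forced by the nonlinearity at `g`.
  have hex : ∀ g : Lp L4T 4 μ, ∃ (u : ℝ → L2T) (p : Lp L4T 4 μ),
      IsDuhamel (Icc t₀ (t₀ + δ)) (fun t => nonlinearity ξ σ (g t)) u ∧ u t₀ = u₀ ∧
      (∀ᵐ t ∂μ, inclL4 (p t) = u t) ∧
      ‖p‖ₑ ≤ κ δ * M + C * eLpNorm (fun t => nonlinearity ξ σ (g t)) (4 / 3) μ := by
    intro g
    obtain ⟨u, hu, hu0⟩ := exists_isDuhamel (hNm g) ht₀ u₀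
    obtain ⟨f, hf, hfu, hfn⟩ := hlin δ hδ0 hδ3 t₀ _ (hNm g) u hu
    refine ⟨u, hf.toLp f, hu, hu0, ?_, ?_⟩
    · filter_upwards [hf.coeFn_toLp, hfu] with t h1 h2
      rw [h1, h2]
    · rw [Lp.enorm_toLp]
      refine hfn.trans (add_le_add ?_ le_rfl)
      rw [hu0]
      exact mul_le_mul_right hu₀ _
  choose U Φ hU hU0 hUΦ hΦn using hex
  set S : Set (Lp L4T 4 μ) := {g | ‖g‖ₑ ≤ r}
  have hScl : IsClosed S := isClosed_le continuous_enorm continuous_const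
  have hmaps : MapsTo Φ S S := by
    intro g hg
    have h1 := hN μ g (fun _ => 0) (Lp.aestronglyMeasurable g) aestronglyMeasurable_const
    have h3 : eLpNorm (fun _ : ℝ => (0 : L4T)) 4 μ = 0 := eLpNorm_zero'
    simp only [nonlinearity_zero, sub_zero] at h1
    rw [h3, hμ, ← Lp.enorm_def] at h1
    have hg' : ‖g‖ₑ ≤ r := hg
    calc ‖Φ g‖ₑ ≤ κ δ * M + C * eLpNorm (fun t => nonlinearity ξ σ (g t)) (4 / 3) μ := hΦn g
      _ ≤ r / 2 + C * (A * ((ENNReal.ofReal δ ^ (1 / 2 : ℝ) + r ^ 2 + r ^ 2) * r)) := by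
          refine add_le_add hδ1 (mul_le_mul_right (h1.trans (mul_le_mul_right
            (mul_le_mul' (add_le_add (add_le_add le_rfl (pow_le_pow_left₀ zero_le hg' 2)) ?_) hg')
              _)) _)
          simp
      _ = r / 2 + C * A * (ENNReal.ofReal δ ^ (1 / 2 : ℝ) + r ^ 2 + r ^ 2) * r := by ring
      _ ≤ r / 2 + 1 / 2 * r :=
          add_le_add le_rfl (mul_le_mul_left ((mul_le_mul_left hCA _).trans hsmall) _)
      _ = r := by
          rw [one_div, ← ENNReal.div_eq_inv_mul, ENNReal.add_halves]
  have hcontr : ∀ g ∈ S, ∀ h ∈ S, edist (Φ g) (Φ h) ≤ ((1 / 2 : NNReal) : ℝ≥0∞) * edist g h := by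
    intro g hg h hh
    have hd := (hU g).sub (hU h) (hNm g) (hNm h)
    obtain ⟨p, -, hpu, hpn⟩ := hlin δ hδ0 hδ3 t₀ _ ((hNm g).sub (hNm h)) _ hd
    -- Both solutions start from `u₀`, so the difference has no free part.
    simp only [hU0, sub_self, enorm_zero, mul_zero, zero_add] at hpn
    have h1 := hN μ g h (Lp.aestronglyMeasurable g) (Lp.aestronglyMeasurable h)
    rw [hμ, ← Lp.enorm_def, ← Lp.enorm_def] at h1
    have e1 : edist (Φ g) (Φ h) = eLpNorm p 4 μ := by
      rw [edist_eq_enorm_sub, Lp.enorm_def]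
      refine eLpNorm_congr_ae ?_
      filter_upwards [Lp.coeFn_sub (Φ g) (Φ h), hUΦ g, hUΦ h, hpu] with t h2 h3 h4 h5
      exact inclL4_injective (by rw [h2, Pi.sub_apply, map_sub, h3, h4, h5])
    have e2 : edist g h = eLpNorm (fun t => g t - h t) 4 μ := by
      rw [edist_eq_enorm_sub, Lp.enorm_def]
      exact eLpNorm_congr_ae (Lp.coeFn_sub g h)
    have hg' : ‖g‖ₑ ≤ r := hg
    have hh' : ‖h‖ₑ ≤ r := hh
    rw [e1, e2]
    calc _ ≤ C * (A * ((ENNReal.ofReal δ ^ (1 / 2 : ℝ) + r ^ 2 + r ^ 2) *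
          eLpNorm (fun t => g t - h t) 4 μ)) := by
          refine hpn.trans (mul_le_mul_right (h1.trans (mul_le_mul_right (mul_le_mul_left
            (add_le_add (add_le_add le_rfl (pow_le_pow_left₀ zero_le hg' 2))
              (pow_le_pow_left₀ zero_le hh' 2)) _) _)) _)
      _ = C * A * (ENNReal.ofReal δ ^ (1 / 2 : ℝ) + r ^ 2 + r ^ 2) *
          eLpNorm (fun t => g t - h t) 4 μ := by ring
      _ ≤ 1 / 2 * eLpNorm (fun t => g t - h t) 4 μ :=
          mul_le_mul_left ((mul_le_mul_left hCA _).trans hsmall) _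
      _ = _ := by simp
  have hC' : ContractingWith (1 / 2) (hmaps.restrict Φ S S) :=
    ⟨by rw [← NNReal.coe_lt_coe]; norm_num, fun g h => hcontr g g.2 h h.2⟩
  obtain ⟨g, hgS, hfix, -⟩ := hC'.exists_fixedPoint' hScl.isComplete hmaps (x := 0)
    (by simp [S]) (edist_ne_top _ _)
  refine ⟨U g, g, ⟨Lp.memLp g, ?_, hU g⟩, hU0 g, ?_⟩
  · have h1 := hUΦ g
    rwa [hfix.eq] at h1
  · rw [← Lp.enorm_def]; exact hgS

/-! ### The mass identity and the mass bound. -/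

/-- The product rule for `c` times its conjugate, both being primitives of integrable functions. -/
lemma normSq_sub_eq_integral {c G : ℝ → ℂ} {s t : ℝ} (hst : s ≤ t)
    (hG : IntervalIntegrable G volume s t) (hc : ∀ x ∈ Icc s t, c x - c s = ∫ τ in s..x, G τ) :
    ‖c t‖ ^ 2 - ‖c s‖ ^ 2 = ∫ τ in s..t, 2 * (starRingEnd ℂ (c τ) * G τ).re := by
  have hGc : IntervalIntegrable (fun τ => starRingEnd ℂ (G τ)) volume s t := by
    rw [intervalIntegrable_iff] at hG ⊢
    exact (hG.norm).mono' (Complex.continuous_conj.comp_aestronglyMeasurable hG.1)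
      (Eventually.of_forall fun x => (RCLike.norm_conj _).le)
  have hcc : ∀ x ∈ Icc s t, starRingEnd ℂ (c s) + ∫ τ in s..x, starRingEnd ℂ (G τ) =
      starRingEnd ℂ (c x) := by
    intro x hx
    rw [intervalIntegral.integral_of_le hx.1, integral_conj, ← intervalIntegral.integral_of_le hx.1,
      ← hc x hx, ← map_add, add_sub_cancel]
  have hcx : ∀ x ∈ Icc s t, c s + ∫ τ in s..x, G τ = c x := fun x hx => by
    rw [← hc x hx, add_sub_cancel]
  have h1 := mul_primitive_sub_eq_integral (c s) (starRingEnd ℂ (c s)) hG hGc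
  have ht : t ∈ Icc s t := right_mem_Icc.2 hst
  rw [hcc t ht, hcx t ht] at h1
  have h2 : ∫ x in s..t, (G x * (starRingEnd ℂ (c s) + ∫ v in s..x, starRingEnd ℂ (G v)) +
      (c s + ∫ v in s..x, G v) * starRingEnd ℂ (G x)) =
      ∫ τ in s..t, ((2 * (starRingEnd ℂ (c τ) * G τ).re : ℝ) : ℂ) := by
    refine intervalIntegral.integral_congr fun x hx => ?_
    rw [uIcc_of_le hst] at hx
    rw [hcc x hx, hcx x hx]
    have := Complex.add_conj (starRingEnd ℂ (c x) * G x)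
    rw [map_mul, Complex.conj_conj] at this
    rw [mul_comm (G x), this]
  rw [h2, intervalIntegral.integral_ofReal, Complex.mul_conj', Complex.mul_conj'] at h1
  exact_mod_cast h1

lemma integral_norm_pow_eq {g : Torus → ℂ} (hg : AEStronglyMeasurable g volume) (n : ℕ) :
    ∫ x, ‖g x‖ ^ n = (∫⁻ x, ‖g x‖ₑ ^ n).toReal := by
  have h := integral_norm_eq_lintegral_enorm (hg.norm.pow n)
  refine Eq.trans (integral_congr_ae (Eventually.of_forall fun x => ?_)) (h.trans ?_)
  · exact (Real.norm_of_nonneg (pow_nonneg (norm_nonneg _) n)).symm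
  · congr 1
    refine lintegral_congr fun x => ?_
    rw [Pi.pow_apply, enorm_pow, enorm_norm]

lemma integral_norm_pow_four (f : L4T) : ∫ x, ‖f x‖ ^ 4 = ‖f‖ ^ 4 := by
  rw [integral_norm_pow_eq (Lp.aestronglyMeasurable f), ← enorm_L4_pow_four, ENNReal.toReal_pow,
    toReal_enorm]

lemma integral_norm_sq_L4 (f : L4T) : ∫ x, ‖f x‖ ^ 2 = ‖inclL4 f‖ ^ 2 := by
  rw [integral_norm_pow_eq (Lp.aestronglyMeasurable f)]
  have h : ‖inclL4 f‖ₑ ^ 2 = ∫⁻ x, ‖f x‖ₑ ^ 2 := by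
    rw [Lp.enorm_def, eLpNorm_congr_ae (coeFn_inclL4 f),
      eLpNorm_eq_lintegral_rpow_enorm_toReal (by norm_num) (by norm_num)]
    simp only [ENNReal.toReal_ofNat, ENNReal.rpow_ofNat]
    rw [ENNReal_sqrt_sq]
  rw [← h, ENNReal.toReal_pow, toReal_enorm]

/-- The Hamiltonian part `-i|f|²f` pairs with `f` to a purely imaginary number; only gain and
damping change the mass. -/
lemma re_nonlinearity_self (ξ σ : ℝ) (f : L4T) :
    (nonlinearity ξ σ f f).re = ξ * ‖inclL4 f‖ ^ 2 - σ * ‖f‖ ^ 4 := by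
  have h2 : Integrable (fun x => ‖f x‖ ^ 2) (volume : Measure Torus) :=
    ((Lp.memLp f).mono_exponent (p := 2) (by norm_num)).integrable_norm_pow (p := 2) (by norm_num)
  have h4 : Integrable (fun x => ‖f x‖ ^ 4) (volume : Measure Torus) :=
    (Lp.memLp f).integrable_norm_pow (p := 4) (by norm_num)
  rw [nonlinearity, dualPairing_apply, ← integral_norm_pow_four, ← integral_norm_sq_L4,
    ← integral_const_mul, ← integral_const_mul, ← integral_sub (h2.const_mul _) (h4.const_mul _)]
  refine Eq.trans (integral_re (𝕜 := ℂ) (integrable_dualPairing (memLp_cubicTerm ξ σ f) f)).symm ?_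
  refine integral_congr_ae (Eventually.of_forall fun x => ?_)
  simp only [RCLike.re_eq_complex_re]
  have e : starRingEnd ℂ (f x) * cubicTerm ξ σ (f x) =
      ((ξ * ‖f x‖ ^ 2 - σ * ‖f x‖ ^ 4 : ℝ) : ℂ) + ((-‖f x‖ ^ 4 : ℝ) : ℂ) * Complex.I := by
    have h := Complex.conj_mul' (f x)
    unfold cubicTerm
    push_cast
    linear_combination ((ξ : ℂ) - (σ + Complex.I) * (‖f x‖ : ℂ) ^ 2) * h
  rw [e, Complex.add_re, Complex.ofReal_re, Complex.re_ofReal_mul, Complex.I_re, mul_zero, add_zero]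

lemma norm_inclL4_pow_four_le (f : L4T) : ‖inclL4 f‖ ^ 4 ≤ 2 * π * ‖f‖ ^ 4 := by
  have h := eLpNorm_le_eLpNorm_mul_rpow_measure_univ (p := 2) (q := 4) (by norm_num)
    (Lp.aestronglyMeasurable f)
  have h1 : ‖inclL4 f‖ₑ ≤ ‖f‖ₑ * ENNReal.ofReal (2 * π) ^ (1 / 4 : ℝ) := by
    rw [Lp.enorm_def, Lp.enorm_def, eLpNorm_congr_ae (coeFn_inclL4 f)]
    refine h.trans_eq ?_
    rw [AddCircle.measure_univ]
    norm_num
  have h2 : ‖inclL4 f‖ₑ ^ 4 ≤ ENNReal.ofReal (2 * π) * ‖f‖ₑ ^ 4 := by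
    refine (pow_le_pow_left₀ zero_le h1 4).trans_eq ?_
    rw [mul_pow, mul_comm, ← ENNReal.rpow_natCast (_ ^ (1 / 4 : ℝ)), ← ENNReal.rpow_mul]
    norm_num
  rw [← ofReal_norm, ← ofReal_norm, ← ENNReal.ofReal_pow (norm_nonneg _),
    ← ENNReal.ofReal_pow (norm_nonneg _), ← ENNReal.ofReal_mul (by positivity),
    ENNReal.ofReal_le_ofReal_iff (by positivity)] at h2
  exact h2

lemma tendsto_Icc_neg_atTop :
    Tendsto (fun n : ℕ => Finset.Icc (-(n : ℤ)) n) atTop atTop := by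
  refine tendsto_atTop_finset_of_monotone
    (fun m n hmn => Finset.Icc_subset_Icc (by omega) (by omega)) fun k => ⟨k.natAbs, ?_⟩
  simp only [Finset.mem_Icc]; omega

section
variable {ξ σ a c : ℝ} {u : ℝ → L2T} {f : ℝ → L4T}

lemma IsL4Solution.intervalIntegrable_mass (h : IsL4Solution ξ σ a c u f) {s t : ℝ}
    (hs : s ∈ Icc a c) (ht : t ∈ Icc a c) :
    IntervalIntegrable (fun τ => ξ * ‖u τ‖ ^ 2 - σ * ‖f τ‖ ^ 4) volume s t := by
  have h4 : IntervalIntegrable (fun τ => ‖f τ‖ ^ 4) volume s t := by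
    rw [intervalIntegrable_iff]
    exact (h.memLp.mono_measure (Measure.restrict_mono (uIoc_subset_Icc_of_mem hs ht)
      le_rfl)).integrable_norm_pow (p := 4) (by norm_num)
  have h2 : IntervalIntegrable (fun τ => ‖u τ‖ ^ 2) volume s t :=
    ((h.continuousOn.mono (uIcc_subset_Icc hs ht)).norm.pow 2).intervalIntegrable
  exact (h2.const_mul _).sub (h4.const_mul _)

/-- The mass identity. -/
theorem IsL4Solution.sq_norm_sub_eq {b : ℝ} (hb : 1 / 2 < b) (hb' : b < 5 / 8)
    (h : IsL4Solution ξ σ a c u f) {s t : ℝ} (hs : s ∈ Icc a c) (ht : t ∈ Icc a c) (hst : s ≤ t) :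
    ‖u t‖ ^ 2 - ‖u s‖ ^ 2 = ∫ τ in s..t, 2 * (ξ * ‖u τ‖ ^ 2 - σ * ‖f τ‖ ^ 4) := by
  have hπ := Real.pi_pos
  have hsub : Icc s t ⊆ Icc a c := Icc_subset_Icc hs.1 ht.2
  have h' := h.mono hsub
  have hss : s ∈ Icc s t := left_mem_Icc.2 hst
  have htt : t ∈ Icc s t := right_mem_Icc.2 hst
  set F : ℝ → DualL4T := fun τ => nonlinearity ξ σ (f τ)
  have hF : MemLp F (4 / 3) (volume.restrict (Icc s t)) := h'.memLp_nonlinearity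
  obtain ⟨C, -, hlin⟩ := exists_linear_estimate hb hb' (t - s + 1) (by linarith)
  -- Invoked for the `L⁴` convergence of the partial sums of `u`. The identity holds mode by mode;
  -- summed over `|k| ≤ n` it pairs the `L^{4/3}` forcing with the partial sum, so that the limit
  -- can be taken.
  obtain ⟨f', hf', hfu, -, -, hlim⟩ := hlin s t hst (by linarith) F hF u h'.duhamel s hss
  have hff' : f' =ᵐ[volume.restrict (Icc s t)] f := by
    filter_upwards [hfu, h'.ae_eq] with τ h1 h2
    exact inclL4_injective (h1.trans h2.symm)
  set p : ℕ → ℝ → L4T := fun n τ => partialSum n fun k => coeffL2 k (u τ)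
  have hlim' : Tendsto (fun n => eLpNorm (fun τ => p n τ - f τ) 4 (volume.restrict (Icc s t)))
      atTop (𝓝 0) := by
    refine hlim.congr fun n => ?_
    rw [← eLpNorm_neg]
    refine eLpNorm_congr_ae ?_
    filter_upwards [hff'] with τ h1
    simp only [Pi.neg_apply, h1, neg_sub, p]
  set d : ℤ → ℝ → ℂ := fun k τ => coeffL2 k (freeFlow (-τ) (u τ))
  have hdc : ∀ k, ContinuousOn (d k) (Icc s t) := fun k =>
    (coeffL2 k).continuous.comp_continuousOn (h'.duhamel.continuousOn_freeFlow_neg hF)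
  have hG : ∀ k, IntervalIntegrable (forcingCoeff F k) volume s t := fun k =>
    intervalIntegrable_forcingCoeff hF hss htt k
  have hdG : ∀ k, IntervalIntegrable (fun τ => starRingEnd ℂ (d k τ) * forcingCoeff F k τ)
      volume s t := fun k => (hG k).continuousOn_mul (by
    rw [uIcc_of_le hst]
    exact Complex.continuous_conj.comp_continuousOn (hdc k))
  have hk : ∀ k, ‖coeffL2 k (u t)‖ ^ 2 - ‖coeffL2 k (u s)‖ ^ 2 =
      ∫ τ in s..t, 2 * (starRingEnd ℂ (d k τ) * forcingCoeff F k τ).re := by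
    intro k
    have hnd : ∀ τ, ‖coeffL2 k (u τ)‖ = ‖d k τ‖ := fun τ => by
      simp only [d, coeffL2_freeFlow, norm_mul, norm_schrodingerPhase, one_mul]
    rw [hnd, hnd]
    refine normSq_sub_eq_integral hst (hG k) fun x hx => ?_
    simp only [d]
    rw [← map_sub]
    exact h'.duhamel s hss x hx k
  have hp : ∀ n τ, p n τ = trigPoly (Finset.Icc (-(n : ℤ)) n) fun k =>
      schrodingerPhase k τ * d k τ := by
    intro n τ
    simp only [p, partialSum, d, ← coeffL2_freeFlow, freeFlow_freeFlow_neg]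
  have hFp : ∀ n τ, 2 * (F τ (p n τ)).re = (2 * π)⁻¹ * ∑ k ∈ Finset.Icc (-(n : ℤ)) n,
      2 * (starRingEnd ℂ (d k τ) * forcingCoeff F k τ).re := by
    intro n τ
    rw [hp, apply_trigPoly_phase, show (2 * π : ℂ)⁻¹ = (((2 * π)⁻¹ : ℝ) : ℂ) by push_cast; rfl,
      Complex.re_ofReal_mul, Complex.re_sum, ← Finset.mul_sum]
    simp only [forcingCoeff]
    ring
  have hi : ∀ k, IntervalIntegrable
      (fun τ => 2 * (starRingEnd ℂ (d k τ) * forcingCoeff F k τ).re) volume s t := fun k => by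
    have h1 := hdG k
    rw [intervalIntegrable_iff] at h1 ⊢
    exact (Integrable.re h1).const_mul 2
  have hn : ∀ n : ℕ, (2 * π)⁻¹ * ((∑ k ∈ Finset.Icc (-(n : ℤ)) n, ‖coeffL2 k (u t)‖ ^ 2) -
      ∑ k ∈ Finset.Icc (-(n : ℤ)) n, ‖coeffL2 k (u s)‖ ^ 2) =
      ∫ τ in Ioc s t, 2 * (F τ (p n τ)).re := by
    intro n
    simp_rw [hFp]
    rw [← intervalIntegral.integral_of_le hst, intervalIntegral.integral_const_mul,
      intervalIntegral.integral_finsetSum fun k _ => hi k, ← Finset.sum_sub_distrib]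
    simp_rw [hk]
  have hint : ∀ n, Integrable (fun τ => 2 * (F τ (p n τ)).re) (volume.restrict (Ioc s t)) := by
    intro n
    simp_rw [hFp]
    refine Integrable.const_mul (integrable_finsetSum _ fun k _ => ?_) _
    have h1 := hi k
    rwa [intervalIntegrable_iff, uIoc_of_le hst] at h1
  have hL : Tendsto (fun n : ℕ => (2 * π)⁻¹ * ((∑ k ∈ Finset.Icc (-(n : ℤ)) n, ‖coeffL2 k (u t)‖ ^ 2) -
      ∑ k ∈ Finset.Icc (-(n : ℤ)) n, ‖coeffL2 k (u s)‖ ^ 2)) atTop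
      (𝓝 ((2 * π)⁻¹ * (2 * π * ‖u t‖ ^ 2 - 2 * π * ‖u s‖ ^ 2))) :=
    Tendsto.const_mul _ (((hasSum_sq_coeffL2 (u t)).comp tendsto_Icc_neg_atTop).sub
      ((hasSum_sq_coeffL2 (u s)).comp tendsto_Icc_neg_atTop))
  set q : ℝ → ℝ := fun τ => 2 * (ξ * ‖u τ‖ ^ 2 - σ * ‖f τ‖ ^ 4)
  have hq : IntervalIntegrable q volume s t := (h'.intervalIntegrable_mass hss htt).const_mul 2
  have hq' : Integrable q (volume.restrict (Ioc s t)) := by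
    rwa [intervalIntegrable_iff, uIoc_of_le hst] at hq
  have hIoc : Ioc s t ⊆ Icc s t := Ioc_subset_Icc_self
  have hR : Tendsto (fun n => ∫ τ in Ioc s t, 2 * (F τ (p n τ)).re) atTop
      (𝓝 (∫ τ in Ioc s t, q τ)) := by
    refine tendsto_integral_of_L1' q hq'.1 (Eventually.of_forall hint) ?_
    -- By Hölder in time the error is at most twice this product of the `L^{4/3}` norm of the
    -- forcing and the `L⁴` error of the partial sums.
    have h1 : Tendsto (fun n => 2 * (eLpNorm F (4 / 3) (volume.restrict (Icc s t)) *
        eLpNorm (fun τ => p n τ - f τ) 4 (volume.restrict (Icc s t)))) atTop (𝓝 0) := by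
      have h2 := ENNReal.Tendsto.const_mul hlim' (Or.inr hF.2.ne)
      rw [mul_zero] at h2
      have h3 := ENNReal.Tendsto.const_mul (a := 2) h2 (Or.inr (by simp))
      rwa [mul_zero] at h3
    refine tendsto_of_tendsto_of_tendsto_of_le_of_le tendsto_const_nhds h1 (fun _ => zero_le)
      fun n => ?_
    have hpm : AEStronglyMeasurable (p n) (volume.restrict (Icc s t)) := by
      have h2 : ContinuousOn (p n) (Icc s t) := by
        simp only [p, partialSum, trigPoly]
        refine continuousOn_finsetSum _ fun k _ => ?_
        exact ((continuousOn_const.mul ((coeffL2 k).continuous.comp_continuousOn h'.continuousOn))).smul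
          continuousOn_const
      exact h2.aestronglyMeasurable measurableSet_Icc
    have hpair := lintegral_pairing_le hF.1 (hpm.sub h'.memLp.1)
    rw [eLpNorm_one_eq_lintegral_enorm]
    calc _ ≤ ∫⁻ τ in Ioc s t, 2 * ‖F τ ((p n - f) τ)‖ₑ := by
          refine lintegral_mono_ae ?_
          filter_upwards [ae_restrict_of_ae_restrict_of_subset hIoc h'.ae_eq] with τ h2
          have h3 : ((fun τ => 2 * (F τ (p n τ)).re) - q) τ = 2 * (F τ ((p n - f) τ)).re := by
            simp only [Pi.sub_apply, q, map_sub, Complex.sub_re]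
            rw [← h2, ← re_nonlinearity_self]
            ring
          rw [h3, enorm_mul]
          refine mul_le_mul' ?_ ?_
          · rw [← ofReal_norm]; norm_num
          · rw [← ofReal_norm, ← ofReal_norm]
            exact ENNReal.ofReal_le_ofReal (Complex.abs_re_le_norm _)
      _ = 2 * ∫⁻ τ in Ioc s t, ‖F τ ((p n - f) τ)‖ₑ := lintegral_const_mul' _ _ (by simp)
      _ ≤ 2 * ∫⁻ τ in Icc s t, ‖F τ ((p n - f) τ)‖ₑ :=
          mul_le_mul_right (lintegral_mono_set hIoc) _
      _ ≤ _ := mul_le_mul_right hpair _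
  have hfinal := tendsto_nhds_unique (hL.congr hn) hR
  rw [intervalIntegral.integral_of_le hst, ← hfinal]
  field_simp

/-- Hölder bounds `‖f‖⁴` below by `y²/(2π)`, where `y` is the mass, and completing the square in `y`
gives a linear rate. The leftover `4πξ²/σ` shows that half of the stated level would suffice. -/
lemma mass_rate_le {ξ σ : ℝ} (hσ : 0 < σ) (f : L4T) :
    2 * (ξ * ‖inclL4 f‖ ^ 2 - σ * ‖f‖ ^ 4) ≤
      -2 * ξ * ‖inclL4 f‖ ^ 2 + 2 * ξ * (2 * ξ / σ * (2 * π)) := by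
  have hπ := Real.pi_pos
  have h := norm_inclL4_pow_four_le f
  have h1 : ‖inclL4 f‖ ^ 4 / (2 * π) ≤ ‖f‖ ^ 4 := by
    rw [div_le_iff₀ (by positivity)]; linarith
  set y := ‖inclL4 f‖ ^ 2
  have hy : ‖inclL4 f‖ ^ 4 = y ^ 2 := by simp only [y]; ring
  rw [hy] at h1
  have h2 : σ * (y ^ 2 / (2 * π)) ≤ σ * ‖f‖ ^ 4 := mul_le_mul_of_nonneg_left h1 hσ.le
  have h3 : 0 ≤ (σ / π) * (y - 2 * π * ξ / σ) ^ 2 + 4 * π * ξ ^ 2 / σ := by positivity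
  have e : (σ / π) * (y - 2 * π * ξ / σ) ^ 2 + 4 * π * ξ ^ 2 / σ =
      2 * ξ * (2 * ξ / σ * (2 * π)) - 4 * ξ * y + 2 * (σ * (y ^ 2 / (2 * π))) := by
    field_simp
    ring
  linarith

/-- As `y` is only continuous, the integral inequality is first turned into a bound for its right
lower Dini derivative, which is what the differential form of Gronwall's inequality asks for. -/
lemma gronwall_of_integral_le {y : ℝ → ℝ} {a c κ K : ℝ} (hκ : κ ≠ 0)
    (hy : ContinuousOn y (Icc a c))
    (h : ∀ s ∈ Icc a c, ∀ t ∈ Icc a c, s ≤ t → y t - y s ≤ ∫ τ in s..t, (-κ * y τ + κ * K)) :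
    ∀ t ∈ Icc a c, y t ≤ y a * Real.exp (-κ * (t - a)) + K * (1 - Real.exp (-κ * (t - a))) := by
  intro t ht
  have key := le_gronwallBound_of_liminf_deriv_right_le (f := y) (f' := fun x => -κ * y x + κ * K)
    (δ := y a) (K := -κ) (ε := κ * K) (a := a) (b := c) hy ?_ le_rfl (fun x _ => le_rfl) t ht
  · rw [gronwallBound_of_K_ne_0 (neg_ne_zero.2 hκ)] at key
    refine key.trans_eq ?_
    field_simp
    ring
  · intro x hx r hr
    refine Eventually.frequently ?_
    set g : ℝ → ℝ := fun x => -κ * y x + κ * K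
    -- The intermediate `r'` makes the final inequality strict: the integrand stays below `r'` near
    -- `x`, hence so does the difference quotient, up to equality.
    obtain ⟨r', hr1, hr2⟩ := exists_between hr
    have hg : ContinuousOn g (Icc a c) := (hy.const_smul (-κ)).add continuousOn_const
    have h1 : ∀ᶠ z in 𝓝[Icc a c] x, g z < r' :=
      (hg x ⟨hx.1, hx.2.le⟩).eventually (Iio_mem_nhds hr1)
    have h2 : ∀ᶠ z in 𝓝[≥] x, g z < r' := by
      rw [← nhdsWithin_Icc_eq_nhdsGE hx.2]
      exact nhdsWithin_mono _ (Icc_subset_Icc hx.1 le_rfl) h1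
    obtain ⟨z₀, hz₀, hz⟩ := (mem_nhdsGE_iff_exists_Ico_subset' hx.2).1 h2
    have h3 : ∀ᶠ z in 𝓝[>] x, z ∈ Ioo x (min z₀ c) :=
      Ioo_mem_nhdsGT (lt_min hz₀ hx.2)
    filter_upwards [h3] with z hz1
    have hzc : z ∈ Icc a c := ⟨hx.1.trans hz1.1.le, hz1.2.le.trans (min_le_right _ _)⟩
    have hxc : x ∈ Icc a c := ⟨hx.1, hx.2.le⟩
    have h4 := h x hxc z hzc hz1.1.le
    have h5 : ∫ τ in x..z, g τ ≤ ∫ _ in x..z, r' := by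
      refine intervalIntegral.integral_mono_on hz1.1.le
        (hg.mono (uIcc_subset_Icc hxc hzc)).intervalIntegrable (by simp) fun τ hτ => ?_
      exact le_of_lt (hz ⟨hτ.1, hτ.2.trans_lt (hz1.2.trans_le (min_le_left _ _))⟩)
    rw [intervalIntegral.integral_const, smul_eq_mul] at h5
    have hzx : 0 < z - x := sub_pos.2 hz1.1
    rw [inv_mul_lt_iff₀ hzx]
    calc y z - y x ≤ (z - x) * r' := h4.trans h5
      _ < (z - x) * r := mul_lt_mul_of_pos_left hr2 hzx

/-- The bound on the mass of a solution. -/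
theorem IsL4Solution.sq_norm_le {b : ℝ} (hb : 1 / 2 < b) (hb' : b < 5 / 8) (hξ : 0 < ξ) (hσ : 0 < σ)
    (h : IsL4Solution ξ σ a c u f) {t : ℝ} (ht : t ∈ Icc a c) :
    ‖u t‖ ^ 2 ≤ ‖u a‖ ^ 2 * Real.exp (-2 * ξ * (t - a)) +
      2 * ξ / σ * (2 * π) * (1 - Real.exp (-2 * ξ * (t - a))) := by
  have key := gronwall_of_integral_le (y := fun t => ‖u t‖ ^ 2) (a := a) (c := c) (κ := 2 * ξ)
    (K := 2 * ξ / σ * (2 * π)) (by positivity) (h.continuousOn.norm.pow 2) ?_ t ht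
  · rw [show -2 * ξ = -(2 * ξ) by ring]
    exact key
  · intro s hs t ht hst
    rw [h.sq_norm_sub_eq hb hb' hs ht hst]
    have hi : IntervalIntegrable (fun τ => -(2 * ξ) * ‖u τ‖ ^ 2 + 2 * ξ * (2 * ξ / σ * (2 * π)))
        volume s t := by
      refine IntervalIntegrable.add (IntervalIntegrable.const_mul ?_ _) (by simp)
      exact ((h.continuousOn.mono (uIcc_subset_Icc hs ht)).norm.pow 2).intervalIntegrable
    refine intervalIntegral.integral_mono_ae_restrict hst
      ((h.intervalIntegrable_mass hs ht).const_mul 2) hi ?_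
    filter_upwards [ae_restrict_of_ae_restrict_of_subset (Icc_subset_Icc hs.1 ht.2) h.ae_eq]
      with τ h1
    rw [← h1]
    have := mass_rate_le (ξ := ξ) hσ (f τ)
    linarith

end

/-! ### Gluing and global existence. -/

section
variable {ξ σ a c : ℝ} {u v : ℝ → L2T} {f g : ℝ → L4T}

/-- Balls of radius at least `(2ξ|𝕋|/σ)^{1/2}` are invariant. -/
lemma IsL4Solution.norm_le {b : ℝ} (hb : 1 / 2 < b) (hb' : b < 5 / 8) (hξ : 0 < ξ) (hσ : 0 < σ)
    (h : IsL4Solution ξ σ a c u f) {M : ℝ} (hM : 0 ≤ M) (hKM : 2 * ξ / σ * (2 * π) ≤ M ^ 2)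
    (hu : ‖u a‖ ≤ M) {t : ℝ} (ht : t ∈ Icc a c) : ‖u t‖ ≤ M := by
  have h1 := h.sq_norm_le hb hb' hξ hσ ht
  have h2 : Real.exp (-2 * ξ * (t - a)) ≤ 1 := by
    rw [Real.exp_le_one_iff]
    have := mul_nonneg hξ.le (sub_nonneg.2 ht.1)
    linarith
  have h3 := Real.exp_pos (-2 * ξ * (t - a))
  have h4 : ‖u a‖ ^ 2 ≤ M ^ 2 := pow_le_pow_left₀ (norm_nonneg _) hu 2
  have h5 : ‖u t‖ ^ 2 ≤ M ^ 2 := by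
    have h6 := mul_le_mul_of_nonneg_right h4 h3.le
    have h7 := mul_le_mul_of_nonneg_right hKM (sub_nonneg.2 h2)
    linarith
  exact (pow_le_pow_iff_left₀ (norm_nonneg _) hM two_ne_zero).1 h5

lemma IsDuhamel.congr {J : Set ℝ} {F : ℝ → DualL4T} (h : IsDuhamel J F u) (huv : EqOn u v J) :
    IsDuhamel J F v := fun s hs t ht k => by
  rw [← huv hs, ← huv ht]
  exact h s hs t ht k

lemma IsL4Solution.congr (h : IsL4Solution ξ σ a c u f) (huv : EqOn u v (Icc a c)) :
    IsL4Solution ξ σ a c v f := by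
  refine ⟨h.memLp, ?_, h.duhamel.congr huv⟩
  filter_upwards [h.ae_eq, ae_restrict_mem measurableSet_Icc] with t h1 h2
  rw [h1, huv h2]

lemma isDuhamel_of_base {m : ℝ} {F : ℝ → DualL4T}
    (hF : MemLp F (4 / 3) (volume.restrict (Icc a c))) (hm : m ∈ Icc a c)
    (h : ∀ t ∈ Icc a c, ∀ k,
      coeffL2 k (freeFlow (-t) (u t) - freeFlow (-m) (u m)) = ∫ τ in m..t, forcingCoeff F k τ) :
    IsDuhamel (Icc a c) F u := by
  intro s hs t ht k
  rw [← sub_sub_sub_cancel_right _ _ (freeFlow (-m) (u m)), map_sub, h t ht, h s hs]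
  exact intervalIntegral.integral_interval_sub_left
    (intervalIntegrable_forcingCoeff hF hm ht k) (intervalIntegrable_forcingCoeff hF hm hs k)

open Classical in
/-- Solutions on adjacent intervals can be glued. -/
lemma IsL4Solution.glue {m : ℝ} (ham : a ≤ m) (hmc : m ≤ c) (hu : IsL4Solution ξ σ a m u f)
    (hv : IsL4Solution ξ σ m c v g) (huv : u m = v m) :
    IsL4Solution ξ σ a c ((Iic m).piecewise u v) ((Iic m).piecewise f g) := by
  have hm : m ∈ Icc a c := ⟨ham, hmc⟩
  have hsub1 : Icc a c ∩ Iic m ⊆ Icc a m := fun x hx => ⟨hx.1.1, hx.2⟩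
  have hsub2 : Icc a c ∩ (Iic m)ᶜ ⊆ Icc m c := fun x hx =>
    ⟨(not_le.1 (show ¬x ≤ m from hx.2)).le, hx.1.2⟩
  have hmem : MemLp ((Iic m).piecewise f g) 4 (volume.restrict (Icc a c)) := by
    refine MemLp.piecewise measurableSet_Iic ?_ ?_
    · rw [Measure.restrict_restrict measurableSet_Iic, inter_comm]
      exact hu.memLp.mono_measure (Measure.restrict_mono hsub1 le_rfl)
    · rw [Measure.restrict_restrict measurableSet_Iic.compl, inter_comm]
      exact hv.memLp.mono_measure (Measure.restrict_mono hsub2 le_rfl)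
  have := isFiniteMeasure_restrict_Icc a c
  refine ⟨hmem, ?_, isDuhamel_of_base (_root_.memLp_nonlinearity ξ σ hmem) hm fun t ht k => ?_⟩
  · have h1 := hu.ae_eq
    have h2 := hv.ae_eq
    rw [ae_restrict_iff' measurableSet_Icc] at h1 h2 ⊢
    filter_upwards [h1, h2] with t h1 h2 ht
    by_cases h : t ∈ Iic m
    · rw [piecewise_eq_of_mem _ _ _ h, piecewise_eq_of_mem _ _ _ h]
      exact h1 ⟨ht.1, h⟩
    · rw [piecewise_eq_of_notMem _ _ _ h, piecewise_eq_of_notMem _ _ _ h]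
      exact h2 ⟨(lt_of_not_ge h).le, ht.2⟩
  -- Duhamel's formula is checked from the junction `m`, which belongs to the left branch; from
  -- there each time lies within a single piece.
  · rw [piecewise_eq_of_mem _ _ _ (mem_Iic.2 le_rfl)]
    by_cases h : t ∈ Iic m
    · rw [piecewise_eq_of_mem _ _ _ h,
        hu.duhamel m (right_mem_Icc.2 ham) t ⟨ht.1, h⟩ k]
      refine intervalIntegral.integral_congr fun τ hτ => ?_
      rw [uIcc_of_ge h] at hτ
      simp only [forcingCoeff]
      rw [piecewise_eq_of_mem _ _ _ (mem_Iic.2 hτ.2)]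
    · have h' : m < t := lt_of_not_ge h
      rw [piecewise_eq_of_notMem _ _ _ h, huv,
        hv.duhamel m (left_mem_Icc.2 hmc) t ⟨h'.le, ht.2⟩ k]
      refine intervalIntegral.integral_congr_ae (Eventually.of_forall fun τ hτ => ?_)
      rw [uIoc_of_le h'.le] at hτ
      simp only [forcingCoeff]
      rw [piecewise_eq_of_notMem _ _ _ (show τ ∉ Iic m from not_le.2 hτ.1)]

/-- Global existence forward in time. -/
theorem exists_global_solution {b : ℝ} (hb : 1 / 2 < b) (hb' : b < 5 / 8) (hξ : 0 < ξ) (hσ : 0 < σ)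
    (a : ℝ) (u₀ : L2T) :
    ∃ u : ℝ → L2T, u a = u₀ ∧ ∀ T, ∃ f, IsL4Solution ξ σ a T u f := by
  classical
  set K := 2 * ξ / σ * (2 * π)
  have hK : 0 ≤ K := by positivity
  -- This `M` bounds the data and satisfies `K ≤ M²`, so its ball is invariant and every iteration
  -- can use the same step `δ`.
  set M := ‖u₀‖ + K + 1
  have hM : 0 ≤ M := by positivity
  have hKM : K ≤ M ^ 2 := by
    have : K + 1 ≤ M := by linarith [norm_nonneg u₀]
    nlinarith
  have henorm : ∀ x : L2T, ‖x‖ ≤ M → ‖x‖ₑ ≤ ENNReal.ofReal M := fun x hx => by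
    rw [← ofReal_norm]; exact ENNReal.ofReal_le_ofReal hx
  obtain ⟨δ, hδ, -, r, -, -, hloc⟩ := exists_local_solution hb hb' ξ σ
    (M := ENNReal.ofReal M) (C₀ := 0) (by simp) (by simp)
  have hex : ∀ n : ℕ, ∃ (u : ℝ → L2T) (f : ℝ → L4T), u a = u₀ ∧
      IsL4Solution ξ σ a (a + (n + 1) * δ) u f := by
    intro n
    induction n with
    | zero =>
      obtain ⟨u, f, hu, hu0, -⟩ := hloc a u₀ (henorm _ (by linarith))
      exact ⟨u, f, hu0, by simpa using hu⟩
    | succ n ih =>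
      obtain ⟨u, f, hu0, hu⟩ := ih
      have hm : a ≤ a + (n + 1) * δ := by
        have : 0 ≤ ((n : ℝ) + 1) * δ := by positivity
        linarith
      have h1 := hu.norm_le hb hb' hξ hσ hM hKM (by rw [hu0]; linarith) (right_mem_Icc.2 hm)
      obtain ⟨v, g, hv, hv0, -⟩ := hloc (a + (n + 1) * δ) (u (a + (n + 1) * δ)) (henorm _ h1)
      have h2 := hu.glue hm (by linarith) hv hv0.symm
      have e : a + (n + 1) * δ + δ = a + (((n + 1 : ℕ) : ℝ) + 1) * δ := by push_cast; ring
      rw [e] at h2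
      exact ⟨_, _, by rw [piecewise_eq_of_mem _ _ _ (mem_Iic.2 hm), hu0], h2⟩
  choose w f hw0 hw using hex
  have hpos : ∀ n : ℕ, a ≤ a + ((n : ℝ) + 1) * δ := fun n => by
    have : 0 ≤ ((n : ℝ) + 1) * δ := by positivity
    linarith
  have heq : ∀ (m n : ℕ) (t : ℝ), t ∈ Icc a (a + ((m : ℝ) + 1) * δ) → t ∈ Icc a (a + ((n : ℝ) + 1) * δ) →
      w m t = w n t := by
    intro m n t hm hn
    have h1 := (hw m).mono (Icc_subset_Icc le_rfl hm.2)
    have h2 := (hw n).mono (Icc_subset_Icc le_rfl hn.2)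
    exact h1.eqOn hb hb' h2 (left_mem_Icc.2 hm.1) ((hw0 m).trans (hw0 n).symm) (right_mem_Icc.2 hm.1)
  have hcov : ∀ t : ℝ, t ≤ a + ((⌈(t - a) / δ⌉₊ : ℝ) + 1) * δ := by
    intro t
    have h1 := (div_le_iff₀ hδ).1 (Nat.le_ceil ((t - a) / δ))
    linarith
  -- The `n`-th iterate lives up to `a + (n + 1)δ`, so this index covers `t` with a step to spare;
  -- by uniqueness the choice of the iterate does not matter.
  refine ⟨fun t => w ⌈(t - a) / δ⌉₊ t, hw0 _, fun T => ?_⟩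
  refine ⟨f ⌈(T - a) / δ⌉₊, ((hw _).mono (Icc_subset_Icc le_rfl (hcov T))).congr fun t ht => ?_⟩
  exact heq _ _ t ⟨ht.1, ht.2.trans (hcov T)⟩ ⟨ht.1, hcov t⟩

lemma eLpNorm_four_Icc_le {E : Type*} [NormedAddCommGroup E] (f : ℝ → E) (a m c : ℝ) :
    eLpNorm f 4 (volume.restrict (Icc a c)) ≤ eLpNorm f 4 (volume.restrict (Icc a m)) +
      eLpNorm f 4 (volume.restrict (Icc m c)) := by
  rw [eLpNorm_four_eq, eLpNorm_four_eq, eLpNorm_four_eq]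
  have hsub : Icc a c ⊆ Icc a m ∪ Icc m c := fun x hx =>
    (le_total x m).imp (fun h => ⟨hx.1, h⟩) fun h => ⟨h, hx.2⟩
  calc _ ≤ ((∫⁻ t in Icc a m, ‖f t‖ₑ ^ 4) + ∫⁻ t in Icc m c, ‖f t‖ₑ ^ 4) ^ (1 / 4 : ℝ) :=
        ENNReal.rpow_le_rpow ((lintegral_mono_set hsub).trans (lintegral_union_le _ _ _))
          (by norm_num)
    _ ≤ _ := ENNReal.rpow_add_le_add_rpow _ _ (by norm_num) (by norm_num)

/-! ### Lipschitz dependence on the data. -/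

/-- Lipschitz dependence on the data on short time intervals. -/
lemma exists_local_lipschitz {b : ℝ} (hb : 1 / 2 < b) (hb' : b < 5 / 8) (ξ σ M : ℝ) :
    ∃ δ : ℝ, 0 < δ ∧ ∃ C : ℝ≥0∞, C ≠ ∞ ∧ ∀ (t₀ : ℝ) (u v : ℝ → L2T) (f g : ℝ → L4T),
      IsL4Solution ξ σ t₀ (t₀ + δ) u f → IsL4Solution ξ σ t₀ (t₀ + δ) v g →
      ‖u t₀‖ ≤ M → ‖v t₀‖ ≤ M →
      eLpNorm f 4 (volume.restrict (Icc t₀ (t₀ + δ))) ≤ C ∧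
      eLpNorm g 4 (volume.restrict (Icc t₀ (t₀ + δ))) ≤ C ∧
      eLpNorm (fun t => f t - g t) 4 (volume.restrict (Icc t₀ (t₀ + δ))) ≤ C * ‖u t₀ - v t₀‖ₑ ∧
      ∀ t ∈ Icc t₀ (t₀ + δ), ‖u t - v t‖ₑ ≤ C * ‖u t₀ - v t₀‖ₑ := by
  obtain ⟨C, hC, hlip⟩ := exists_lipschitz_of_small hb hb' ξ σ 1 one_pos
  -- The constant `C` of the Lipschitz estimate is passed as the smallness parameter, so that
  -- solutions of `L⁴` norm at most `r` meet its hypothesis.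
  obtain ⟨δ, hδ, hδ1, r, hr, hsmall, hloc⟩ := exists_local_solution hb hb' ξ σ
    (M := ENNReal.ofReal M) ENNReal.ofReal_ne_top hC
  have hle : ∀ (t₀ : ℝ) (u : ℝ → L2T) (f : ℝ → L4T), IsL4Solution ξ σ t₀ (t₀ + δ) u f →
      ‖u t₀‖ ≤ M → eLpNorm f 4 (volume.restrict (Icc t₀ (t₀ + δ))) ≤ r := by
    intro t₀ u f hu hM
    have ht₀ : t₀ ∈ Icc t₀ (t₀ + δ) := left_mem_Icc.2 (by linarith)
    obtain ⟨w, h, hw, hw0, hh⟩ := hloc t₀ (u t₀) (by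
      rw [← ofReal_norm]; exact ENNReal.ofReal_le_ofReal hM)
    -- By uniqueness an arbitrary solution is the constructed one and inherits its `L⁴` bound.
    have heq := hu.eqOn hb hb' hw ht₀ hw0.symm
    refine (eLpNorm_congr_ae ?_).trans_le hh
    filter_upwards [hu.ae_eq, hw.ae_eq, ae_restrict_mem measurableSet_Icc] with t h1 h2 h3
    exact inclL4_injective (by rw [h1, h2, heq h3])
  refine ⟨δ, hδ, r + 2 * C, by finiteness, fun t₀ u v f g hu hv hMu hMv => ?_⟩
  have hf := hle t₀ u f hu hMu
  have hg := hle t₀ v g hv hMv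
  obtain ⟨h1, h2⟩ := hlip t₀ (t₀ + δ) (by linarith) (by linarith) u v f g hu hv t₀
    (left_mem_Icc.2 (by linarith)) (by
      rw [add_sub_cancel_left]
      refine le_trans (mul_le_mul_right (add_le_add (add_le_add le_rfl ?_) ?_) _) hsmall
      · exact pow_le_pow_left₀ zero_le hf 2
      · exact pow_le_pow_left₀ zero_le hg 2)
  have h3 : 2 * C * ‖u t₀ - v t₀‖ₑ ≤ (r + 2 * C) * ‖u t₀ - v t₀‖ₑ := mul_le_mul_left le_add_self _
  exact ⟨hf.trans le_self_add, hg.trans le_self_add, h1.trans h3, fun t ht => (h2 t ht).trans h3⟩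

/-- Lipschitz dependence on the data on bounded time intervals. -/
lemma exists_global_lipschitz {b : ℝ} (hb : 1 / 2 < b) (hb' : b < 5 / 8) (hξ : 0 < ξ) (hσ : 0 < σ)
    {M : ℝ} (hM : 0 ≤ M) (hKM : 2 * ξ / σ * (2 * π) ≤ M ^ 2) (T : ℝ) :
    ∃ T' ≥ T, 0 ≤ T' ∧ ∃ C : ℝ≥0∞, C ≠ ∞ ∧ ∀ (u v : ℝ → L2T) (f g : ℝ → L4T),
      IsL4Solution ξ σ 0 T' u f → IsL4Solution ξ σ 0 T' v g → ‖u 0‖ ≤ M → ‖v 0‖ ≤ M →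
      restrictedNorm b (Icc 0 T') (fun t => u t - v t) ≤ C * ‖u 0 - v 0‖ₑ ∧
      ∀ t ∈ Icc 0 T', ‖u t - v t‖ₑ ≤ C * ‖u 0 - v 0‖ₑ := by
  obtain ⟨δ, hδ, C, hC, hloc⟩ := exists_local_lipschitz hb hb' ξ σ M
  -- The invariance of the ball of radius `M` lets the same `δ` and `C` serve at every step.
  have hind : ∀ n : ℕ, ∃ D : ℝ≥0∞, D ≠ ∞ ∧ ∀ (u v : ℝ → L2T) (f g : ℝ → L4T),
      IsL4Solution ξ σ 0 (n * δ) u f → IsL4Solution ξ σ 0 (n * δ) v g → ‖u 0‖ ≤ M → ‖v 0‖ ≤ M →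
      eLpNorm f 4 (volume.restrict (Icc 0 (n * δ))) ≤ D ∧
      eLpNorm g 4 (volume.restrict (Icc 0 (n * δ))) ≤ D ∧
      eLpNorm (fun t => f t - g t) 4 (volume.restrict (Icc 0 (n * δ))) ≤ D * ‖u 0 - v 0‖ₑ ∧
      ∀ t ∈ Icc 0 (n * δ), ‖u t - v t‖ₑ ≤ D * ‖u 0 - v 0‖ₑ := by
    intro n
    induction n with
    | zero =>
      refine ⟨1, by simp, fun u v f g _ _ _ _ => ?_⟩
      have h0 : volume.restrict (Icc (0 : ℝ) ((0 : ℕ) * δ)) = 0 := by simp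
      rw [h0]
      refine ⟨by simp, by simp, by simp, fun t ht => ?_⟩
      have : t = 0 := by simpa using ht
      rw [this, one_mul]
    | succ n ih =>
      obtain ⟨D, hD, ih⟩ := ih
      refine ⟨D + C + C * D, by finiteness, fun u v f g hu hv hMu hMv => ?_⟩
      have e : ((n + 1 : ℕ) : ℝ) * δ = n * δ + δ := by push_cast; ring
      rw [e] at hu hv ⊢
      have hn : 0 ≤ n * δ := by positivity
      have hu1 := hu.mono (Icc_subset_Icc le_rfl (by linarith : n * δ ≤ n * δ + δ))
      have hv1 := hv.mono (Icc_subset_Icc le_rfl (by linarith : n * δ ≤ n * δ + δ))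
      have hu2 := hu.mono (Icc_subset_Icc hn le_rfl)
      have hv2 := hv.mono (Icc_subset_Icc hn le_rfl)
      have hmem : n * δ ∈ Icc 0 (n * δ) := right_mem_Icc.2 hn
      obtain ⟨a1, a2, a3, a4⟩ := ih u v f g hu1 hv1 hMu hMv
      obtain ⟨b1, b2, b3, b4⟩ := hloc (n * δ) u v f g hu2 hv2
        (hu1.norm_le hb hb' hξ hσ hM hKM hMu hmem) (hv1.norm_le hb hb' hξ hσ hM hKM hMv hmem)
      have h1 : C * ‖u (n * δ) - v (n * δ)‖ₑ ≤ C * D * ‖u 0 - v 0‖ₑ := by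
        rw [mul_assoc]; exact mul_le_mul_right (a4 _ hmem) _
      refine ⟨?_, ?_, ?_, fun t ht => ?_⟩
      · exact (eLpNorm_four_Icc_le f 0 (n * δ) _).trans ((add_le_add a1 b1).trans le_self_add)
      · exact (eLpNorm_four_Icc_le g 0 (n * δ) _).trans ((add_le_add a2 b2).trans le_self_add)
      · refine (eLpNorm_four_Icc_le _ 0 (n * δ) _).trans ((add_le_add a3 (b3.trans h1)).trans ?_)
        rw [← add_mul]
        exact mul_le_mul_left (add_le_add le_self_add le_rfl) _
      · rcases le_total t (n * δ) with h | h
        · refine (a4 t ⟨ht.1, h⟩).trans (mul_le_mul_left ?_ _)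
          rw [add_assoc]; exact le_self_add
        · exact ((b4 t ⟨h, ht.2⟩).trans h1).trans (mul_le_mul_left le_add_self _)
  obtain ⟨n, hn⟩ := exists_nat_ge (T / δ)
  have hT : T ≤ n * δ := (div_le_iff₀ hδ).1 hn
  have hn0 : 0 ≤ n * δ := by positivity
  obtain ⟨D, hD, hDl⟩ := hind n
  -- The restricted norm is not assembled from pieces: the `L⁴` bounds on the whole interval are
  -- inserted once in the difference estimate.
  obtain ⟨E, hE, hdiff⟩ := exists_difference_estimate hb hb' ξ σ (n * δ + 1) (by linarith)
  refine ⟨n * δ, hT, hn0, D + E * (1 + (ENNReal.ofReal (n * δ) ^ (1 / 2 : ℝ) + D ^ 2 + D ^ 2) * D),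
    by finiteness, fun u v f g hu hv hMu hMv => ?_⟩
  obtain ⟨a1, a2, a3, a4⟩ := hDl u v f g hu hv hMu hMv
  obtain ⟨-, h2, -⟩ := hdiff 0 (n * δ) hn0 (by linarith) u v f g hu hv 0 (left_mem_Icc.2 hn0) _ rfl
  refine ⟨h2.trans ?_, fun t ht => (a4 t ht).trans (mul_le_mul_left le_self_add _)⟩
  rw [sub_zero]
  calc _ ≤ E * (‖u 0 - v 0‖ₑ + (ENNReal.ofReal (n * δ) ^ (1 / 2 : ℝ) + D ^ 2 + D ^ 2) *
        (D * ‖u 0 - v 0‖ₑ)) := by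
        refine mul_le_mul_right (add_le_add le_rfl (mul_le_mul' (add_le_add (add_le_add le_rfl ?_) ?_)
          a3)) _
        · exact pow_le_pow_left₀ zero_le a1 2
        · exact pow_le_pow_left₀ zero_le a2 2
    _ = E * (1 + (ENNReal.ofReal (n * δ) ^ (1 / 2 : ℝ) + D ^ 2 + D ^ 2) * D) * ‖u 0 - v 0‖ₑ := by ring
    _ ≤ _ := mul_le_mul_left le_add_self _

end

/-! ### The assertions of the theorem. -/

section
variable {ξ σ b : ℝ}

lemma uniqueness (hb : 1 / 2 < b) (hb' : b < 5 / 8) {I : Set ℝ} {u₀ : L2T} {u v : ℝ → L2T}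
    (hI : I.OrdConnected) (h0 : (0 : ℝ) ∈ I) (hu : IsSolutionOn ξ σ b I u₀ u)
    (hv : IsSolutionOn ξ σ b I u₀ v) : EqOn u v I := by
  intro t ht
  have hsub : Icc (min 0 t) (max 0 t) ⊆ I := hI.uIcc_subset h0 ht
  have h0' : (0 : ℝ) ∈ Icc (min 0 t) (max 0 t) := ⟨min_le_left _ _, le_max_left _ _⟩
  obtain ⟨f, hf⟩ := exists_isL4Solution hb hu hsub h0'
  obtain ⟨g, hg⟩ := exists_isL4Solution hb hv hsub h0'
  exact hf.eqOn hb hb' hg h0' ((hu.apply_zero h0).trans (hv.apply_zero h0).symm)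
    ⟨min_le_right _ _, le_max_right _ _⟩

lemma IsSolutionOn.exists_isL4Solution_Icc (hb : 1 / 2 < b) {u₀ : L2T} {u : ℝ → L2T}
    (hu : IsSolutionOn ξ σ b (Ici 0) u₀ u) {T : ℝ} (hT : 0 ≤ T) :
    ∃ f, IsL4Solution ξ σ 0 T u f :=
  exists_isL4Solution hb hu Icc_subset_Ici_self (left_mem_Icc.2 hT)

lemma exists_solution (hb : 1 / 2 < b) (hb' : b < 5 / 8) (hξ : 0 < ξ) (hσ : 0 < σ) (u₀ : L2T) :
    ∃ u : ℝ → L2T, IsSolutionOn ξ σ b (Ici 0) u₀ u := by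
  obtain ⟨u, hu0, hu⟩ := exists_global_solution hb hb' hξ hσ 0 u₀
  refine ⟨u, ?_⟩
  rw [← hu0]
  exact isSolutionOn_of_isL4Solution hb hb' le_rfl fun T _ => hu T

lemma exists_extension (hb : 1 / 2 < b) (hb' : b < 5 / 8) (hξ : 0 < ξ) (hσ : 0 < σ) {δ : ℝ}
    {u₀ : L2T} {v : ℝ → L2T} (hδ : 0 < δ) (hv : IsSolutionOn ξ σ b (Icc (-δ) δ) u₀ v) :
    ∃ u : ℝ → L2T, IsSolutionOn ξ σ b (Ici (-δ)) u₀ u ∧ EqOn u v (Icc (-δ) δ) := by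
  have h0 : (0 : ℝ) ∈ Icc (-δ) δ := ⟨by linarith, hδ.le⟩
  obtain ⟨g, hg⟩ := exists_isL4Solution hb hv le_rfl h0
  obtain ⟨w, hw0, hw⟩ := exists_global_solution hb hb' hξ hσ δ (v δ)
  classical
  have heq : ∀ t ≤ δ, (Iic δ).piecewise v w t = v t := fun t ht =>
    piecewise_eq_of_mem _ _ _ (mem_Iic.2 ht)
  refine ⟨(Iic δ).piecewise v w, ?_, fun t ht => heq t ht.2⟩
  rw [← hv.apply_zero h0, ← heq 0 hδ.le]
  -- The local solution is kept up to `δ` and then continued by the global solution with data `v δ`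
  -- at time `δ`.
  refine isSolutionOn_of_isL4Solution hb hb' (by linarith) fun T _ => ?_
  obtain ⟨f, hf⟩ := hw (max T δ)
  exact ⟨_, (hg.glue (by linarith) (le_max_right _ _) hf hw0.symm).mono
    (Icc_subset_Icc le_rfl (le_max_left _ _))⟩

lemma mass_bound (hb : 1 / 2 < b) (hb' : b < 5 / 8) (hξ : 0 < ξ) (hσ : 0 < σ) {u₀ : L2T}
    {u : ℝ → L2T} (hu : IsSolutionOn ξ σ b (Ici 0) u₀ u) {t : ℝ} (ht : 0 ≤ t) :
    ‖u t‖ ^ 2 ≤ ‖u₀‖ ^ 2 * Real.exp (-2 * ξ * t) +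
      2 * ξ / σ * (2 * π) * (1 - Real.exp (-2 * ξ * t)) := by
  obtain ⟨f, hf⟩ := hu.exists_isL4Solution_Icc hb ht
  have h := hf.sq_norm_le hb hb' hξ hσ (right_mem_Icc.2 ht)
  rwa [sub_zero, hu.apply_zero (mem_Ici.2 le_rfl)] at h

lemma exists_absorbing_time (hb : 1 / 2 < b) (hb' : b < 5 / 8) (hξ : 0 < ξ) (hσ : 0 < σ) {ρ : ℝ}
    (hρ : 2 * ξ / σ * (2 * π) < ρ) (M : ℝ) :
    ∃ t₀ ≥ (0 : ℝ), ∀ (u₀ : L2T) (u : ℝ → L2T),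
      ‖u₀‖ ≤ M → IsSolutionOn ξ σ b (Ici 0) u₀ u → ∀ t ≥ t₀, ‖u t‖ ^ 2 ≤ ρ := by
  have h1 : Tendsto (fun t : ℝ => M ^ 2 * Real.exp (-2 * ξ * t)) atTop (𝓝 (M ^ 2 * 0)) := by
    refine Tendsto.const_mul _ (Real.tendsto_exp_atBot.comp ?_)
    exact tendsto_id.const_mul_atTop_of_neg (by linarith)
  rw [mul_zero] at h1
  obtain ⟨t₁, ht₁⟩ := eventually_atTop.1 (h1.eventually_le_const (sub_pos.2 hρ))
  refine ⟨max t₁ 0, le_max_right _ _, fun u₀ u hM hu t ht => ?_⟩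
  have h2 := mass_bound hb hb' hξ hσ hu ((le_max_right _ _).trans ht)
  have h3 := ht₁ t ((le_max_left _ _).trans ht)
  have h4 := Real.exp_pos (-2 * ξ * t)
  have h5 : ‖u₀‖ ^ 2 ≤ M ^ 2 := pow_le_pow_left₀ (norm_nonneg _) hM 2
  have h6 := mul_le_mul_of_nonneg_right h5 h4.le
  have h7 : 0 ≤ 2 * ξ / σ * (2 * π) * Real.exp (-2 * ξ * t) := by positivity
  linarith

lemma continuous_dependence (hb : 1 / 2 < b) (hb' : b < 5 / 8) (hξ : 0 < ξ) (hσ : 0 < σ) {u₀ : L2T}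
    {u : ℝ → L2T} (hu : IsSolutionOn ξ σ b (Ici 0) u₀ u) (T : ℝ) {ε : ℝ} (hε : 0 < ε) :
    ∃ η > (0 : ℝ), ∀ (v₀ : L2T) (v : ℝ → L2T),
      IsSolutionOn ξ σ b (Ici 0) v₀ v → ‖v₀ - u₀‖ < η →
        (∀ t ∈ Icc 0 T, ‖v t - u t‖ < ε) ∧
        restrictedNorm b (Icc 0 T) (fun t => v t - u t) < ENNReal.ofReal ε := by
  set K := 2 * ξ / σ * (2 * π)
  have hK : 0 ≤ K := by positivity
  set M := ‖u₀‖ + K + 1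
  have hM : 0 ≤ M := by positivity
  have hKM : K ≤ M ^ 2 := by
    have : K + 1 ≤ M := by linarith [norm_nonneg u₀]
    nlinarith
  obtain ⟨T', hT, hT0, C, hC, hlip⟩ := exists_global_lipschitz hb hb' hξ hσ hM hKM T
  have hC1 : 0 < C.toReal + 1 := by positivity
  -- The bound `1` keeps `v₀` in the ball of radius `M`, which explains the `+ 1` in `M`. The `+ 1`
  -- in the denominator avoids dividing by zero and makes the final inequality strict.
  refine ⟨min 1 (ε / (C.toReal + 1)), by positivity, fun v₀ v hv hvu => ?_⟩
  obtain ⟨f, hf⟩ := hu.exists_isL4Solution_Icc hb hT0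
  obtain ⟨g, hg⟩ := hv.exists_isL4Solution_Icc hb hT0
  have hu0 := hu.apply_zero (mem_Ici.2 le_rfl)
  have hv0 := hv.apply_zero (mem_Ici.2 le_rfl)
  have hv₀ : ‖v₀‖ ≤ M := by
    have h1 := norm_le_norm_add_norm_sub' v₀ u₀
    have h2 := hvu.trans_le (min_le_left _ _)
    linarith
  obtain ⟨h1, h2⟩ := hlip v u g f hg hf (by rwa [hv0]) (by rw [hu0]; linarith)
  rw [hv0, hu0] at h1 h2
  have hsmall : C * ‖v₀ - u₀‖ₑ < ENNReal.ofReal ε := by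
    have h3 := (lt_div_iff₀ hC1).1 (hvu.trans_le (min_le_right _ _))
    rw [← ENNReal.ofReal_toReal hC, ← ofReal_norm, ← ENNReal.ofReal_mul ENNReal.toReal_nonneg,
      ENNReal.ofReal_lt_ofReal_iff hε]
    nlinarith [norm_nonneg (v₀ - u₀)]
  have hsub : Icc 0 T ⊆ Icc 0 T' := Icc_subset_Icc le_rfl hT
  refine ⟨fun t ht => ?_, ((restrictedNorm_mono hsub _).trans h1).trans_lt hsmall⟩
  have h3 := (h2 t (hsub ht)).trans_lt hsmall
  rwa [← ofReal_norm, ENNReal.ofReal_lt_ofReal_iff hε] at h3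

end

end

theorem mainTheorem2 (ξ σ b : ℝ) (hξ : 0 < ξ) (hσ : 0 < σ) (hb : 1 / 2 < b) (hb' : b < 5 / 8) :
    -- global existence
    (∀ u₀ : L2T, ∃ u : ℝ → L2T, IsSolutionOn ξ σ b (Ici 0) u₀ u) ∧
    -- uniqueness on every time interval containing `0`
    (∀ (I : Set ℝ) (u₀ : L2T) (u v : ℝ → L2T), I.OrdConnected → (0 : ℝ) ∈ I →
      IsSolutionOn ξ σ b I u₀ u → IsSolutionOn ξ σ b I u₀ v → EqOn u v I) ∧
    -- every local solution extends to all later times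
    (∀ (δ : ℝ) (u₀ : L2T) (v : ℝ → L2T), 0 < δ → IsSolutionOn ξ σ b (Icc (-δ) δ) u₀ v →
      ∃ u : ℝ → L2T, IsSolutionOn ξ σ b (Ici (-δ)) u₀ u ∧ EqOn u v (Icc (-δ) δ)) ∧
    -- continuous dependence on the data, in `C([0, T]; L²) ∩ X^{0,b}_{[0, T]}`
    (∀ (u₀ : L2T) (u : ℝ → L2T), IsSolutionOn ξ σ b (Ici 0) u₀ u →
      ∀ T > (0 : ℝ), ∀ ε > (0 : ℝ), ∃ η > (0 : ℝ), ∀ (v₀ : L2T) (v : ℝ → L2T),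
        IsSolutionOn ξ σ b (Ici 0) v₀ v → ‖v₀ - u₀‖ < η →
          (∀ t ∈ Icc 0 T, ‖v t - u t‖ < ε) ∧
          restrictedNorm b (Icc 0 T) (fun t => v t - u t) < ENNReal.ofReal ε) ∧
    -- the bound on the mass
    (∀ (u₀ : L2T) (u : ℝ → L2T), IsSolutionOn ξ σ b (Ici 0) u₀ u → ∀ t ≥ (0 : ℝ),
      ‖u t‖ ^ 2 ≤ ‖u₀‖ ^ 2 * Real.exp (-2 * ξ * t) +
        2 * ξ / σ * (2 * π) * (1 - Real.exp (-2 * ξ * t))) ∧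
    -- absorbing balls
    (∀ ρ > 2 * ξ / σ * (2 * π), ∀ M : ℝ, ∃ t₀ ≥ (0 : ℝ), ∀ (u₀ : L2T) (u : ℝ → L2T),
      ‖u₀‖ ≤ M → IsSolutionOn ξ σ b (Ici 0) u₀ u → ∀ t ≥ t₀, ‖u t‖ ^ 2 ≤ ρ) :=
  ⟨exists_solution hb hb' hξ hσ,
    fun _ _ _ _ hI h0 hu hv => uniqueness hb hb' hI h0 hu hv,
    fun _ _ _ hδ hv => exists_extension hb hb' hξ hσ hδ hv,
    fun _ _ hu T _ _ hε => continuous_dependence hb hb' hξ hσ hu T hε,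
    fun _ _ hu _ ht => mass_bound hb hb' hξ hσ hu ht,
    fun _ hρ M => exists_absorbing_time hb hb' hξ hσ hρ M⟩
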